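/- **Setting.** Let $G$ be a profinite group, $R$ a commutative ring, $M$ an $R$-module, and $H\le G$ an open subgroup. A truncation set $S$ for $H$ is a set of open subgroups of $H$, closed under $H$-conjugation and upwards closed among open subgroups of $H$. For $K\le H$ put $S|_K=\{U\in S: U\le K\}$ (a truncation set for $K$) and $S\smallsetminus K=\{U\in S: \text{no } H\text{-conjugate of } U \text{ lies in } K\}$ (a truncation set for $H$). Write $U^g=g^{-1}Ug$, and let $g\cdot(-):M^{\otimes_R G/U^g}\to M^{\otimes_R G/U}$ be induced by the bijection $aU^g\mapsto ag^{-1}U$. **Witt vectors.** Choose a representative of each $H$-conjugacy class in $S$; let $\underline S$ be the set of representatives. The ghost map $w:\prod_{V\in\underline S}M^{\otimes_R G/V}\to\prod_{U\in S}M^{\otimes_R G/U}$ has components $$w_U(n)=\sum_{V\in\underline S}\ \sum_{hV\in (H/V)^U} h\cdot f_{G/V}\bigl(n_V^{\otimes V/U^h}\bigr),$$ where $f_{G/V}:(M^{\otimes G/V})^{\otimes V/U}\cong M^{\otimes G/U}$ comes from a choice of coset representatives of $G/V$. The tensor powers are discrete and the product has the product topology. For a free commutative ring $T$ and a free $T$-module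 $Q$, $\mathrm{im}(w)$ is a subgroup. For arbitrary $(R;M)$ let $(\bar T;\bar Q)\rightrightarrows(T;Q)\to(R;M)$ be the canonical (free–forgetful) free resolution and let $W^S_{H\le G}(R;M)$ be the coequaliser of the two maps $\mathrm{im}(w)_{(\bar T;\bar Q)}\rightrightarrows\mathrm{im}(w)_{(T;Q)}$, that is, the quotient of $\mathrm{im}(w)_{(T;Q)}$ by the subgroup of all differences of the two maps, with the quotient topology. Its maximal Hausdorff quotient $\widehat W^S_{H\le G}(R;M)$ is the coequaliser in Hausdorff topological abelian groups. **Operators.** For open $K\le H$, $S'\subseteq S$ and $g\in G$ consider the formulas $V(a)_U=\sum_{hK\in(H/K)^U}h\cdot a_{U^h}$ (from $S|_K$ to $S$), $F(a)_U=a_U$ (from $S$ to $S|_K$), $R_{S'}(a)_U=a_U$ (from $S$ to $S'$), and $c_g(a)_U=g\cdot a_{U^g}$ (from $S$ to $gSg^{-1}$). Over $(T;Q)$ they map $\mathrm{im}(w)$ to $\mathrm{im}(w)$, and they induce homomorphisms $V_K^H$, $F_K^H$, $R_{S'}$, $c_g$ of the groups $W(R;M)$. If $S$ is finite then $W^S_{H\le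 G}(R;M)$ is Hausdorff. **Right exactness.** Let $K\le H$ be open. Then $V_K^H$ factors through a continuous homomorphism on the coinvariants under $c_n$, $n\in N_H(K)$, and in $$W^{S|_K}_{K\le G}(R;M)_{N_H(K)}\xrightarrow{V_K^H}W^S_{H\le G}(R;M)\xrightarrow{R_{S\smallsetminus K}}W^{S\smallsetminus K}_{H\le G}(R;M)\to0$$ one has $\mathrm{im}(V_K^H)=\ker(R_{S\smallsetminus K})$, and $R_{S\smallsetminus K}$ is a topological quotient map. On maximal Hausdorff quotients these maps induce continuous homomorphisms $\widehat V$ and $\widehat R$, where $\widehat R$ is a topological quotient map, $\overline{\mathrm{im}(\widehat V)}=\ker(\widehat R)$, and $\mathrm{im}(\widehat V)=\ker(\widehat R)$ whenever $W^{S\smallsetminus K}_{H\le G}(R;M)$ is Hausdorff (for example when $S\smallsetminus K$ is finite). **Truncation of Mackey functors.** Let $G$ be finite, $H\le G$, and $S$ a truncation set for $H$. Then $\underline W^S_G(R;M):K\mapsto W^{S|_K}_{K\le G}(R;M)$ ($K\le H$), with transfers $V$, restrictions $F$ and conjugations $c_h$, is an $H$-Mackey functor; let $\underline W_G(R;M)$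 be the $G$-Mackey functor given by the set of all subgroups of $G$. Let $\underline A^S$ be the $H$-Mackey functor $\underline\pi_0(\Sigma^\infty\tilde E\mathcal F(S))$, where $\mathcal F(S)$ is the family of subgroups of $H$ not in $S$; algebraically, $\underline A^S(K)$ is the Burnside group of $K$ modulo the subgroup spanned by the orbits $[K/U]$ with $U\notin S$. The $S$-truncation of a $G$-Mackey functor $\underline M$ is the box product $\underline M^S=\underline M\,\square\,\underline A^S$ of $H$-Mackey functors, where $\underline M$ is restricted to $H$. Then $\underline W^S_G(R;M)$ is the $S$-truncation of $\underline W_G(R;M)$: there is a universal pairing $\beta^S$ of the Mackey functors $\underline W_G(R;M)|_H$ and $\underline A^S$ with values in $\underline W^S_G(R;M)$. Under this identification the truncation maps agree: for all $K\le H$, $\beta^S_K(x,[K/K])=R_{S|_K}(x)$, and for truncation sets $S'\subseteq S$ the map $R_{S'|_K}$ corresponds to the map of box products induced by the projection $\underline A^S\to\underline A^{S'}$. -/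

import Mathlib

open scoped TensorProduct Topology

universe u v w w' w''

noncomputable section

namespace GWitt

/-! ### Conjugation of subgroups and truncation sets -/

/-- The subgroup `U ^ g = g⁻¹ U g`.  The conjugate `g U g⁻¹` is `rconj U g⁻¹`. -/
def rconj {G : Type v} [Group G] (U : Subgroup G) (g : G) : Subgroup G :=
  U.comap (MulAut.conj g).toMonoidHom

theorem mem_rconj {G : Type v} [Group G] {U : Subgroup G} {g x : G} :
    x ∈ rconj U g ↔ g * x * g⁻¹ ∈ U := Iff.rfl

theorem rconj_rconj {G : Type v} [Group G] (U : Subgroup G) (g h : G) :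
    rconj (rconj U g) h = rconj U (g * h) := by
  ext x
  simp [mem_rconj, mul_assoc]

theorem rconj_one {G : Type v} [Group G] (U : Subgroup G) : rconj U 1 = U := by
  ext x
  simp [mem_rconj]

theorem rconj_mono {G : Type v} [Group G] {U V : Subgroup G} (h : U ≤ V) (g : G) :
    rconj U g ≤ rconj V g := fun _ hx => h hx

theorem rconj_of_mem {G : Type v} [Group G] {U : Subgroup G} {g : G} (hg : g ∈ U) :
    rconj U g = U := by
  ext x
  rw [mem_rconj, U.mul_mem_cancel_right (U.inv_mem hg), U.mul_mem_cancel_left hg]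

theorem rconj_le {G : Type v} [Group G] {U H : Subgroup G} (h : U ≤ H) {g : G} (hg : g ∈ H) :
    rconj U g ≤ H := (rconj_mono h g).trans (rconj_of_mem hg).le

/-- A truncation set for `H`: a set of open subgroups of `H`, upwards closed and closed under
conjugation. -/
structure TruncationSet {G : Type v} [Group G] [TopologicalSpace G] (H : Subgroup G) where
  carrier : Set (Subgroup G)
  isOpen : ∀ U ∈ carrier, IsOpen (U : Set G)
  le : ∀ U ∈ carrier, U ≤ H
  up : ∀ U ∈ carrier, ∀ U' : Subgroup G, IsOpen (U' : Set G) → U ≤ U' → U' ≤ H → U' ∈ carrier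
  conj : ∀ U ∈ carrier, ∀ h ∈ H, rconj U h ∈ carrier

namespace TruncationSet

variable {G : Type v} [Group G] [TopologicalSpace G] {H : Subgroup G}

/-- The set of all open subgroups of `H`. -/
def all [IsTopologicalGroup G] (H : Subgroup G) : TruncationSet H where
  carrier := {U | IsOpen (U : Set G) ∧ U ≤ H}
  isOpen _ h := h.1
  le _ h := h.2
  up _ _ _ ho _ hl := ⟨ho, hl⟩
  conj U h g hg := ⟨h.1.preimage (f := fun x : G => g * x * g⁻¹) (by fun_prop),
    rconj_le h.2 hg⟩

/-- `S|_K`, the members of `S` contained in `K`. -/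
def restrict (S : TruncationSet H) (K : Subgroup G) (hK : K ≤ H) : TruncationSet K where
  carrier := {U | U ∈ S.carrier ∧ U ≤ K}
  isOpen U h := S.isOpen U h.1
  le _ h := h.2
  up U h U' ho hl hl' := ⟨S.up U h.1 U' ho hl (hl'.trans hK), hl'⟩
  conj U h k hk := ⟨S.conj U h.1 k (hK hk), rconj_le h.2 hk⟩

/-- `S ∖ K`, the members of `S` that are not subconjugate (in `H`) to `K`. -/
def diff (S : TruncationSet H) (K : Subgroup G) : TruncationSet H where
  carrier := {U | U ∈ S.carrier ∧ ¬ ∃ h ∈ H, rconj U h ≤ K}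
  isOpen U h := S.isOpen U h.1
  le U h := S.le U h.1
  up U h U' ho hl hl' := ⟨S.up U h.1 U' ho hl hl', fun ⟨g, hg, hgK⟩ =>
    h.2 ⟨g, hg, (rconj_mono hl g).trans hgK⟩⟩
  conj U h k hk := ⟨S.conj U h.1 k hk, fun ⟨g, hg, hgK⟩ =>
    h.2 ⟨k * g, H.mul_mem hk hg, by rwa [← rconj_rconj]⟩⟩

theorem diff_subset (S : TruncationSet H) (K : Subgroup G) :
    (S.diff K).carrier ⊆ S.carrier := fun _ h => h.1

theorem mem_restrict (S : TruncationSet H) (K : Subgroup G) (hK : K ≤ H) (U : Subgroup G) :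
    U ∈ (S.restrict K hK).carrier ↔ U ∈ S.carrier ∧ U ≤ K := Iff.rfl

theorem restrict_subset {S S' : TruncationSet H} (hS : S'.carrier ⊆ S.carrier) (K : Subgroup G)
    (hK : K ≤ H) : (S'.restrict K hK).carrier ⊆ (S.restrict K hK).carrier :=
  fun _ h => ⟨hS h.1, h.2⟩

theorem restrict_subset_all [IsTopologicalGroup G] (S : TruncationSet H) (K : Subgroup G)
    (hK : K ≤ H) :
    (S.restrict K hK).carrier ⊆ ((all (⊤ : Subgroup G)).restrict K le_top).carrier :=
  fun U h => ⟨⟨S.isOpen U h.1, le_top⟩, h.2⟩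

/-- `H`-conjugacy on the members of `S`. -/
def setoid (S : TruncationSet H) : Setoid S.carrier where
  r U V := ∃ h ∈ H, V.1 = rconj U.1 h
  iseqv :=
    { refl := fun U => ⟨1, H.one_mem, (rconj_one U.1).symm⟩
      symm := fun {U V} ⟨h, hh, e⟩ => ⟨h⁻¹, H.inv_mem hh, by
        rw [e, rconj_rconj, mul_inv_cancel, rconj_one]⟩
      trans := fun {U V W} ⟨h, hh, e⟩ ⟨k, hk, e'⟩ => ⟨h * k, H.mul_mem hh hk, by
        rw [e', e, rconj_rconj]⟩ }

/-- A choice of distinguished representative for each `H`-conjugacy class in `S`. -/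
def reps (S : TruncationSet H) : Set S.carrier :=
  Set.range (Quotient.out : Quotient S.setoid → S.carrier)

end TruncationSet

/-! ### Tensor powers -/

section Tensor

/-- `(⨂_X M) ⊗ ... ⊗ (⨂_X M) → ⨂_{X × Fin k} M` as a multilinear map. -/
def nestFin (R M X : Type*) [CommRing R] [AddCommGroup M] [Module R M] : ∀ k : ℕ,
    MultilinearMap R (fun _ : Fin k => ⨂[R] _ : X, M) (⨂[R] _ : X × Fin k, M)
  | 0 => MultilinearMap.constOfIsEmpty R _ (PiTensorProduct.tprod R fun p => p.2.elim0)
  | k + 1 =>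
    let e : X ⊕ X × Fin k ≃ X × Fin (k + 1) :=
      { toFun := Sum.elim (fun x => (x, 0)) (fun p => (p.1, p.2.succ))
        invFun := fun p => Fin.cases (Sum.inl p.1) (fun i => Sum.inr (p.1, i)) p.2
        left_inv := by rintro (x | ⟨x, i⟩) <;> rfl
        right_inv := by rintro ⟨x, i⟩; refine Fin.cases rfl (fun _ => rfl) i }
    let J : (⨂[R] _ : X, M) →ₗ[R] (⨂[R] _ : X × Fin k, M) →ₗ[R] ⨂[R] _ : X × Fin (k + 1), M :=
      (TensorProduct.mk R _ _).compr₂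
        ((PiTensorProduct.reindex R (fun _ => M) e).toLinearMap ∘ₗ
          (PiTensorProduct.tmulEquiv R M).toLinearMap)
    LinearMap.uncurryLeft
      { toFun := fun a => (J a).compMultilinearMap (nestFin R M X k)
        map_add' := fun a b => by ext; simp
        map_smul' := fun r a => by ext; simp }

theorem nestFin_tprod (R M X : Type*) [CommRing R] [AddCommGroup M] [Module R M] (k : ℕ)
    (m : Fin k → X → M) :
    nestFin R M X k (fun i => PiTensorProduct.tprod R (m i)) =
      PiTensorProduct.tprod R (fun p : X × Fin k => m p.2 p.1) := by
  induction k with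
  | zero =>
    simp only [nestFin, MultilinearMap.constOfIsEmpty_apply]
    change PiTensorProduct.tprod R _ = PiTensorProduct.tprod R _
    exact congrArg (PiTensorProduct.tprod R) (funext fun p : X × Fin 0 => p.2.elim0)
  | succ k ih =>
    simp only [nestFin, LinearMap.uncurryLeft_apply, LinearMap.coe_mk, AddHom.coe_mk,
      LinearMap.compMultilinearMap_apply, Fin.tail_def, ih, LinearMap.compr₂_apply,
      TensorProduct.mk_apply, LinearMap.comp_apply, LinearEquiv.coe_coe,
      PiTensorProduct.tmulEquiv_apply, PiTensorProduct.reindex_tprod]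
    congr 1
    ext ⟨x, i⟩
    refine Fin.cases rfl (fun _ => rfl) i

open Classical in
/-- The tensor power map `n ↦ n^{⊗ Y}` from `M^{⊗ X}` to `M^{⊗ (X × Y)}`, for a finite set `Y`
(for infinite `Y`, which does not occur, the value is `0`). -/
def tpow {R M X Y : Type*} [CommRing R] [AddCommGroup M] [Module R M]
    (n : ⨂[R] _ : X, M) : ⨂[R] _ : X × Y, M :=
  if h : Finite Y then
    PiTensorProduct.reindex R (fun _ => M)
      (Equiv.prodCongr (Equiv.refl X) (@Finite.equivFin Y h).symm)
      (nestFin R M X (Nat.card Y) fun _ => n)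
  else 0

/-- On pure tensors, `(⨂ m_x)^{⊗ Y} = ⨂_{(x, y)} m_x`. -/
theorem tpow_tprod {R M X Y : Type*} [CommRing R] [AddCommGroup M] [Module R M] [h : Finite Y]
    (m : X → M) : tpow (Y := Y) (PiTensorProduct.tprod R m) =
      PiTensorProduct.tprod R (fun p : X × Y => m p.1) := by
  rw [tpow, dif_pos h, nestFin_tprod, PiTensorProduct.reindex_tprod]
  rfl

/-- The map `M^{⊗_R X} → M'^{⊗_{R'} X}` induced by a morphism `(α; f) : (R; M) → (R'; M')` in
the category of all modules. -/
def tensorMap {R R' M M' : Type*} [CommRing R] [CommRing R'] [AddCommGroup M] [Module R M]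
    [AddCommGroup M'] [Module R' M'] (α : R →+* R') (f : M →ₛₗ[α] M') (X : Type*) :
    (⨂[R] _ : X, M) →+ (⨂[R'] _ : X, M') :=
  letI : Module R (⨂[R'] _ : X, M') := Module.compHom _ α
  (PiTensorProduct.lift (R := R)
    { toFun := fun m => PiTensorProduct.tprod R' (fun x => f (m x))
      map_update_add' := fun m i a b => by
        have key : ∀ c, (fun x => f (Function.update m i c x)) =
            Function.update (fun x => f (m x)) i (f c) := fun c => by
          ext x
          by_cases h : x = i
          · subst h; simp
          · simp [h]
        simp only [key, map_add, MultilinearMap.map_update_add]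
      map_update_smul' := fun m i r a => by
        have key : ∀ c, (fun x => f (Function.update m i c x)) =
            Function.update (fun x => f (m x)) i (f c) := fun c => by
          ext x
          by_cases h : x = i
          · subst h; simp
          · simp [h]
        simp only [key, LinearMap.map_smulₛₗ, MultilinearMap.map_update_smul]
        rfl } : (⨂[R] _ : X, M) →ₗ[R] (⨂[R'] _ : X, M')).toAddMonoidHom

theorem tensorMap_tprod {R R' M M' : Type*} [CommRing R] [CommRing R'] [AddCommGroup M]
    [Module R M] [AddCommGroup M'] [Module R' M'] (α : R →+* R') (f : M →ₛₗ[α] M') (X : Type*)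
    (m : X → M) : tensorMap α f X (PiTensorProduct.tprod R m) =
      PiTensorProduct.tprod R' (fun x => f (m x)) := by
  let _ : Module R (⨂[R'] _ : X, M') := Module.compHom _ α
  exact PiTensorProduct.lift.tprod _

end Tensor

/-- `M^{⊗_R G/U}`, regarded as a discrete topological abelian group. -/
def TP {G : Type v} [Group G] (R M : Type u) [CommRing R] [AddCommGroup M] [Module R M]
    (U : Subgroup G) : Type (max u v) :=
  ⨂[R] _ : G ⧸ U, M

section TP

variable {G : Type v} [Group G] (R M : Type u) [CommRing R] [AddCommGroup M] [Module R M]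

instance (U : Subgroup G) : AddCommGroup (TP R M U) :=
  inferInstanceAs (AddCommGroup (⨂[R] _ : G ⧸ U, M))

instance (U : Subgroup G) : TopologicalSpace (TP R M U) := ⊥

instance (U : Subgroup G) : DiscreteTopology (TP R M U) := ⟨rfl⟩

/-- The bijection `G/U^g ≃ G/U`, `a U^g ↦ a g⁻¹ U`. -/
def cosetEquiv (U : Subgroup G) (g : G) : G ⧸ rconj U g ≃ G ⧸ U where
  toFun := Quotient.map' (fun a => a * g⁻¹) fun a b h => by
    rw [QuotientGroup.leftRel_apply] at h ⊢
    simpa [mem_rconj, mul_assoc] using h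
  invFun := Quotient.map' (fun a => a * g) fun a b h => by
    rw [QuotientGroup.leftRel_apply] at h ⊢
    simpa [mem_rconj, mul_assoc] using h
  left_inv := by
    refine Quotient.ind' fun a => ?_
    simp [Quotient.map'_mk'']
  right_inv := by
    refine Quotient.ind' fun a => ?_
    simp [Quotient.map'_mk'']

variable {R M}

/-- The isomorphism `g · (-) : M^{⊗ G/U^g} → M^{⊗ G/U}` induced by `a U^g ↦ a g⁻¹ U`. -/
def act (g : G) (U : Subgroup G) : TP R M (rconj U g) →+ TP R M U :=
  (PiTensorProduct.reindex R (fun _ => M) (cosetEquiv U g)).toLinearMap.toAddMonoidHom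

/-- `f_{G/V}(n^{⊗ V/U})` for `U ≤ V`, where `f_{G/V}` is induced by the bijection
`G/V × V/U ≃ G/U`, `(g_i V, s U) ↦ g_i s U`, for a choice of coset representatives `g_i`. -/
def cosetPow {U V : Subgroup G} (h : U ≤ V) (n : TP R M V) : TP R M U :=
  PiTensorProduct.reindex R (fun _ => M) (Subgroup.quotientEquivProdOfLE h).symm
    (tpow (X := G ⧸ V) (Y := V ⧸ U.subgroupOf V) n)

end TP

/-! ### The ghost map -/

section Ghost

variable {G : Type v} [Group G] [TopologicalSpace G] {H : Subgroup G}

/-- The product `∏_{U ∈ S} M^{⊗_R G/U}`, with the product topology. The ghost group is its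
subgroup of `H`-fixed points; all families that occur below lie in that subgroup. -/
abbrev GhostProd (S : TruncationSet H) (R M : Type u) [CommRing R] [AddCommGroup M]
    [Module R M] : Type (max u v) :=
  ∀ U : S.carrier, TP R M U.1

open Classical in
/-- The ghost map `w`, with components
`w_U(n) = ∑_V ∑_{hV ∈ (H/V)^U} h · f_{G/V}(n_V^{⊗ V/U^h})`, where `V` runs over the
distinguished representatives. -/
def ghost (S : TruncationSet H) (R M : Type u) [CommRing R] [AddCommGroup M] [Module R M]
    (n : ∀ V : S.reps, TP R M V.1.1) : GhostProd S R M := fun U =>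
  ∑ᶠ V : S.reps, ∑ᶠ c : H ⧸ V.1.1.subgroupOf H,
    if h : rconj U.1 (c.out : G) ≤ V.1.1 then act (c.out : G) U.1 (cosetPow h (n V)) else 0

/-- The group generated by the image of the ghost map, with the subspace topology. (For free
coefficients, the only case in which it is used, the image of the ghost map is a subgroup.) -/
def ghostImage (S : TruncationSet H) (R M : Type u) [CommRing R] [AddCommGroup M]
    [Module R M] : AddSubgroup (GhostProd S R M) :=
  AddSubgroup.closure (Set.range (ghost S R M))

/-- The map on products induced by a morphism `(α; f)` of modules. -/
def ghostProdMap (S : TruncationSet H) {R M R' M' : Type u} [CommRing R] [AddCommGroup M]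
    [Module R M] [CommRing R'] [AddCommGroup M'] [Module R' M'] (α : R →+* R')
    (f : M →ₛₗ[α] M') : GhostProd S R M →+ GhostProd S R' M' where
  toFun a U := tensorMap α f (G ⧸ U.1) (a U)
  map_zero' := by funext U; exact map_zero _
  map_add' a b := by funext U; exact map_add _ _ _

end Ghost

/-! ### The canonical free resolution -/

section Free

/-- The free commutative ring on the underlying set of `R`. -/
abbrev FreeR (R : Type u) : Type u := MvPolynomial R ℤ

/-- The free `FreeR R`-module on the underlying set of `M`; the pair `(FreeR R; FreeM R M)` is
`FU(R; M)` for the free-forgetful adjunction between modules and pairs of sets. -/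
abbrev FreeM (R M : Type u) : Type u := M →₀ MvPolynomial R ℤ

/-- Ring part of the counit `FU(R; M) → (R; M)`. -/
def counitR (R : Type u) [CommRing R] : FreeR R →+* R :=
  MvPolynomial.eval₂Hom (Int.castRingHom R) id

/-- Module part of the counit `FU(R; M) → (R; M)`. -/
def counitM (R M : Type u) [CommRing R] [AddCommGroup M] [Module R M] :
    FreeM R M →ₛₗ[counitR R] M where
  toFun x := x.sum fun m c => counitR R c • m
  map_add' x y := Finsupp.sum_add_index' (by simp) (by simp [add_smul])
  map_smul' r x := by
    rw [Finsupp.sum_smul_index' (by simp), Finsupp.smul_sum]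
    simp [mul_smul]

/-- Ring part of `F(a, b)` for maps of sets `a : A → A'`, `b : B → B'`. -/
def freeMapR {A A' : Type u} (a : A → A') : MvPolynomial A ℤ →+* MvPolynomial A' ℤ :=
  (MvPolynomial.rename a).toRingHom

/-- Module part of `F(a, b)` for maps of sets `a : A → A'`, `b : B → B'`. -/
def freeMapM {A A' B B' : Type u} (a : A → A') (b : B → B') :
    (B →₀ MvPolynomial A ℤ) →ₛₗ[freeMapR a] (B' →₀ MvPolynomial A' ℤ) where
  toFun x := x.sum fun y c => Finsupp.single (b y) (freeMapR a c)
  map_add' x y := Finsupp.sum_add_index' (by simp) (by simp)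
  map_smul' r x := by
    rw [Finsupp.sum_smul_index' (by simp), Finsupp.smul_sum]
    simp

end Free

/-! ### Witt vectors -/

section Witt

variable {G : Type v} [Group G] [TopologicalSpace G] {H : Subgroup G}

/-- The subgroup `{f_*(a) - g_*(a)}` of `im(w)` over `FU(R; M)`, where `a` runs over `im(w)` over
`FUFU(R; M)` and `f, g : FUFU(R; M) ⇉ FU(R; M)` is the canonical free resolution of `(R; M)`:
`f` is the counit of `FU(R; M)` and `g` is `FU` of the counit of `(R; M)`. -/
def resolutionRel (S : TruncationSet H) (R M : Type u) [CommRing R] [AddCommGroup M]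
    [Module R M] : AddSubgroup (GhostProd S (FreeR R) (FreeM R M)) :=
  (ghostImage S (FreeR (FreeR R)) (FreeM (FreeR R) (FreeM R M))).map
    (ghostProdMap S (counitR (FreeR R)) (counitM (FreeR R) (FreeM R M)) -
      ghostProdMap S (freeMapR (counitR R)) (freeMapM (counitR R) (counitM R M)))

/-- The `S`-truncated `G`-typical Witt vectors `W^S_{H ≤ G}(R; M)`: the coequaliser of
`im(w) ⇉ im(w)` along the canonical free resolution of `(R; M)`, with the quotient topology.
Its Hausdorff quotient `SeparationQuotient (Witt S R M)` is the coequaliser in Hausdorff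
topological abelian groups. -/
def Witt (S : TruncationSet H) (R M : Type u) [CommRing R] [AddCommGroup M] [Module R M] :
    Type (max u v) :=
  ghostImage S (FreeR R) (FreeM R M) ⧸
    (resolutionRel S R M).addSubgroupOf (ghostImage S (FreeR R) (FreeM R M))

variable (S : TruncationSet H) (R M : Type u) [CommRing R] [AddCommGroup M] [Module R M]

instance (U : Subgroup G) : IsTopologicalAddGroup (TP R M U) where
  continuous_add := continuous_of_discreteTopology
  continuous_neg := continuous_of_discreteTopology

instance : AddCommGroup (Witt S R M) :=
  inferInstanceAs (AddCommGroup (_ ⧸ (resolutionRel S R M).addSubgroupOf _))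

instance : TopologicalSpace (Witt S R M) :=
  inferInstanceAs (TopologicalSpace (_ ⧸ (resolutionRel S R M).addSubgroupOf _))

instance : IsTopologicalAddGroup (Witt S R M) :=
  inferInstanceAs (IsTopologicalAddGroup (_ ⧸ (resolutionRel S R M).addSubgroupOf _))

variable {S R M}

/-- The class in `W^S_{H ≤ G}(R; M)` of an element of `im(w)` over `FU(R; M)`. -/
def Witt.mk (a : ghostImage S (FreeR R) (FreeM R M)) : Witt S R M :=
  QuotientAddGroup.mk a

end Witt

/-! ### Operators -/

section Operators

variable {G : Type v} [Group G] [TopologicalSpace G] {H K : Subgroup G}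

section GhostOperators

variable {R M : Type u} [CommRing R] [AddCommGroup M] [Module R M]

open Classical in
/-- The ghost Verschiebung, `V(a)_W = ∑_{hK ∈ (H/K)^W} h · a_{W^h}`. -/
def ghostVer (S : TruncationSet H) (S' : TruncationSet K)
    (hS : ∀ U, U ∈ S'.carrier ↔ U ∈ S.carrier ∧ U ≤ K)
    (a : GhostProd S' R M) : GhostProd S R M := fun U =>
  ∑ᶠ c : H ⧸ K.subgroupOf H,
    if h : rconj U.1 (c.out : G) ≤ K then
      act (c.out : G) U.1 (a ⟨rconj U.1 (c.out : G), (hS _).2 ⟨S.conj _ U.2 _ c.out.2, h⟩⟩)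
    else 0

/-- The ghost Frobenius, the projection to the components of `S|_K`. -/
def ghostFrob (S : TruncationSet H) (S' : TruncationSet K)
    (hS : ∀ U, U ∈ S'.carrier ↔ U ∈ S.carrier ∧ U ≤ K)
    (a : GhostProd S R M) : GhostProd S' R M := fun U => a ⟨U.1, ((hS _).1 U.2).1⟩

/-- The ghost conjugation, `c_g(a)_U = g · a_{U^g}`, to the conjugate truncation set
`S' = gSg⁻¹`. -/
def ghostConj (g : G) (S : TruncationSet H) (S' : TruncationSet K)
    (hS : ∀ U, U ∈ S'.carrier ↔ rconj U g ∈ S.carrier)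
    (a : GhostProd S R M) : GhostProd S' R M := fun U =>
  act g U.1 (a ⟨rconj U.1 g, (hS _).1 U.2⟩)

/-- The ghost truncation, the projection to the components of `S' ⊆ S`. -/
def ghostTrunc (S S' : TruncationSet H) (hS : S'.carrier ⊆ S.carrier)
    (a : GhostProd S R M) : GhostProd S' R M := fun U => a ⟨U.1, hS U.2⟩

end GhostOperators

variable {R M : Type u} [CommRing R] [AddCommGroup M] [Module R M]

/-- `Φ` is the operator on Witt vectors that extends the restriction of the ghost operator `θ`
to free coefficients: `θ` maps `im(w)` to `im(w)` over `FU(R; M)`, and `Φ` is the induced map on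
coequalisers. -/
def IsInduced {S : TruncationSet H} {S' : TruncationSet K}
    (θ : GhostProd S (FreeR R) (FreeM R M) → GhostProd S' (FreeR R) (FreeM R M))
    (Φ : Witt S R M →+ Witt S' R M) : Prop :=
  ∀ a : ghostImage S (FreeR R) (FreeM R M), ∃ h : θ a ∈ ghostImage S' (FreeR R) (FreeM R M),
    Φ (Witt.mk a) = Witt.mk ⟨θ a, h⟩

open Classical in
/-- The operator on Witt vectors induced by a ghost operator `θ` (and `0` if there is none). -/
def wittOp {S : TruncationSet H} {S' : TruncationSet K}
    (θ : GhostProd S (FreeR R) (FreeM R M) → GhostProd S' (FreeR R) (FreeM R M)) :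
    Witt S R M →+ Witt S' R M :=
  if h : ∃ Φ : Witt S R M →+ Witt S' R M, IsInduced θ Φ then h.choose else 0

variable (R M)

/-- The Verschiebung `V_K^H`, for `S' = S|_K`. -/
def ver (S : TruncationSet H) (S' : TruncationSet K)
    (hS : ∀ U, U ∈ S'.carrier ↔ U ∈ S.carrier ∧ U ≤ K) : Witt S' R M →+ Witt S R M :=
  wittOp (ghostVer S S' hS)

/-- The Frobenius `F_K^H`, for `S' = S|_K`. -/
def frob (S : TruncationSet H) (S' : TruncationSet K)
    (hS : ∀ U, U ∈ S'.carrier ↔ U ∈ S.carrier ∧ U ≤ K) : Witt S R M →+ Witt S' R M :=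
  wittOp (ghostFrob S S' hS)

/-- The conjugation `c_g`, for `S' = gSg⁻¹`. -/
def conjOp (g : G) (S : TruncationSet H) (S' : TruncationSet K)
    (hS : ∀ U, U ∈ S'.carrier ↔ rconj U g ∈ S.carrier) : Witt S R M →+ Witt S' R M :=
  wittOp (ghostConj g S S' hS)

/-- The truncation `R_{S'}`, for `S' ⊆ S`. -/
def trunc (S S' : TruncationSet H) (hS : S'.carrier ⊆ S.carrier) :
    Witt S R M →+ Witt S' R M :=
  wittOp (ghostTrunc S S' hS)

theorem restrict_conj (S : TruncationSet H) (hK : K ≤ H) {n : G} (hn : n ∈ H)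
    (hnK : rconj K n = K) (U : Subgroup G) :
    U ∈ (S.restrict K hK).carrier ↔ rconj U n ∈ (S.restrict K hK).carrier := by
  have key : ∀ (n : G) (U : Subgroup G), n ∈ H → rconj K n = K →
      U ∈ (S.restrict K hK).carrier → rconj U n ∈ (S.restrict K hK).carrier :=
    fun n U hn hnK h => ⟨S.conj U h.1 n hn, (rconj_mono h.2 n).trans hnK.le⟩
  refine ⟨key n U hn hnK, fun h => ?_⟩
  have := key n⁻¹ _ (H.inv_mem hn) (by
    conv_lhs => rw [← hnK]
    rw [rconj_rconj, mul_inv_cancel, rconj_one]) h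
  rwa [rconj_rconj, mul_inv_cancel, rconj_one] at this

/-- The orbits `W^{S|_K}_{K ≤ G}(R; M)_{N_H(K)}`: the quotient by the subgroup generated by the
elements `c_n(x) - x` with `n ∈ N_H(K)`. -/
abbrev WeylOrbits (S : TruncationSet H) (hK : K ≤ H) : Type (max u v) :=
  Witt (S.restrict K hK) R M ⧸ AddSubgroup.closure
    {y | ∃ (n : G) (hn : n ∈ H) (hnK : rconj K n = K) (x : Witt (S.restrict K hK) R M),
      y = conjOp R M n _ _ (restrict_conj S hK hn hnK) x - x}

end Operators

/-! ### Mackey functors -/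

section Mackey

/-- The subgroups of `H`. -/
abbrev Subgp {G : Type v} [Group G] (H : Subgroup G) : Type v := {K : Subgroup G // K ≤ H}

/-- The data of an `H`-Mackey functor: abelian groups `M(K)` for `K ≤ H`, transfers,
restrictions and conjugations. The axioms are in `MackeyData.IsMackey`. -/
structure MackeyData {G : Type v} [Group G] (H : Subgroup G) where
  obj : Subgp H → Type w
  [grp : ∀ K, AddCommGroup (obj K)]
  tr : ∀ {K L : Subgp H}, K.1 ≤ L.1 → obj K →+ obj L
  res : ∀ {K L : Subgp H}, K.1 ≤ L.1 → obj L →+ obj K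
  /-- The conjugation `c_h : M(K) → M(L)` for `h ∈ H` and `L = hKh⁻¹`. -/
  conj : ∀ (h : G) {K L : Subgp H}, h ∈ H → L.1 = rconj K.1 h⁻¹ →
    obj K →+ obj L

attribute [instance] MackeyData.grp

variable {G : Type v} [Group G] {H : Subgroup G}

theorem inf_rconj (J K : Subgroup G) (x : G) :
    J ⊓ rconj K x⁻¹ = rconj (rconj J x ⊓ K) x⁻¹ := by
  ext y
  simp [mem_rconj, Subgroup.mem_inf, mul_assoc]

namespace MackeyData

/-- The axioms of a Mackey functor. -/
structure IsMackey (M : MackeyData.{v, w} H) : Prop where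
  tr_self : ∀ (K : Subgp H) (x : M.obj K), M.tr (le_refl K.1) x = x
  res_self : ∀ (K : Subgp H) (x : M.obj K), M.res (le_refl K.1) x = x
  conj_self : ∀ (K : Subgp H) (h : G) (hK : h ∈ K.1) (e : K.1 = rconj K.1 h⁻¹) (x : M.obj K),
    M.conj h (K.2 hK) e x = x
  tr_tr : ∀ {J K L : Subgp H} (h : J.1 ≤ K.1) (h' : K.1 ≤ L.1) (x : M.obj J),
    M.tr h' (M.tr h x) = M.tr (h.trans h') x
  res_res : ∀ {J K L : Subgp H} (h : J.1 ≤ K.1) (h' : K.1 ≤ L.1) (x : M.obj L),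
    M.res h (M.res h' x) = M.res (h.trans h') x
  conj_conj : ∀ {J K L : Subgp H} (g h : G) (hg : g ∈ H) (hh : h ∈ H) (e : K.1 = rconj J.1 h⁻¹)
    (e' : L.1 = rconj K.1 g⁻¹) (e'' : L.1 = rconj J.1 (g * h)⁻¹) (x : M.obj J),
    M.conj g hg e' (M.conj h hh e x) = M.conj (g * h) (H.mul_mem hg hh) e'' x
  conj_tr : ∀ {K L K' L' : Subgp H} (h : G) (hh : h ∈ H) (e : K'.1 = rconj K.1 h⁻¹)
    (e' : L'.1 = rconj L.1 h⁻¹) (i : K.1 ≤ L.1) (i' : K'.1 ≤ L'.1) (x : M.obj K),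
    M.conj h hh e' (M.tr i x) = M.tr i' (M.conj h hh e x)
  conj_res : ∀ {K L K' L' : Subgp H} (h : G) (hh : h ∈ H) (e : K'.1 = rconj K.1 h⁻¹)
    (e' : L'.1 = rconj L.1 h⁻¹) (i : K.1 ≤ L.1) (i' : K'.1 ≤ L'.1) (x : M.obj L),
    M.conj h hh e (M.res i x) = M.res i' (M.conj h hh e' x)
  /-- The double coset formula
  `res^L_J tr^L_K = ∑_{JxK} tr^J_{J ∩ xKx⁻¹} c_x res^K_{x⁻¹Jx ∩ K}`. -/
  res_tr : ∀ {J K L : Subgp H} (hJ : J.1 ≤ L.1) (hK : K.1 ≤ L.1) (x : M.obj K),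
    M.res hJ (M.tr hK x) =
      ∑ᶠ d : DoubleCoset.Quotient (J.1.subgroupOf L.1 : Set L.1) (K.1.subgroupOf L.1),
        M.tr (K := ⟨J.1 ⊓ rconj K.1 (d.out : G)⁻¹, inf_le_left.trans J.2⟩) inf_le_left
          (M.conj (d.out : G) (K := ⟨rconj J.1 (d.out : G) ⊓ K.1, inf_le_right.trans K.2⟩)
            (L.2 d.out.2) (inf_rconj J.1 K.1 (d.out : G))
            (M.res inf_le_right x))

/-- The underlying `H`-Mackey functor of an `H'`-Mackey functor. -/
def restrict {H' : Subgroup G} (M : MackeyData.{v, w} H') (hH : H ≤ H') :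
    MackeyData.{v, w} H where
  obj K := M.obj ⟨K.1, K.2.trans hH⟩
  tr i := M.tr i
  res i := M.res i
  conj h _ _ hh e := M.conj h (hH hh) e

/-- Morphisms of Mackey functors. -/
structure IsHom {M : MackeyData.{v, w} H} {N : MackeyData.{v, w} H}
    (φ : ∀ K, M.obj K →+ N.obj K) : Prop where
  tr : ∀ {K L : Subgp H} (i : K.1 ≤ L.1) (x : M.obj K), φ L (M.tr i x) = N.tr i (φ K x)
  res : ∀ {K L : Subgp H} (i : K.1 ≤ L.1) (x : M.obj L), φ K (M.res i x) = N.res i (φ L x)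
  conj : ∀ {K L : Subgp H} (h : G) (hh : h ∈ H) (e : L.1 = rconj K.1 h⁻¹) (x : M.obj K),
    φ L (M.conj h hh e x) = N.conj h hh e (φ K x)

/-- Pairings `(M, N) → P` of Mackey functors. -/
structure IsPairing {M : MackeyData.{v, w} H} {N : MackeyData.{v, w'} H}
    {P : MackeyData.{v, w''} H} (β : ∀ K, M.obj K →+ N.obj K →+ P.obj K) : Prop where
  res : ∀ {K L : Subgp H} (i : K.1 ≤ L.1) (m : M.obj L) (n : N.obj L),
    P.res i (β L m n) = β K (M.res i m) (N.res i n)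
  conj : ∀ {K L : Subgp H} (h : G) (hh : h ∈ H) (e : L.1 = rconj K.1 h⁻¹) (m : M.obj K)
    (n : N.obj K), P.conj h hh e (β K m n) = β L (M.conj h hh e m) (N.conj h hh e n)
  tr_left : ∀ {K L : Subgp H} (i : K.1 ≤ L.1) (m : M.obj K) (n : N.obj L),
    P.tr i (β K m (N.res i n)) = β L (M.tr i m) n
  tr_right : ∀ {K L : Subgp H} (i : K.1 ≤ L.1) (m : M.obj L) (n : N.obj K),
    P.tr i (β K (M.res i m) n) = β L m (N.tr i n)

/-- `P` is the box product `M □ N` of Mackey functors, by means of the pairing `β`: every pairing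
of `M` and `N` with values in a Mackey functor `Q` is induced from `β` by a unique morphism
`P → Q`. -/
structure IsBoxProduct (M : MackeyData.{v, w} H) (N : MackeyData.{v, w'} H)
    (P : MackeyData.{v, max w w'} H) (β : ∀ K, M.obj K →+ N.obj K →+ P.obj K) : Prop where
  isMackey : P.IsMackey
  isPairing : IsPairing β
  existsUnique : ∀ (Q : MackeyData.{v, max w w'} H), Q.IsMackey →
    ∀ γ : ∀ K, M.obj K →+ N.obj K →+ Q.obj K, IsPairing γ →
      ∃! φ : ∀ K, P.obj K →+ Q.obj K, IsHom φ ∧ ∀ K m n, φ K (β K m n) = γ K m n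

end MackeyData

end Mackey

/-! ### Truncations of the Burnside Mackey functor -/

section Burnside

variable {G : Type v} [Group G] [TopologicalSpace G] {H : Subgroup G}

/-- The relations `[K/U] = [K/kUk⁻¹]` for `k ∈ K`, and `[K/U] = 0` for `U ∉ S`. -/
def burnRel (S : TruncationSet H) (K : Subgroup G) : AddSubgroup (FreeAbelianGroup (Subgp K)) :=
  AddSubgroup.closure
    ({x | ∃ U V : Subgp K, (∃ k ∈ K, V.1 = rconj U.1 k) ∧
        x = FreeAbelianGroup.of U - FreeAbelianGroup.of V} ∪
      {x | ∃ U : Subgp K, U.1 ∉ S.carrier ∧ x = FreeAbelianGroup.of U})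

/-- The value at `K` of the Mackey functor `π₀(Σ^∞ ẼF(S))`, where `F(S)` is the family of
subgroups of `H` that are not in `S`: the Burnside group of `K` (the free abelian group on the
orbits `[K/U]` up to isomorphism) modulo the image of `π₀(Σ^∞ EF(S)_+)`, which is spanned by the
orbits with isotropy in `F(S)`. For `S` the set of all subgroups it is the Burnside group. -/
def Burn (S : TruncationSet H) (K : Subgroup G) : Type v :=
  FreeAbelianGroup (Subgp K) ⧸ burnRel S K

instance (S : TruncationSet H) (K : Subgroup G) : AddCommGroup (Burn S K) :=
  inferInstanceAs (AddCommGroup (_ ⧸ burnRel S K))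

/-- The class `[K/U]`. -/
def Burn.cls (S : TruncationSet H) {K : Subgroup G} (U : Subgp K) : Burn S K :=
  QuotientAddGroup.mk (FreeAbelianGroup.of U)

theorem Burn.cls_conj (S : TruncationSet H) {K : Subgroup G} (U V : Subgp K) (k : G) (hk : k ∈ K)
    (h : V.1 = rconj U.1 k) : Burn.cls S U = Burn.cls S V := by
  refine (QuotientAddGroup.eq_iff_sub_mem).2 ?_
  exact AddSubgroup.subset_closure (Or.inl ⟨U, V, ⟨k, hk, h⟩, rfl⟩)

theorem Burn.cls_eq_zero (S : TruncationSet H) {K : Subgroup G} (U : Subgp K)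
    (h : U.1 ∉ S.carrier) : Burn.cls S U = 0 :=
  (QuotientAddGroup.eq_zero_iff _).2 (AddSubgroup.subset_closure (Or.inr ⟨U, h, rfl⟩))

/-- Homomorphisms out of `Burn S K` are given on orbits. -/
def Burn.lift (S : TruncationSet H) {K : Subgroup G} {A : Type*} [AddCommGroup A]
    (f : Subgp K → A) (h₁ : ∀ U V : Subgp K, ∀ k ∈ K, V.1 = rconj U.1 k → f U = f V)
    (h₂ : ∀ U : Subgp K, U.1 ∉ S.carrier → f U = 0) : Burn S K →+ A :=
  QuotientAddGroup.lift (burnRel S K) (FreeAbelianGroup.lift f) <| by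
    refine (AddSubgroup.closure_le _).2 ?_
    rintro x (⟨U, V, ⟨k, hk, h⟩, rfl⟩ | ⟨U, h, rfl⟩)
    · simp [h₁ U V k hk h]
    · simp [h₂ U h]

theorem Burn.lift_cls (S : TruncationSet H) {K : Subgroup G} {A : Type*} [AddCommGroup A]
    (f : Subgp K → A) (h₁ : ∀ U V : Subgp K, ∀ k ∈ K, V.1 = rconj U.1 k → f U = f V)
    (h₂ : ∀ U : Subgp K, U.1 ∉ S.carrier → f U = 0) (U : Subgp K) :
    Burn.lift S f h₁ h₂ (Burn.cls S U) = f U :=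
  FreeAbelianGroup.lift_apply_of f U

/-- Induction `[K/U] ↦ [L/U]`. -/
def Burn.tr (S : TruncationSet H) {K L : Subgroup G} (i : K ≤ L) : Burn S K →+ Burn S L :=
  Burn.lift S (fun U => Burn.cls S ⟨U.1, U.2.trans i⟩)
    (fun _ _ k hk h => Burn.cls_conj S _ _ k (i hk) h)
    (fun _ h => Burn.cls_eq_zero S _ h)

/-- Conjugation `[K/U] ↦ [hKh⁻¹/hUh⁻¹]`. -/
def Burn.conj (S : TruncationSet H) {K L : Subgroup G} (h : G) (hh : h ∈ H)
    (e : L = rconj K h⁻¹) : Burn S K →+ Burn S L :=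
  Burn.lift S (fun U => Burn.cls S ⟨rconj U.1 h⁻¹, e ▸ rconj_mono U.2 h⁻¹⟩)
    (fun U V k hk hV => Burn.cls_conj S _ _ (h * k * h⁻¹)
      (by rw [e, mem_rconj]; simpa [mul_assoc] using hk)
      (by simp only [hV, rconj_rconj]; congr 1; group))
    (fun U hU => Burn.cls_eq_zero S _ fun hS => hU (by
      have := S.conj _ hS h hh
      rwa [rconj_rconj, inv_mul_cancel, rconj_one] at this))

/-- The restriction of the `L`-set `L/U` to `J`: the sum over the double cosets `JxU` in `L` of
the orbits `[J/(J ∩ xUx⁻¹)]`. -/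
def Burn.resOrbit (S : TruncationSet H) (J : Subgroup G) {L : Subgroup G} (U : Subgp L) :
    Burn S J :=
  ∑ᶠ d : DoubleCoset.Quotient (J.subgroupOf L : Set L) (U.1.subgroupOf L),
    Burn.cls S (⟨J ⊓ rconj U.1 (d.out : G)⁻¹, inf_le_left⟩ : Subgp J)

theorem Burn.resOrbit_conj (S : TruncationSet H) {J L : Subgroup G} (U V : Subgp L)
    (l : G) (hl : l ∈ L) (h : V.1 = rconj U.1 l) :
    Burn.resOrbit S J U = Burn.resOrbit S J V := by
  have hmap : ∀ (A B : Subgroup G) (l : L), B = rconj A l → ∀ a b : L,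
      (DoubleCoset.setoid (J.subgroupOf L : Set L) (A.subgroupOf L)) a b →
      (DoubleCoset.setoid (J.subgroupOf L : Set L) (B.subgroupOf L)) (a * l) (b * l) := by
    intro A B l hB a b hab
    rw [DoubleCoset.rel_iff] at hab ⊢
    obtain ⟨j, hj, u, hu, rfl⟩ := hab
    refine ⟨j, hj, l⁻¹ * u * l, ?_, by group⟩
    rw [hB, Subgroup.mem_subgroupOf, mem_rconj]
    simpa [mul_assoc] using Subgroup.mem_subgroupOf.1 hu
  have h' : U.1 = rconj V.1 ((⟨l, hl⟩ : L)⁻¹ : L) := by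
    simp [h, rconj_rconj, rconj_one]
  let e : DoubleCoset.Quotient (J.subgroupOf L : Set L) (U.1.subgroupOf L) ≃
      DoubleCoset.Quotient (J.subgroupOf L : Set L) (V.1.subgroupOf L) :=
    { toFun := Quotient.map (· * ⟨l, hl⟩) (hmap _ _ ⟨l, hl⟩ h)
      invFun := Quotient.map (· * (⟨l, hl⟩ : L)⁻¹) (hmap _ _ _ h')
      left_inv := by refine Quotient.ind fun a => ?_; simp; rfl
      right_inv := by refine Quotient.ind fun a => ?_; simp; rfl }
  refine finsum_eq_of_bijective e e.bijective fun d => ?_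
  have hd : (DoubleCoset.setoid (J.subgroupOf L : Set L) (V.1.subgroupOf L))
      (d.out * ⟨l, hl⟩) (e d).out := by
    exact Quotient.exact (Eq.trans (congrArg e (Quotient.out_eq d)) (Quotient.out_eq (e d)).symm)
  rw [DoubleCoset.rel_iff] at hd
  obtain ⟨j, hj, u, hu, hd⟩ := hd
  refine Burn.cls_conj S _ _ (j⁻¹ : L) (J.inv_mem hj) ?_
  have hu' : rconj V.1 (u : G)⁻¹ = V.1 := rconj_of_mem (V.1.inv_mem hu)
  have hj' : rconj J ((j⁻¹ : L) : G) = J := rconj_of_mem (J.inv_mem hj)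
  have e1 : rconj V.1 (((e d).out : L) : G)⁻¹ = rconj (rconj U.1 (d.out : G)⁻¹) ((j⁻¹ : L) : G) := by
    rw [hd]
    have : ((j * (d.out * ⟨l, hl⟩) * u : L) : G)⁻¹ = (u : G)⁻¹ * (l⁻¹ * (d.out : G)⁻¹ * (j : G)⁻¹) := by
      simp [mul_assoc]
    rw [this, ← rconj_rconj, hu', h, rconj_rconj, rconj_rconj]
    congr 1
    simp [mul_assoc]
  change J ⊓ rconj V.1 _ = rconj (J ⊓ rconj U.1 _) _
  rw [e1]
  exact congrArg (· ⊓ rconj (rconj U.1 (d.out : G)⁻¹) ((j⁻¹ : L) : G)) hj'.symm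

theorem Burn.resOrbit_eq_zero [IsTopologicalGroup G] (S : TruncationSet H) {J L : Subgroup G}
    (hL : L ≤ H) (U : Subgp L) (hU : U.1 ∉ S.carrier) : Burn.resOrbit S J U = 0 := by
  refine finsum_eq_zero_of_forall_eq_zero fun d => Burn.cls_eq_zero S _ fun hS => hU ?_
  have hd : (d.out : G) ∈ H := hL d.out.2
  have h1 : rconj U.1 (d.out : G)⁻¹ ∈ S.carrier :=
    S.up _ hS _ (Subgroup.isOpen_mono inf_le_right (S.isOpen _ hS)) inf_le_right
      (rconj_le (U.2.trans hL) (H.inv_mem hd))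
  have := S.conj _ h1 _ hd
  rwa [rconj_rconj, inv_mul_cancel, rconj_one] at this

/-- The Mackey functor `π₀(Σ^∞ ẼF(S))`, a quotient of the Burnside Mackey functor. -/
def burnside [IsTopologicalGroup G] (S : TruncationSet H) : MackeyData.{v, v} H where
  obj K := Burn S K.1
  tr i := Burn.tr S i
  res {K L} _ := Burn.lift S (Burn.resOrbit S K.1)
    (fun _ _ k hk h => Burn.resOrbit_conj S _ _ k hk h)
    (fun U h => Burn.resOrbit_eq_zero S L.2 U h)
  conj h _ _ hh e := Burn.conj S h hh e

/-- The projection `π₀(Σ^∞ ẼF(S)) → π₀(Σ^∞ ẼF(S'))` for `S' ⊆ S`, `[K/U] ↦ [K/U]`. -/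
def Burn.proj (S S' : TruncationSet H) (hS : S'.carrier ⊆ S.carrier) (K : Subgroup G) :
    Burn S K →+ Burn S' K :=
  Burn.lift S (fun U => Burn.cls S' U) (fun _ _ k hk h => Burn.cls_conj S' _ _ k hk h)
    (fun _ h => Burn.cls_eq_zero S' _ fun h' => h (hS h'))

end Burnside

/-! ### The Witt vector Mackey functor and truncation of Mackey functors -/

section WittMackey

variable {G : Type v} [Group G] [TopologicalSpace G] {H : Subgroup G}

theorem restrict_restrict (S : TruncationSet H) {K L : Subgp H} (i : K.1 ≤ L.1) (U : Subgroup G) :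
    U ∈ (S.restrict K.1 K.2).carrier ↔ U ∈ (S.restrict L.1 L.2).carrier ∧ U ≤ K.1 :=
  ⟨fun h => ⟨⟨h.1, h.2.trans i⟩, h.2⟩, fun h => ⟨h.1.1, h.2⟩⟩

theorem restrict_rconj (S : TruncationSet H) {K L : Subgp H} (h : G) (hh : h ∈ H)
    (e : L.1 = rconj K.1 h⁻¹) (U : Subgroup G) :
    U ∈ (S.restrict L.1 L.2).carrier ↔ rconj U h ∈ (S.restrict K.1 K.2).carrier := by
  have e' : rconj L.1 h = K.1 := by rw [e, rconj_rconj, inv_mul_cancel, rconj_one]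
  constructor
  · rintro ⟨h₁, h₂⟩
    exact ⟨S.conj _ h₁ _ hh, (rconj_mono h₂ h).trans e'.le⟩
  · rintro ⟨h₁, h₂⟩
    have h₃ := S.conj _ h₁ _ (H.inv_mem hh)
    have h₄ := rconj_mono h₂ h⁻¹
    rw [rconj_rconj, mul_inv_cancel, rconj_one] at h₃ h₄
    exact ⟨h₃, h₄.trans e.ge⟩

/-- The `H`-Mackey functor `W^S_G(R; M) : K ↦ W^{S|_K}_{K ≤ G}(R; M)`, with Verschiebung as
transfer and Frobenius as restriction. -/
def wittMackey (S : TruncationSet H) (R M : Type u) [CommRing R] [AddCommGroup M] [Module R M] :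
    MackeyData.{v, max u v} H where
  obj K := Witt (S.restrict K.1 K.2) R M
  tr i := ver R M _ _ (restrict_restrict S i)
  res i := frob R M _ _ (restrict_restrict S i)
  conj h _ _ hh e := conjOp R M h _ _ (restrict_rconj S h hh e)

/-- The untruncated Witt vector `G`-Mackey functor `W_G(R; M)`. -/
def wittMackeyAll (G : Type v) [Group G] [TopologicalSpace G] [IsTopologicalGroup G]
    (R M : Type u) [CommRing R] [AddCommGroup M] [Module R M] :
    MackeyData.{v, max u v} (⊤ : Subgroup G) :=
  wittMackey (TruncationSet.all ⊤) R M

/-- `P` is the `S`-truncation `M^S = M □ π₀(Σ^∞ ẼF(S))` of the `G`-Mackey functor `M` (an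
`H`-Mackey functor), by means of the pairing `β`. -/
def IsMackeyTruncation [IsTopologicalGroup G] (S : TruncationSet H)
    (M : MackeyData.{v, max u v} (⊤ : Subgroup G)) (P : MackeyData.{v, max u v} H)
    (β : ∀ K : Subgp H, (M.restrict (le_top : H ≤ ⊤)).obj K →+ (burnside S).obj K →+ P.obj K) :
    Prop :=
  MackeyData.IsBoxProduct.{v, max u v, v} (M.restrict (le_top : H ≤ ⊤)) (burnside S) P β

end WittMackey

end GWitt

end

open GWitt

noncomputable section

open scoped TensorProduct Topology

namespace GWitt

/-! ### Relative traces -/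

section Trace

variable {G : Type v} [Group G] {Y : Type*}

/-! Everything rests on an intrinsic description of the image of the ghost map over free
coefficients. For coefficients free on sets `A` and `B`, each `Q^{⊗ G/U}` has a ℤ-basis of
monomials, and `iota` embeds all these groups at once in the free abelian group `GSpace` on pairs
(rational exponent, function `G → B`). Exponents are divided by the index of `U`, so that a monomial
is identified with its own tensor powers, and the maps `act` become the action of `G` by right
translation. The images `C(U)` grow as `U` shrinks, and `U` acts trivially on `C(U)`.

A ghost family is a function `α(U) = ∑_{W ≥ U} p(W)` on `S`, where `p` is `H`-equivariant, supported
on `S`, and `p(V)` is a trace from `V` to `N_H(V)` of an element of `C(V)`. By `mem_ghostImage_iff`,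
`im(w)` consists exactly of the ghost families. That ghost vectors are ghost families comes down to
the tensor powers of one element (`normFam_isGhost`). With coefficients `1` they are sums over a
`V`-set of functions, grouped by stabiliser; arbitrary coefficients are reduced modulo `[N_V(W) :
W]`, and the error is again a trace. The converse (`exists_ghost_eq`) holds because the ghost
equations are triangular with respect to the index.

The operators are transparent in terms of `p`: the Verschiebung induces it, the Frobenius sums it
over the fibres of `V ↦ V ∩ K`, and truncation restricts it. Extending `p` by zero lifts along
truncations, with enough control on supports to make truncation open. If `α` vanishes on `S ∖ K`, so
does `p`; then `p` lives on conjugates of subgroups of `K` and comes from the Verschiebung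
(`IsGhost.exists_ver`). Naturality carries this to coequalisers, where a relation over `S ∖ K` is
first lifted to one over `S` (`range_ver`). Openness of truncation then gives the statements on
Hausdorff quotients (`separationQuotient_exact`).

For finite `G` the Mackey axioms are identities of traces. Repeated use of exactness shows that the
kernel of a truncation is generated by transfers from the subgroups that are lost (`ker_trunc_le`).
The box product of `M` with the truncated Burnside functor is the quotient of `M` by exactly such
transfers (`isBoxProduct_orbitPairing`), since `[K/U]` is the transfer of the unit `[U/U]`, which is
zero for `U ∉ S`. -/

instance rconj_finiteIndex (U : Subgroup G) [U.FiniteIndex] (g : G) :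
    (rconj U g).FiniteIndex := ⟨by
  rw [rconj, Subgroup.index_comap_of_surjective]
  · exact Subgroup.FiniteIndex.index_ne_zero
  · exact (MulAut.conj g).surjective⟩

/-- `f` is invariant under right translation by `A`. -/
def RightInv (A : Subgroup G) {B : Subgroup G} (f : B → Y) : Prop :=
  ∀ g a : B, (a : G) ∈ A → f (g * a) = f g

theorem RightInv.eq {A B : Subgroup G} {f : B → Y} (hf : RightInv A f) {g h : B}
    (e : (g : G)⁻¹ * h ∈ A) : f h = f g := by
  have := hf g (g⁻¹ * h) (by simpa using e)
  simpa using this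

variable [AddCommMonoid Y]

/-- The sum of `f` over representatives of the cosets `B / A`. -/
def relTrace (A B : Subgroup G) (f : B → Y) : Y := ∑ᶠ c : B ⧸ A.subgroupOf B, f c.out

theorem relTrace_congr {A B : Subgroup G} {f f' : B → Y} (h : ∀ b, f b = f' b) :
    relTrace A B f = relTrace A B f' := by
  rw [funext h]

theorem mk_eq_iff_mem {A B : Subgroup G} (g h : B) :
    (QuotientGroup.mk g : B ⧸ A.subgroupOf B) = QuotientGroup.mk h ↔ (g : G)⁻¹ * h ∈ A := by
  rw [QuotientGroup.eq, Subgroup.mem_subgroupOf]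
  simp

theorem out_inv_mul_mem {A B : Subgroup G} (b : B) :
    (((QuotientGroup.mk b : B ⧸ A.subgroupOf B).out : B) : G)⁻¹ * b ∈ A := by
  rw [← mk_eq_iff_mem]
  exact Quotient.out_eq _

/-- Right invariance makes the sum independent of the transversal. The trace identities below differ
only in the transversal `rep` that is exhibited. -/
theorem relTrace_eq_finsum {A B : Subgroup G} {f : B → Y} (hf : RightInv A f) {E : Type*}
    (rep : E → B) (hrep : ∀ b : B, ∃! e, (rep e : G)⁻¹ * b ∈ A) :
    relTrace A B f = ∑ᶠ e, f (rep e) := by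
  symm
  refine finsum_eq_of_bijective (fun e => (QuotientGroup.mk (rep e) : B ⧸ A.subgroupOf B))
    ⟨fun e e' h => ?_, fun c => ?_⟩ fun e => ?_
  · obtain ⟨x, -, hx⟩ := hrep (rep e')
    rw [hx e ((mk_eq_iff_mem _ _).1 h), hx e' (by simp [A.one_mem])]
  · obtain ⟨x, hx, -⟩ := hrep c.out
    exact ⟨x, ((mk_eq_iff_mem _ _).2 hx).trans (Quotient.out_eq c)⟩
  · exact hf.eq (out_inv_mul_mem _)

theorem relTrace_self {A : Subgroup G} {f : A → Y} (hf : RightInv A f) :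
    relTrace A A f = f 1 := by
  rw [relTrace_eq_finsum hf (fun _ : Unit => 1) fun b => ⟨(), by simp, fun _ _ => rfl⟩]
  exact finsum_unique (fun _ : Unit => f 1)

theorem relTrace_add (A B : Subgroup G) [A.FiniteIndex] (f f' : B → Y) :
    relTrace A B (fun b => f b + f' b) = relTrace A B f + relTrace A B f' :=
  finsum_add_distrib (Set.toFinite _) (Set.toFinite _)

theorem map_relTrace (A B : Subgroup G) [A.FiniteIndex] {Y' : Type*} [AddCommMonoid Y']
    (φ : Y →+ Y') (f : B → Y) : φ (relTrace A B f) = relTrace A B fun b => φ (f b) :=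
  φ.map_finsum (Set.toFinite _)

theorem relTrace_zero (A B : Subgroup G) : relTrace A B (fun _ => (0 : Y)) = 0 :=
  finsum_zero

theorem relTrace_eq_zero {A B : Subgroup G} {f : B → Y} (h : ∀ b, f b = 0) :
    relTrace A B f = 0 := by
  rw [relTrace_congr h, relTrace_zero]

theorem relTrace_const (A B : Subgroup G) [A.FiniteIndex] (y : Y) :
    relTrace A B (fun _ => y) = A.relIndex B • y := by
  have := Fintype.ofFinite (B ⧸ A.subgroupOf B)
  rw [relTrace, finsum_eq_sum_of_fintype, Finset.sum_const, Finset.card_univ,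
    ← Nat.card_eq_fintype_card]
  rfl

theorem relTrace_finsum (A B : Subgroup G) [A.FiniteIndex] {E : Type*} [Finite E]
    (f : E → B → Y) :
    relTrace A B (fun b => ∑ᶠ e : E, f e b) = ∑ᶠ e : E, relTrace A B (f e) := by
  have := Fintype.ofFinite E
  have := Fintype.ofFinite (B ⧸ A.subgroupOf B)
  simp only [relTrace, finsum_eq_sum_of_fintype]
  rw [Finset.sum_comm]

/-- Products of transversals of `C/B` and of `B/A` form a transversal of `C/A`. -/
theorem relTrace_trans {A B C : Subgroup G} (hAB : A ≤ B) (hBC : B ≤ C) [A.FiniteIndex]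
    {f : C → Y} (hf : RightInv A f) :
    relTrace B C (fun c => relTrace A B fun b => f (c * ⟨b, hBC b.2⟩)) = relTrace A C f := by
  have : B.FiniteIndex := Subgroup.finiteIndex_of_le hAB
  have := Fintype.ofFinite (C ⧸ B.subgroupOf C)
  have := Fintype.ofFinite (B ⧸ A.subgroupOf B)
  rw [relTrace_eq_finsum hf (E := (C ⧸ B.subgroupOf C) × (B ⧸ A.subgroupOf B))
    (fun e => e.1.out * ⟨(e.2.out : B), hBC e.2.out.2⟩)]
  · simp only [relTrace, finsum_eq_sum_of_fintype]
    rw [Fintype.sum_prod_type]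
  · intro c
    have h1 := out_inv_mul_mem (A := B) c
    have h2 := out_inv_mul_mem (A := A) (⟨_, h1⟩ : B)
    refine ⟨(QuotientGroup.mk c, QuotientGroup.mk ⟨_, h1⟩), ?_, ?_⟩
    · simpa [mul_assoc] using h2
    · rintro ⟨x, y⟩ h
      simp only [Subgroup.coe_mul, mul_inv_rev] at h
      have hx : x = QuotientGroup.mk c := by
        rw [← Quotient.out_eq x]
        refine (mk_eq_iff_mem _ _).2 ?_
        have := B.mul_mem y.out.2 (hAB h)
        simpa [mul_assoc] using this
      subst hx
      refine Prod.ext rfl ?_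
      rw [← Quotient.out_eq y]
      refine (mk_eq_iff_mem _ _).2 ?_
      simpa [mul_assoc] using h

/-- Mackey decomposition: the `J`-orbit of `dK` in `L/K` is `J/(J ∩ dKd⁻¹)`, so the products `j * d`
form a transversal of `L/K`. -/
theorem relTrace_doubleCoset {J K L : Subgroup G} (hJ : J ≤ L) [J.FiniteIndex]
    [K.FiniteIndex] {f : L → Y} (hf : RightInv K f) :
    relTrace K L f =
      ∑ᶠ d : DoubleCoset.Quotient (J.subgroupOf L : Set L) (K.subgroupOf L),
        relTrace (J ⊓ rconj K (d.out : G)⁻¹) J (fun j => f (⟨j, hJ j.2⟩ * d.out)) := by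
  have hd : Finite (DoubleCoset.Quotient (J.subgroupOf L : Set L) (K.subgroupOf L)) := by
    refine Finite.of_surjective
      (fun c : L ⧸ K.subgroupOf L => DoubleCoset.mk (J.subgroupOf L) (K.subgroupOf L) c.out) ?_
    intro d
    refine ⟨QuotientGroup.mk d.out, ?_⟩
    conv_rhs => rw [← DoubleCoset.out_eq' _ _ d]
    rw [DoubleCoset.eq]
    refine ⟨1, Subgroup.one_mem _, ((QuotientGroup.mk d.out : L ⧸ K.subgroupOf L).out)⁻¹ * d.out,
      Subgroup.mem_subgroupOf.2 (out_inv_mul_mem (A := K) d.out), ?_⟩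
    simp
  have := Fintype.ofFinite (DoubleCoset.Quotient (J.subgroupOf L : Set L) (K.subgroupOf L))
  have (g : G) := Fintype.ofFinite (J ⧸ (J ⊓ rconj K g⁻¹).subgroupOf J)
  rw [relTrace_eq_finsum hf
    (E := Σ d : DoubleCoset.Quotient (J.subgroupOf L : Set L) (K.subgroupOf L),
      J ⧸ (J ⊓ rconj K (d.out : G)⁻¹).subgroupOf J)
    (fun e => ⟨(e.2.out : J), hJ e.2.out.2⟩ * e.1.out)]
  · simp only [relTrace, finsum_eq_sum_of_fintype]
    exact Fintype.sum_sigma _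
  · intro c
    obtain ⟨h, k, hh, hk, e⟩ :=
      DoubleCoset.mk_out_eq_mul (J.subgroupOf L) (K.subgroupOf L) c
    set d := DoubleCoset.mk (J.subgroupOf L) (K.subgroupOf L) c with hd
    have hh' : ((h : L) : G)⁻¹ ∈ J := J.inv_mem hh
    have h2 := out_inv_mul_mem (A := J ⊓ rconj K (d.out : G)⁻¹) (⟨_, hh'⟩ : J)
    have e' : (c : G) = (h : G)⁻¹ * (d.out : L) * (k : G)⁻¹ := by
      rw [e]; simp [mul_assoc]
    have hk' : (k : G) ∈ K := hk
    refine ⟨⟨d, QuotientGroup.mk ⟨_, hh'⟩⟩, ?_, ?_⟩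
    · simp only [Subgroup.coe_mul, mul_inv_rev]
      rw [e']
      have := (Subgroup.mem_inf.1 h2).2
      rw [mem_rconj] at this
      have := K.mul_mem this (K.inv_mem hk')
      simpa [mul_assoc] using this
    · rintro ⟨x, y⟩ hy
      simp only [Subgroup.coe_mul, mul_inv_rev] at hy
      have hx : x = d := by
        rw [hd, ← DoubleCoset.out_eq' _ _ x]
        rw [DoubleCoset.eq]
        refine ⟨⟨(y.out : J), hJ y.out.2⟩, y.out.2,
          (⟨_, hJ y.out.2⟩ * x.out)⁻¹ * c, ?_, ?_⟩
        · simpa [Subgroup.mem_subgroupOf] using hy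
        · ext
          simp [mul_assoc]
      subst hx
      congr 1
      rw [← Quotient.out_eq y]
      refine (mk_eq_iff_mem _ _).2 (Subgroup.mem_inf.2
        ⟨J.mul_mem (J.inv_mem y.out.2) hh', ?_⟩)
      rw [mem_rconj]
      rw [e'] at hy
      have := K.mul_mem hy hk'
      simpa [mul_assoc] using this

/-- The sum of a function over a finite set with an action of `N`, as a sum of traces. -/
theorem finsum_eq_finsum_relTrace (N : Subgroup G) {Ω : Type*} [MulAction N Ω] [Finite Ω]
    (A : Ω → Subgroup G) (hA : ∀ ω, (A ω).subgroupOf N = MulAction.stabilizer N ω)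
    (F : Ω → Y) :
    ∑ᶠ ω, F ω = ∑ᶠ o : Quotient (MulAction.orbitRel N Ω),
      relTrace (A o.out) N (fun n => F (n • o.out)) := by
  have := Fintype.ofFinite Ω
  have := Fintype.ofFinite (Quotient (MulAction.orbitRel N Ω))
  have hfin (ω : Ω) : Finite (N ⧸ MulAction.stabilizer N ω) :=
    Finite.of_equiv _ (MulAction.orbitEquivQuotientStabilizer N ω)
  have (ω : Ω) := Fintype.ofFinite (N ⧸ MulAction.stabilizer N ω)
  rw [← finsum_comp_equiv (MulAction.selfEquivSigmaOrbitsQuotientStabilizer N Ω).symm,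
    finsum_eq_sum_of_fintype, Fintype.sum_sigma, finsum_eq_sum_of_fintype]
  refine Finset.sum_congr rfl fun o _ => ?_
  rw [relTrace, hA, ← finsum_eq_sum_of_fintype]
  refine finsum_congr fun c => ?_
  conv_lhs => rw [← Quotient.out_eq c]
  rfl

theorem relTrace_mul_left {A N : Subgroup G} {f : N → Y}
    (hf : RightInv A f) (n : N) : relTrace A N (fun b => f (n * b)) = relTrace A N f := by
  symm
  refine relTrace_eq_finsum hf (fun c : N ⧸ A.subgroupOf N => n * c.out) fun b => ?_
  refine ⟨QuotientGroup.mk (n⁻¹ * b), ?_, fun c hc => ?_⟩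
  · have := out_inv_mul_mem (A := A) (n⁻¹ * b)
    simpa [mul_assoc] using this
  · rw [← Quotient.out_eq c]
    refine (mk_eq_iff_mem _ _).2 ?_
    simpa [mul_assoc] using hc

theorem relTrace_mul_right {A N : Subgroup G} {f : N → Y} (n : N)
    (hf : RightInv (rconj A (n : G)) f) :
    relTrace A N (fun b => f (b * n)) = relTrace (rconj A (n : G)) N f := by
  symm
  refine relTrace_eq_finsum hf (fun c : N ⧸ A.subgroupOf N => c.out * n) fun b => ?_
  refine ⟨QuotientGroup.mk (b * n⁻¹), ?_, fun c hc => ?_⟩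
  · have := out_inv_mul_mem (A := A) (b * n⁻¹)
    beta_reduce
    rw [mem_rconj]
    simpa [mul_assoc] using this
  · rw [← Quotient.out_eq c]
    refine (mk_eq_iff_mem _ _).2 ?_
    beta_reduce at hc
    rw [mem_rconj] at hc
    simpa [mul_assoc] using hc

end Trace

/-! ### Coefficient systems and ghost families -/

section Coeff

variable {G : Type v} [Group G]

/-- A subgroup containing `U` is determined by its image in the finite set `G/U`. -/
theorem finite_overgroups (U : Subgroup G) [U.FiniteIndex] : Finite {W : Subgroup G // U ≤ W} := by
  refine Finite.of_injective
    (fun W : {W : Subgroup G // U ≤ W} => ((↑) '' (W.1 : Set G) : Set (G ⧸ U))) ?_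
  rintro ⟨W, hW⟩ ⟨W', hW'⟩ h
  have key : ∀ W : Subgroup G, U ≤ W → ∀ x,
      x ∈ W ↔ (x : G ⧸ U) ∈ ((↑) '' (W : Set G) : Set (G ⧸ U)) := by
    refine fun W hW x => ⟨fun hx => ⟨x, hx, rfl⟩, ?_⟩
    rintro ⟨y, hy, e⟩
    have := W.mul_mem hy (hW (QuotientGroup.eq.1 e))
    simpa using this
  ext x
  rw [key W hW, key W' hW']
  exact Set.ext_iff.1 h _

theorem rconj_inv_cancel (U : Subgroup G) (g : G) : rconj (rconj U g) g⁻¹ = U := by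
  rw [rconj_rconj, mul_inv_cancel, rconj_one]

theorem rconj_cancel_inv (U : Subgroup G) (g : G) : rconj (rconj U g⁻¹) g = U := by
  rw [rconj_rconj, inv_mul_cancel, rconj_one]

theorem rconj_le_rconj {U V : Subgroup G} {g : G} : rconj U g ≤ rconj V g ↔ U ≤ V :=
  ⟨fun h => by simpa only [rconj_inv_cancel] using rconj_mono h g⁻¹, fun h => rconj_mono h g⟩

theorem rconj_inf (U V : Subgroup G) (g : G) : rconj (U ⊓ V) g = rconj U g ⊓ rconj V g := rfl

theorem rconj_eq_iff {U V : Subgroup G} {g : G} : rconj U g = V ↔ U = rconj V g⁻¹ := by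
  constructor
  · rintro rfl
    exact (rconj_inv_cancel U g).symm
  · rintro rfl
    exact rconj_cancel_inv V g

theorem index_rconj (U : Subgroup G) (g : G) : (rconj U g).index = U.index :=
  Subgroup.index_comap_of_surjective _ (MulAut.conj g).surjective

/-- The normaliser of `V` in `H`. -/
def nrm (H V : Subgroup G) : Subgroup G where
  carrier := {h | h ∈ H ∧ rconj V h = V}
  one_mem' := ⟨H.one_mem, rconj_one V⟩
  mul_mem' {a b} ha hb := ⟨H.mul_mem ha.1 hb.1, by rw [← rconj_rconj, ha.2, hb.2]⟩
  inv_mem' {a} ha := ⟨H.inv_mem ha.1, by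
    conv_lhs => rw [← ha.2]
    exact rconj_inv_cancel V a⟩

theorem mem_nrm {H V : Subgroup G} {h : G} : h ∈ nrm H V ↔ h ∈ H ∧ rconj V h = V := Iff.rfl

theorem nrm_le (H V : Subgroup G) : nrm H V ≤ H := fun _ h => h.1

theorem le_nrm {H V : Subgroup G} (h : V ≤ H) : V ≤ nrm H V :=
  fun _ hx => ⟨h hx, rconj_of_mem hx⟩

theorem rconj_nrm (H V : Subgroup G) (g : G) : rconj (nrm H V) g = nrm (rconj H g) (rconj V g) := by
  ext x
  simp only [mem_rconj, mem_nrm, rconj_rconj]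
  refine and_congr_right fun _ => ?_
  rw [← rconj_rconj, rconj_eq_iff, inv_inv, ← rconj_rconj]

variable {Z : Type*} [AddCommGroup Z] [DistribMulAction G Z]

variable (G Z) in
/-- A compatible family of subgroups `C(U)` of a `G`-module, with `C(U)` fixed by `U`. -/
structure CoeffSystem where
  grp : Subgroup G → AddSubgroup Z
  anti : ∀ {U V : Subgroup G}, U.FiniteIndex → U ≤ V → grp V ≤ grp U
  smul_mem : ∀ (U : Subgroup G) (g : G) {z : Z}, z ∈ grp (rconj U g) → g • z ∈ grp U
  smul_eq : ∀ {U : Subgroup G} {u : G} {z : Z}, u ∈ U → z ∈ grp U → u • z = z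

variable (C : CoeffSystem G Z)

/-- `y` is the trace from `A` to `N` of an element of `C(A)`. -/
def IsTr (A N : Subgroup G) (y : Z) : Prop :=
  ∃ z ∈ C.grp A, y = relTrace A N fun g => (g : G) • z

variable {C}

theorem CoeffSystem.rightInv {A N : Subgroup G} {z : Z} (hz : z ∈ C.grp A) :
    RightInv A (fun g : N => (g : G) • z) := fun g a ha => by
  simp only [Subgroup.coe_mul, mul_smul, C.smul_eq ha hz]

theorem IsTr.zero (A N : Subgroup G) : IsTr C A N 0 :=
  ⟨0, zero_mem _, by rw [relTrace_eq_zero]; simp⟩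

theorem IsTr.add {A N : Subgroup G} [A.FiniteIndex] {x y : Z} (hx : IsTr C A N x)
    (hy : IsTr C A N y) : IsTr C A N (x + y) := by
  obtain ⟨z, hz, rfl⟩ := hx
  obtain ⟨z', hz', rfl⟩ := hy
  exact ⟨z + z', add_mem hz hz', by simp only [smul_add, relTrace_add]⟩

theorem IsTr.neg {A N : Subgroup G} [A.FiniteIndex] {x : Z} (hx : IsTr C A N x) :
    IsTr C A N (-x) := by
  obtain ⟨z, hz, rfl⟩ := hx
  exact ⟨-z, neg_mem hz, by
    simp only [smul_neg]
    exact map_relTrace A N (negAddMonoidHom : Z →+ Z) _⟩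

theorem IsTr.finsum {A N : Subgroup G} [A.FiniteIndex] {Ω : Type*} {F : Ω → Z}
    (h : ∀ ω, IsTr C A N (F ω)) : IsTr C A N (∑ᶠ ω, F ω) :=
  finsum_induction (IsTr C A N) (IsTr.zero A N) (fun _ _ => IsTr.add) h

theorem isTr_self {A : Subgroup G} {z : Z} (hz : z ∈ C.grp A) : IsTr C A A z :=
  ⟨z, hz, by rw [relTrace_self (C.rightInv hz)]; simp⟩

theorem IsTr.trans {A B N : Subgroup G} [A.FiniteIndex] (hAB : A ≤ B) (hBN : B ≤ N) {y : Z}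
    (hy : IsTr C A B y) : IsTr C A N (relTrace B N fun g => (g : G) • y) := by
  obtain ⟨z, hz, rfl⟩ := hy
  refine ⟨z, hz, ?_⟩
  rw [← relTrace_trans hAB hBN (C.rightInv hz)]
  refine relTrace_congr fun c => ?_
  rw [← DistribSMul.toAddMonoidHom_apply, map_relTrace]
  refine relTrace_congr fun b => ?_
  simp [mul_smul]

theorem relTrace_rconj {A N : Subgroup G} {Y : Type*} [AddCommGroup Y] (g : G) {f : G → Y}
    (hf : RightInv A (fun n : N => f n)) :
    relTrace A N (fun n => f n) =
      relTrace (rconj A g) (rconj N g) (fun n => f (g * n * g⁻¹)) := by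
  refine relTrace_eq_finsum hf
    (fun c : rconj N g ⧸ (rconj A g).subgroupOf (rconj N g) => ⟨g * c.out * g⁻¹, c.out.2⟩)
    fun b => ?_
  have hb : g⁻¹ * (b : G) * g ∈ rconj N g := by simp [mem_rconj, mul_assoc]
  refine ⟨QuotientGroup.mk ⟨_, hb⟩, ?_, ?_⟩
  · have := out_inv_mul_mem (A := rconj A g) (⟨_, hb⟩ : rconj N g)
    rw [mem_rconj] at this
    simpa [mul_assoc] using this
  · intro c hc
    rw [← Quotient.out_eq c]
    refine (mk_eq_iff_mem _ _).2 ?_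
    rw [mem_rconj]
    simpa [mul_assoc] using hc

theorem IsTr.smul {A N : Subgroup G} [A.FiniteIndex] {g : G} {y : Z}
    (hy : IsTr C (rconj A g) (rconj N g) y) : IsTr C A N (g • y) := by
  obtain ⟨z, hz, rfl⟩ := hy
  have hz' := C.smul_mem _ _ hz
  refine ⟨_, hz', ?_⟩
  rw [relTrace_rconj (f := fun n => n • g • z) g (C.rightInv hz'),
    ← DistribSMul.toAddMonoidHom_apply, map_relTrace]
  refine relTrace_congr fun b => ?_
  simp [← mul_smul]

/-- The stabiliser in `N`, as a subgroup of `G`. -/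
def stab (N : Subgroup G) {Ω : Type*} [MulAction N Ω] (ω : Ω) : Subgroup G :=
  (MulAction.stabilizer N ω).map N.subtype

theorem mem_stab {N : Subgroup G} {Ω : Type*} [MulAction N Ω] {ω : Ω} {g : G} :
    g ∈ stab N ω ↔ ∃ h : g ∈ N, (⟨g, h⟩ : N) • ω = ω := by
  simp [stab, MulAction.mem_stabilizer_iff]

/-- The main device for recognising traces: an equivariant sum splits into orbits, each orbit sum is
a trace from a stabiliser, and traces compose. Points where `F` vanishes are exempt, because their
stabilisers need not contain `A`. -/
theorem IsTr.of_orbits {A N : Subgroup G} [A.FiniteIndex] {Ω : Type*} [MulAction N Ω] [Finite Ω]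
    {F : Ω → Z} (hF : ∀ (n : N) ω, F (n • ω) = (n : G) • F ω)
    (h : ∀ ω, F ω ≠ 0 → A ≤ stab N ω ∧ IsTr C A (stab N ω) (F ω)) :
    IsTr C A N (∑ᶠ ω, F ω) := by
  rw [finsum_eq_finsum_relTrace N (stab N)
    (fun ω => Subgroup.comap_map_eq_self_of_injective N.subtype_injective _)]
  refine IsTr.finsum fun o => ?_
  simp only [hF]
  by_cases h0 : F o.out = 0
  · rw [relTrace_eq_zero]
    · exact IsTr.zero _ _
    · simp [h0]
  · exact (h _ h0).2.trans (h _ h0).1 fun x hx => (mem_stab.1 hx).1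

end Coeff

/-! ### Sums over overgroups and their inversion -/

section Zeta

variable {G : Type v} [Group G] {Z : Type*} [AddCommGroup Z]

/-- The sum of `p` over the subgroups that contain `U`. -/
def zeta (p : Subgroup G → Z) (U : Subgroup G) : Z := ∑ᶠ W : {W // U ≤ W}, p W.1


theorem zeta_add (p q : Subgroup G → Z) (U : Subgroup G) [U.FiniteIndex] :
    zeta (fun W => p W + q W) U = zeta p U + zeta q U := by
  have := finite_overgroups U
  exact finsum_add_distrib (Set.toFinite _) (Set.toFinite _)

theorem zeta_neg (p : Subgroup G → Z) (U : Subgroup G) :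
    zeta (fun W => - p W) U = - zeta p U := by
  simp only [zeta]
  rw [finsum_neg_distrib]

theorem zeta_zero (U : Subgroup G) : zeta (fun _ => (0 : Z)) U = 0 := finsum_zero

theorem zeta_congr {p q : Subgroup G → Z} {U : Subgroup G} (h : ∀ W, U ≤ W → p W = q W) :
    zeta p U = zeta q U :=
  finsum_congr fun W => h W.1 W.2

theorem zeta_eq_zero {p : Subgroup G → Z} {U : Subgroup G} (h : ∀ W, U ≤ W → p W = 0) :
    zeta p U = 0 := by
  rw [zeta_congr h, zeta_zero]

theorem zeta_rconj (p : Subgroup G → Z) (U : Subgroup G) (g : G) :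
    zeta (fun W => p (rconj W g)) U = zeta p (rconj U g) := by
  refine finsum_eq_of_bijective
    (fun W : {W // U ≤ W} => (⟨rconj W.1 g, rconj_mono W.2 g⟩ : {W // rconj U g ≤ W}))
    ⟨fun W W' h => ?_, fun W => ?_⟩ fun W => rfl
  · have := congrArg Subtype.val h
    simp only at this
    rw [rconj_eq_iff, rconj_inv_cancel] at this
    exact Subtype.ext this
  · refine ⟨⟨rconj W.1 g⁻¹, ?_⟩, Subtype.ext (rconj_cancel_inv W.1 g)⟩
    rw [← rconj_le_rconj (g := g), rconj_cancel_inv]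
    exact W.2

theorem map_zeta {Z' : Type*} [AddCommGroup Z'] (φ : Z →+ Z') (p : Subgroup G → Z)
    (U : Subgroup G) [U.FiniteIndex] : φ (zeta p U) = zeta (fun W => φ (p W)) U := by
  have := finite_overgroups U
  exact φ.map_finsum (Set.toFinite _)

theorem smul_zeta [DistribMulAction G Z] (g : G) (p : Subgroup G → Z) (U : Subgroup G) [U.FiniteIndex] :
    g • zeta p U = zeta (fun W => g • p W) U :=
  map_zeta (DistribSMul.toAddMonoidHom Z g) p U

theorem zeta_eq_self_add (p : Subgroup G → Z) (U : Subgroup G) [U.FiniteIndex] :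
    zeta p U = p U + ∑ᶠ W : {W // U < W}, p W.1 := by
  have hs : {W | U ≤ W} = insert U {W | U < W} := by
    ext W
    simp [le_iff_eq_or_lt, eq_comm]
  have hfin : {W | U < W}.Finite :=
    (Set.finite_coe_iff.1 (finite_overgroups U) : {W | U ≤ W}.Finite).subset fun W (hW : U < W) => hW.le
  have h1 := finsum_set_coe_eq_finsum_mem (f := p) {W | U ≤ W}
  have h2 := finsum_set_coe_eq_finsum_mem (f := p) {W | U < W}
  rw [hs, finsum_mem_insert p (by simp) hfin, ← h2, ← hs] at h1
  exact h1

/-- Inversion by induction on the index: the sum at `U` is `p U` plus values at strictly larger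
subgroups, which vanish already. Only the sums at overgroups of `U` enter. -/
theorem eq_zero_of_zeta_eq_zero {p : Subgroup G → Z} {U : Subgroup G} [hU : U.FiniteIndex]
    (h : ∀ W, U ≤ W → zeta p W = 0) : p U = 0 := by
  obtain ⟨n, hn⟩ : ∃ n, U.index = n := ⟨_, rfl⟩
  induction n using Nat.strong_induction_on generalizing U with
  | _ n ih =>
    have h0 := h U le_rfl
    rw [zeta_eq_self_add, finsum_eq_zero_of_forall_eq_zero, add_zero] at h0
    · exact h0
    · rintro ⟨W, hW⟩
      have : W.FiniteIndex := Subgroup.finiteIndex_of_le hW.le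
      exact ih W.index (hn ▸ Subgroup.index_strictAnti hW) (fun W' hW' => h W' (hW.le.trans hW')) rfl

end Zeta

/-! ### Trace families and ghost families on a truncation set -/

section Ghosts

variable {G : Type v} [Group G] [TopologicalSpace G] {H K : Subgroup G}
variable {Z : Type*} [AddCommGroup Z] [DistribMulAction G Z] (C : CoeffSystem G Z)

theorem finiteIndex_of_isOpen [IsTopologicalGroup G] [CompactSpace G] {U : Subgroup G}
    (h : IsOpen (U : Set G)) : U.FiniteIndex := by
  have := Subgroup.quotient_finite_of_isOpen U h
  exact Subgroup.finiteIndex_of_finite_quotient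

theorem TruncationSet.finiteIndex [IsTopologicalGroup G] [CompactSpace G] (S : TruncationSet H)
    {U : Subgroup G} (h : U ∈ S.carrier) : U.FiniteIndex :=
  finiteIndex_of_isOpen (S.isOpen U h)

theorem TruncationSet.mem_of_le [IsTopologicalGroup G] (S : TruncationSet H)
    {U W : Subgroup G} (h : U ∈ S.carrier) (hW : U ≤ W) (hWH : W ≤ H) : W ∈ S.carrier :=
  S.up U h W (Subgroup.isOpen_mono hW (S.isOpen U h)) hW hWH

theorem TruncationSet.rconj_mem_iff (S : TruncationSet H) {U : Subgroup G} {h : G} (hh : h ∈ H) :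
    rconj U h ∈ S.carrier ↔ U ∈ S.carrier :=
  ⟨fun hU => by simpa only [rconj_inv_cancel] using S.conj _ hU h⁻¹ (H.inv_mem hh),
    fun hU => S.conj U hU h hh⟩

/-- Equivariant families of traces, indexed by the members of `S`. -/
structure IsTraceFamily (S : TruncationSet H) (p : Subgroup G → Z) : Prop where
  equivariant : ∀ h ∈ H, ∀ U, h • p (rconj U h) = p U
  eq_zero : ∀ V ∉ S.carrier, p V = 0
  isTr : ∀ V ∈ S.carrier, IsTr C V (nrm H V) (p V)

open Classical in
/-- Families `U ↦ ∑_{W ≥ U} p(W)` for a trace family `p`. -/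
def IsGhost (S : TruncationSet H) (α : Subgroup G → Z) : Prop :=
  ∃ p, IsTraceFamily C S p ∧ ∀ U, α U = if U ∈ S.carrier then zeta p U else 0

variable {C}

end Ghosts

/-! ### Verschiebung, Frobenius, conjugation and truncation of ghost families -/

section GhostOperations

variable {G : Type v} [Group G] {H K : Subgroup G}

theorem finite_inf_eq (K W : Subgroup G) [W.FiniteIndex] :
    Finite {V : Subgroup G // V ⊓ K = W} :=
  have := finite_overgroups W
  Finite.of_injective (fun V : {V : Subgroup G // V ⊓ K = W} =>
    (⟨V.1, V.2.symm.le.trans inf_le_left⟩ : {V // W ≤ V})) fun _ _ h =>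
      Subtype.ext (congrArg (fun x => x.1) h)

theorem rconj_inf_of_mem {k : G} (hk : k ∈ K) (V : Subgroup G) :
    rconj V k ⊓ K = rconj (V ⊓ K) k := by
  rw [rconj_inf, rconj_of_mem hk]

theorem rconj_injective (g : G) : Function.Injective fun U : Subgroup G => rconj U g :=
  fun U V h => by
    simp only at h
    rw [rconj_eq_iff, rconj_inv_cancel] at h
    exact h

variable {Z : Type*} [AddCommGroup Z] [DistribMulAction G Z] {C : CoeffSystem G Z}

/-- The summand of the Verschiebung depends only on the coset `gK`, so the trace lemmas apply to it.
-/
theorem equivariant_rightInv {p : Subgroup G → Z} (hp : ∀ k ∈ K, ∀ U, k • p (rconj U k) = p U)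
    (U : Subgroup G) : RightInv K (fun g : H => (g : G) • p (rconj U g)) := fun g a ha => by
  simp only [Subgroup.coe_mul, ← rconj_rconj, mul_smul, hp _ ha]

theorem equivariant_smul {p : Subgroup G → Z} (hp : ∀ h ∈ H, ∀ U, h • p (rconj U h) = p U)
    {h : G} (hh : h ∈ H) (U : Subgroup G) : p (rconj U h⁻¹) = h • p U := by
  rw [← hp h hh (rconj U h⁻¹), rconj_cancel_inv]

theorem relTrace_equivariant {p : Subgroup G → Z} [K.FiniteIndex]
    (hp : ∀ k ∈ K, ∀ U, k • p (rconj U k) = p U)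
    {h : G} (hh : h ∈ H) (U : Subgroup G) :
    h • relTrace K H (fun c => (c : G) • p (rconj (rconj U h) c)) =
      relTrace K H (fun c => (c : G) • p (rconj U c)) := by
  rw [← relTrace_mul_left (equivariant_rightInv hp U) ⟨h, hh⟩,
    ← DistribSMul.toAddMonoidHom_apply, map_relTrace]
  refine relTrace_congr fun b => ?_
  simp [mul_smul, rconj_rconj]

variable [TopologicalSpace G]

/-- The value at `V` is a sum over `H/K`, on which `N_H(V)` acts. The stabiliser of `cK`, conjugated
by `c`, is `N_K(V^c)`, and `p(V^c)` is a trace from `V^c` to precisely this group. Now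
`IsTr.of_orbits` applies. -/
theorem IsTraceFamily.ver {S : TruncationSet H} {S' : TruncationSet K} [IsTopologicalGroup G]
    [CompactSpace G] [K.FiniteIndex] (hKH : K ≤ H)
    (hS : ∀ U, U ∈ S'.carrier ↔ U ∈ S.carrier ∧ U ≤ K) {p : Subgroup G → Z}
    (hp : IsTraceFamily C S' p) :
    IsTraceFamily C S (fun U => relTrace K H fun c => (c : G) • p (rconj U c)) where
  equivariant h hh U := relTrace_equivariant hp.equivariant hh U
  eq_zero V hV := relTrace_eq_zero fun b => by
    rw [hp.eq_zero, smul_zero]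
    exact fun h => hV ((S.rconj_mem_iff b.2).1 ((hS _).1 h).1)
  isTr V hV := by
    have := S.finiteIndex hV
    let _ : MulAction (nrm H V) (H ⧸ K.subgroupOf H) :=
      MulAction.compHom _ (Subgroup.inclusion (nrm_le H V))
    have hsm : ∀ (n : nrm H V) (h : H), n • (QuotientGroup.mk h : H ⧸ K.subgroupOf H) =
      QuotientGroup.mk (⟨n, nrm_le H V n.2⟩ * h) := fun n h => rfl
    have hF : ∀ h : H, ((QuotientGroup.mk h : H ⧸ K.subgroupOf H).out : G) •
        p (rconj V (QuotientGroup.mk h : H ⧸ K.subgroupOf H).out) = (h : G) • p (rconj V h) :=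
      fun h => ((equivariant_rightInv hp.equivariant V).eq (out_inv_mul_mem h)).symm
    refine IsTr.of_orbits (N := nrm H V) ?_ ?_
    · intro n c
      obtain ⟨h, rfl⟩ := QuotientGroup.mk_surjective c
      refine (hF (⟨n, nrm_le H V n.2⟩ * h)).trans ?_
      refine Eq.trans ?_ (congrArg ((n : G) • ·) (hF h)).symm
      simp only [Subgroup.coe_mul]
      rw [← rconj_rconj, (mem_nrm.1 n.2).2, mul_smul]
    · intro c hc
      have hm : rconj V (c.out : G) ∈ S'.carrier := by
        by_contra h
        exact hc (by simp only [hp.eq_zero _ h, smul_zero])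
      have hst : rconj (stab (nrm H V) c) (c.out : G) = nrm K (rconj V (c.out : G)) := by
        ext x
        rw [mem_rconj, mem_stab]
        have key : ∀ n : nrm H V, n • c = c ↔ (c.out : G)⁻¹ * n * c.out ∈ K := by
          intro n
          conv_lhs => rw [← Quotient.out_eq c]
          change n • (QuotientGroup.mk c.out : H ⧸ K.subgroupOf H) = QuotientGroup.mk c.out ↔ _
          rw [eq_comm, hsm, mk_eq_iff_mem]
          simp [mul_assoc]
        simp only [key, exists_prop]
        have e : (c.out : G)⁻¹ * ((c.out : G) * x * (c.out : G)⁻¹) * c.out = x := by group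
        rw [e]
        constructor
        · rintro ⟨⟨-, h⟩, hx⟩
          refine ⟨hx, ?_⟩
          rwa [← rconj_rconj, rconj_eq_iff, inv_inv, ← rconj_rconj] at h
        · rintro ⟨hx, h⟩
          have hxH : x ∈ H := by
            exact hKH hx
          refine ⟨⟨H.mul_mem (H.mul_mem c.out.2 hxH) (H.inv_mem c.out.2), ?_⟩, hx⟩
          rwa [← rconj_rconj, rconj_eq_iff, inv_inv, ← rconj_rconj]
      constructor
      · rw [← rconj_le_rconj (g := (c.out : G)), hst]
        exact le_nrm (S'.le _ hm)
      · refine IsTr.smul ?_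
        rw [hst]
        exact hp.isTr _ hm

theorem IsGhost.ver {S : TruncationSet H} {S' : TruncationSet K} [IsTopologicalGroup G]
    [CompactSpace G] [K.FiniteIndex] (hKH : K ≤ H)
    (hS : ∀ U, U ∈ S'.carrier ↔ U ∈ S.carrier ∧ U ≤ K) {α : Subgroup G → Z}
    (hα : IsGhost C S' α) :
    IsGhost C S (fun U => relTrace K H fun c => (c : G) • α (rconj U c)) := by
  classical
  obtain ⟨p, hp, h⟩ := hα
  refine ⟨_, hp.ver hKH hS, fun U => ?_⟩
  split_ifs with hU
  · have := S.finiteIndex hU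
    have := finite_overgroups U
    rw [zeta, ← relTrace_finsum]
    refine relTrace_congr fun b => ?_
    trans (b : G) • zeta p (rconj U b)
    · rw [h]
      split_ifs with hb
      · rfl
      -- Here `U^b` is not contained in `K`, so no overgroup of it lies in the support of `p`.
      · rw [zeta_eq_zero]
        intro W hW
        refine hp.eq_zero W fun hW' => hb ((hS _).2 ⟨S.conj U hU b b.2, hW.trans ?_⟩)
        exact S'.le W hW'
    · rw [smul_zeta]
      exact (zeta_rconj (fun W => (b : G) • p W) U b).symm
  · refine relTrace_eq_zero fun b => ?_
    rw [h, if_neg, smul_zero]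
    exact fun h => hU ((S.rconj_mem_iff b.2).1 ((hS _).1 h).1)

-- The group `N_K(W)` permutes the fibre `{V : V ∩ K = W}`, with stabilisers `N_K(V)`. Restricting
-- the trace `p(V)` from `N_H(V)` to `N_K(V)` by the double coset formula produces traces from `W`,
-- as required by `IsTr.of_orbits`.
open Classical in
theorem IsTraceFamily.frob {S : TruncationSet H} {S' : TruncationSet K} [IsTopologicalGroup G]
    [CompactSpace G] (hKH : K ≤ H) {p : Subgroup G → Z}
    (hp : IsTraceFamily C S p) :
    IsTraceFamily C S' (fun W => if W ∈ S'.carrier then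
      ∑ᶠ V : {V : Subgroup G // V ⊓ K = W}, p V.1 else 0) where
  equivariant k hk U := by
    have hm : rconj U k ∈ S'.carrier ↔ U ∈ S'.carrier := S'.rconj_mem_iff hk
    simp only [hm]
    split_ifs with hU
    · have := S'.finiteIndex hU
      have hfin := finite_inf_eq K (rconj U k)
      rw [← DistribSMul.toAddMonoidHom_apply, AddMonoidHom.map_finsum _ (Set.toFinite _)]
      symm
      refine finsum_eq_of_bijective (fun V : {V : Subgroup G // V ⊓ K = U} =>
        (⟨rconj V.1 k, by rw [rconj_inf_of_mem hk, V.2]⟩ : {V : Subgroup G // V ⊓ K = rconj U k}))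
        ⟨fun V V' h => ?_, fun V => ?_⟩ fun V => ?_
      · exact Subtype.ext (rconj_injective k (congrArg Subtype.val h))
      · refine ⟨⟨rconj V.1 k⁻¹, ?_⟩, Subtype.ext (rconj_cancel_inv V.1 k)⟩
        rw [rconj_inf_of_mem (K.inv_mem hk), V.2, rconj_inv_cancel]
      · exact (hp.equivariant k (hKH hk) V.1).symm
    · exact smul_zero _
  eq_zero V hV := if_neg hV
  isTr W hW := by
    rw [if_pos hW]
    have := S'.finiteIndex hW
    let a : MulAction (nrm K W) {V : Subgroup G // V ⊓ K = W} :=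
      { smul := fun n V => ⟨rconj V.1 (n : G)⁻¹, by
          rw [rconj_inf_of_mem (K.inv_mem n.2.1), V.2]
          exact (mem_nrm.1 (nrm K W |>.inv_mem n.2)).2⟩
        one_smul := fun V => Subtype.ext (by
          change rconj V.1 ((1 : nrm K W) : G)⁻¹ = V.1
          simp [rconj_one])
        mul_smul := fun m n V => Subtype.ext (by
          change rconj V.1 ((m * n : nrm K W) : G)⁻¹ = rconj (rconj V.1 _) _
          simp [rconj_rconj]) }
    have hfin := finite_inf_eq K W
    refine IsTr.of_orbits (N := nrm K W) ?_ ?_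
    · intro n V
      exact equivariant_smul hp.equivariant (hKH n.2.1) V.1
    · intro V hV
      have hVS : V.1 ∈ S.carrier := by
        by_contra h
        exact hV (hp.eq_zero _ h)
      have hst : stab (nrm K W) V = nrm K V.1 := by
        ext x
        rw [mem_stab]
        have key : ∀ n : nrm K W, n • V = V ↔ rconj V.1 n = V.1 := by
          intro n
          rw [Subtype.ext_iff]
          change rconj V.1 (n : G)⁻¹ = V.1 ↔ _
          rw [rconj_eq_iff, inv_inv, eq_comm]
        simp only [key, exists_prop]
        constructor
        · rintro ⟨h, h'⟩
          exact ⟨h.1, h'⟩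
        · rintro ⟨h, h'⟩
          refine ⟨⟨h, ?_⟩, h'⟩
          conv_lhs => rw [← V.2]
          rw [← rconj_inf_of_mem h, h', V.2]
      have hWK : W ≤ K := S'.le _ hW
      have hWV : W ≤ V.1 := V.2.symm.le.trans inf_le_left
      have hWn : W ≤ nrm K V.1 := fun x hx => ⟨hWK hx, rconj_of_mem (hWV hx)⟩
      rw [hst]
      refine ⟨hWn, ?_⟩
      obtain ⟨z, hz, e⟩ := hp.isTr _ hVS
      have := S.finiteIndex hVS
      have : (nrm K V.1).FiniteIndex := Subgroup.finiteIndex_of_le hWn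
      rw [e, relTrace_doubleCoset (J := nrm K V.1) (L := nrm H V.1)
        (fun x hx => ⟨hKH hx.1, hx.2⟩)
        (C.rightInv hz)]
      refine IsTr.finsum fun d => ?_
      have hd : rconj V.1 (d.out : G)⁻¹ = V.1 := by
        exact (mem_nrm.1 ((nrm H V.1).inv_mem d.out.2)).2
      -- `V` is normal in `N_H(V)`, so every intersection in the double coset formula is `N_K(V) ∩ V
      -- = V ∩ K = W`.
      have hJ : nrm K V.1 ⊓ rconj V.1 (d.out : G)⁻¹ = W := by
        rw [hd]
        refine Eq.trans ?_ V.2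
        ext x
        simp only [Subgroup.mem_inf, mem_nrm]
        exact ⟨fun h => ⟨h.2, h.1.1⟩, fun h => ⟨⟨h.2, rconj_of_mem h.1⟩, h.1⟩⟩
      rw [hJ]
      refine ⟨(d.out : G) • z, C.anti inferInstance hWV (C.smul_mem _ _ ?_), ?_⟩
      · rw [show rconj V.1 (d.out : G) = V.1 from (mem_nrm.1 d.out.2).2]
        exact hz
      · refine relTrace_congr fun b => ?_
        simp [mul_smul]

/-- For `U ≤ K`, the overgroups `V` of `U` are grouped according to `V ∩ K`, which again contains
`U`. -/
theorem IsGhost.frob {S : TruncationSet H} {S' : TruncationSet K} [IsTopologicalGroup G]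
    [CompactSpace G] (hKH : K ≤ H)
    (hS : ∀ U, U ∈ S'.carrier ↔ U ∈ S.carrier ∧ U ≤ K) {α β : Subgroup G → Z}
    (hα : IsGhost C S α) (hβ : ∀ U ∈ S'.carrier, β U = α U) (hβ' : ∀ U ∉ S'.carrier, β U = 0) :
    IsGhost C S' β := by
  classical
  obtain ⟨p, hp, h⟩ := hα
  refine ⟨_, hp.frob hKH, fun U => ?_⟩
  split_ifs with hU
  · rw [hβ U hU, h, if_pos ((hS U).1 hU).1]
    have hUK := S'.le U hU
    have := S'.finiteIndex hU
    have := finite_overgroups U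
    have e : ∀ W : {W // U ≤ W}, (if W.1 ∈ S'.carrier then
        ∑ᶠ V : {V : Subgroup G // V ⊓ K = W.1}, p V.1 else 0) =
        ∑ᶠ V : {V : {V // U ≤ V} // V.1 ⊓ K = W.1}, p V.1.1 := by
      intro W
      have e' : ∑ᶠ V : {V : {V // U ≤ V} // V.1 ⊓ K = W.1}, p V.1.1 =
          ∑ᶠ V : {V : Subgroup G // V ⊓ K = W.1}, p V.1 :=
        finsum_eq_of_bijective (fun V => ⟨V.1.1, V.2⟩)
          ⟨fun V V' h => Subtype.ext (Subtype.ext (congrArg (fun x => x.1) h)),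
            fun V => ⟨⟨⟨V.1, W.2.trans (V.2.symm.le.trans inf_le_left)⟩, V.2⟩, rfl⟩⟩ fun _ => rfl
      rw [e']
      split_ifs with hW
      · rfl
      · symm
        refine finsum_eq_zero_of_forall_eq_zero fun V => hp.eq_zero _ fun hV => hW ?_
        exact S'.mem_of_le hU W.2 (V.2.symm.le.trans inf_le_right)
    rw [zeta, zeta, finsum_congr e]
    let φ : {V // U ≤ V} → {W // U ≤ W} := fun V => ⟨V.1 ⊓ K, le_inf V.2 hUK⟩
    have := Fintype.ofFinite {V // U ≤ V}
    have e2 : ∀ W : {W // U ≤ W}, ∑ᶠ V : {V : {V // U ≤ V} // V.1 ⊓ K = W.1}, p V.1.1 =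
        ∑ V : {V : {V // U ≤ V} // φ V = W}, p V.1.1 := by
      intro W
      rw [← finsum_eq_sum_of_fintype]
      exact finsum_eq_of_bijective (fun V => ⟨V.1, Subtype.ext V.2⟩)
        ⟨fun V V' h => Subtype.ext (congrArg (fun x => x.1) h),
          fun V => ⟨⟨V.1, congrArg Subtype.val V.2⟩, rfl⟩⟩ fun _ => rfl
    rw [finsum_congr e2, finsum_eq_sum_of_fintype, finsum_eq_sum_of_fintype]
    exact (Fintype.sum_fiberwise φ fun V => p V.1).symm
  · exact hβ' U hU

theorem IsTraceFamily.conj {S : TruncationSet H} {S' : TruncationSet K} [IsTopologicalGroup G]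
    [CompactSpace G] {g : G} (hK : rconj K g = H)
    (hS : ∀ U, U ∈ S'.carrier ↔ rconj U g ∈ S.carrier) {p : Subgroup G → Z}
    (hp : IsTraceFamily C S p) : IsTraceFamily C S' (fun U => g • p (rconj U g)) where
  equivariant k hk U := by
    have hk' : g⁻¹ * k * g ∈ H := by
      rw [← hK, mem_rconj]
      simpa [mul_assoc] using hk
    have := hp.equivariant _ hk' (rconj U g)
    have e : g * (g⁻¹ * k * g) = k * g := by group
    rw [← this, rconj_rconj, rconj_rconj, ← mul_smul, ← mul_smul, e]
  eq_zero V hV := by rw [hp.eq_zero _ fun h => hV ((hS V).2 h), smul_zero]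
  isTr V hV := by
    have := S'.finiteIndex hV
    refine IsTr.smul ?_
    rw [rconj_nrm, hK]
    exact hp.isTr _ ((hS V).1 hV)

theorem IsGhost.conj {S : TruncationSet H} {S' : TruncationSet K} [IsTopologicalGroup G]
    [CompactSpace G] {g : G} (hK : rconj K g = H)
    (hS : ∀ U, U ∈ S'.carrier ↔ rconj U g ∈ S.carrier) {α : Subgroup G → Z}
    (hα : IsGhost C S α) : IsGhost C S' (fun U => g • α (rconj U g)) := by
  classical
  obtain ⟨p, hp, h⟩ := hα
  refine ⟨_, hp.conj hK hS, fun U => ?_⟩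
  simp only [h, ← hS]
  split_ifs with hU
  · have := S'.finiteIndex hU
    rw [smul_zeta]
    exact (zeta_rconj (fun W => g • p W) U g).symm
  · exact smul_zero _

open Classical in
theorem IsTraceFamily.trunc {S S' : TruncationSet H} (hS : S'.carrier ⊆ S.carrier)
    {p : Subgroup G → Z} (hp : IsTraceFamily C S p) :
    IsTraceFamily C S' (fun U => if U ∈ S'.carrier then p U else 0) where
  equivariant h hh U := by
    simp only [S'.rconj_mem_iff hh]
    split_ifs
    · exact hp.equivariant h hh U
    · exact smul_zero _
  eq_zero V hV := if_neg hV
  isTr V hV := by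
    rw [if_pos hV]
    exact hp.isTr V (hS hV)

/-- As `S'` is upwards closed, the sum at a member of `S'` involves only values of `p` on `S'`,
apart from subgroups outside `H`, where `p` is zero. -/
theorem IsGhost.trunc {S S' : TruncationSet H} [IsTopologicalGroup G]
    [CompactSpace G] (hS : S'.carrier ⊆ S.carrier) {α β : Subgroup G → Z}
    (hα : IsGhost C S α) (hβ : ∀ U ∈ S'.carrier, β U = α U) (hβ' : ∀ U ∉ S'.carrier, β U = 0) :
    IsGhost C S' β := by
  classical
  obtain ⟨p, hp, h⟩ := hα
  refine ⟨_, hp.trunc hS, fun U => ?_⟩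
  split_ifs with hU
  · rw [hβ U hU, h, if_pos (hS hU)]
    refine zeta_congr fun W hW => ?_
    by_cases hWH : W ≤ H
    · rw [if_pos (S'.mem_of_le hU hW hWH)]
    · rw [if_neg fun h => hWH (S'.le _ h), hp.eq_zero _ fun h => hWH (S.le _ h)]
  · exact hβ' U hU

theorem IsTraceFamily.extend {S S' : TruncationSet H} (hS : S'.carrier ⊆ S.carrier)
    {p : Subgroup G → Z} (hp : IsTraceFamily C S' p) : IsTraceFamily C S p where
  equivariant := hp.equivariant
  eq_zero V hV := hp.eq_zero V fun h => hV (hS h)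
  isTr V hV := by
    by_cases h : V ∈ S'.carrier
    · exact hp.isTr V h
    · rw [hp.eq_zero V h]
      exact IsTr.zero _ _

/-- Ghost families extend to larger truncation sets, with control over the support. -/
theorem IsGhost.extend {S S' : TruncationSet H} [IsTopologicalGroup G]
    [CompactSpace G] (hS : S'.carrier ⊆ S.carrier) {β : Subgroup G → Z}
    (hβ : IsGhost C S' β) : ∃ α, IsGhost C S α ∧ (∀ U ∈ S'.carrier, α U = β U) ∧
      ∀ U ∈ S.carrier, (∀ V ∈ S'.carrier, U ≤ V → β V = 0) → α U = 0 := by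
  classical
  obtain ⟨p, hp, h⟩ := hβ
  -- The same `p` serves for `S`: it is zero on `S ∖ S'`, where zero counts as a trace.
  refine ⟨fun U => if U ∈ S.carrier then zeta p U else 0, ⟨p, hp.extend hS, fun _ => rfl⟩,
    fun U hU => ?_, fun U hU h0 => ?_⟩
  · simp only [h, if_pos hU, if_pos (hS hU)]
  · simp only [if_pos hU]
    refine zeta_eq_zero fun W hW => ?_
    by_cases hWS : W ∈ S'.carrier
    · have := S'.finiteIndex hWS
      -- The value `p W` is recovered from `β` on the overgroups of `W`, and all of these contain
      -- `U`.
      refine eq_zero_of_zeta_eq_zero fun V hV => ?_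
      by_cases hVH : V ≤ H
      · have hVS := S'.mem_of_le hWS hV hVH
        have := h0 V hVS (hW.trans hV)
        rwa [h, if_pos hVS] at this
      · refine zeta_eq_zero fun V' hV' => hp.eq_zero _ fun h => hVH (hV'.trans (S'.le _ h))
    · exact hp.eq_zero _ hWS

theorem IsGhost.add {S : TruncationSet H} [IsTopologicalGroup G] [CompactSpace G]
    {α β : Subgroup G → Z} (hα : IsGhost C S α) (hβ : IsGhost C S β) :
    IsGhost C S (fun U => α U + β U) := by
  classical
  obtain ⟨p, hp, h⟩ := hα
  obtain ⟨q, hq, h'⟩ := hβ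
  refine ⟨fun U => p U + q U, ⟨fun h hh U => ?_, fun V hV => ?_, fun V hV => ?_⟩, fun U => ?_⟩
  · rw [smul_add, hp.equivariant h hh, hq.equivariant h hh]
  · rw [hp.eq_zero V hV, hq.eq_zero V hV, add_zero]
  · have := S.finiteIndex hV
    exact (hp.isTr V hV).add (hq.isTr V hV)
  · simp only [h, h']
    split_ifs with hU
    · have := S.finiteIndex hU
      exact (zeta_add p q U).symm
    · exact add_zero 0

theorem IsGhost.neg {S : TruncationSet H} [IsTopologicalGroup G] [CompactSpace G]
    {α : Subgroup G → Z} (hα : IsGhost C S α) : IsGhost C S (fun U => - α U) := by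
  classical
  obtain ⟨p, hp, h⟩ := hα
  refine ⟨fun U => - p U, ⟨fun h hh U => ?_, fun V hV => ?_, fun V hV => ?_⟩, fun U => ?_⟩
  · rw [smul_neg, hp.equivariant h hh]
  · rw [hp.eq_zero V hV, neg_zero]
  · have := S.finiteIndex hV
    exact (hp.isTr V hV).neg
  · simp only [h]
    split_ifs with hU
    · exact (zeta_neg p U).symm
    · exact neg_zero

theorem IsGhost.zero (S : TruncationSet H) : IsGhost C S fun _ => 0 := by
  classical
  refine ⟨fun _ => 0, ⟨fun h hh U => smul_zero _, fun V hV => rfl, fun V hV => IsTr.zero _ _⟩,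
    fun U => ?_⟩
  simp only [zeta_zero, ite_self]

theorem IsGhost.equivariant {S : TruncationSet H} [IsTopologicalGroup G] [CompactSpace G]
    {α : Subgroup G → Z} (hα : IsGhost C S α) {h : G} (hh : h ∈ H) (U : Subgroup G) :
    h • α (rconj U h) = α U := by
  classical
  obtain ⟨p, hp, e⟩ := hα
  simp only [e, S.rconj_mem_iff hh]
  split_ifs with hU
  · have := S.conj U hU h hh
    have := S.finiteIndex this
    rw [smul_zeta, ← zeta_rconj (fun W => h • p W)]
    exact zeta_congr fun W _ => hp.equivariant h hh W
  · exact smul_zero _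

end GhostOperations

/-! ### Ghost families killed by truncation come from the Verschiebung -/

section Kernel

variable {G : Type v} [Group G] {H K : Subgroup G}
variable {Z : Type*} [AddCommGroup Z] [DistribMulAction G Z] {C : CoeffSystem G Z}

open Classical in
/-- The family with value `z` at `V` and `0` elsewhere. -/
def delta (V : Subgroup G) (z : Z) (W : Subgroup G) : Z := if W = V then z else 0

theorem delta_equivariant {V : Subgroup G} {z : Z} (hz : z ∈ C.grp V) (v : G) (hv : v ∈ V)
    (U : Subgroup G) : v • delta V z (rconj U v) = delta V z U := by
  have : rconj U v = V ↔ U = V := by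
    rw [rconj_eq_iff, rconj_of_mem (V.inv_mem hv)]
  by_cases h : U = V
  · rw [delta, delta, if_pos h, if_pos (this.2 h)]
    exact C.smul_eq hv hz
  · rw [delta, delta, if_neg h, if_neg fun h' => h (this.1 h')]
    exact smul_zero _

/-- Only cosets `cV` with `c` in the normaliser satisfy `V^c = V`. Thus inducing the one-point
family `delta V z` from `V` to `H` realises the trace of `z` as its value at `V`. -/
theorem relTrace_delta {V : Subgroup G} [V.FiniteIndex] (hV : V ≤ H) {z : Z}
    (hz : z ∈ C.grp V) :
    relTrace V H (fun c => (c : G) • delta V z (rconj V c)) =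
      relTrace V (nrm H V) (fun n => (n : G) • z) := by
  have : (nrm H V).FiniteIndex := Subgroup.finiteIndex_of_le (le_nrm hV)
  rw [← relTrace_trans (le_nrm hV) (nrm_le H V)
    (equivariant_rightInv (delta_equivariant hz) V)]
  have h1 : ∀ c : H, rconj V c ≠ V → relTrace V (nrm H V) (fun b => ((c * ⟨b, nrm_le H V b.2⟩ : H) : G) •
      delta V z (rconj V (c * ⟨b, nrm_le H V b.2⟩ : H))) = 0 := by
    intro c hc
    refine relTrace_eq_zero fun b => ?_
    rw [delta, if_neg, smul_zero]
    rw [Subgroup.coe_mul, ← rconj_rconj]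
    intro h
    rw [rconj_eq_iff, (mem_nrm.1 ((nrm H V).inv_mem b.2)).2] at h
    exact hc h
  rw [relTrace, finsum_eq_single _ (QuotientGroup.mk 1)]
  · have h0 := out_inv_mul_mem (A := nrm H V) (1 : H)
    set n := (QuotientGroup.mk (1 : H) : H ⧸ (nrm H V).subgroupOf H).out
    have hn : (n : G) ∈ nrm H V := by simpa using h0
    rw [← relTrace_mul_left (C.rightInv hz) ⟨n, hn⟩]
    refine relTrace_congr fun b => ?_
    have hb : rconj V ((n : G) * b) = V := (mem_nrm.1 ((nrm H V).mul_mem hn b.2)).2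
    simp only [Subgroup.coe_mul, delta, hb, if_true]
  · intro c hc
    refine h1 _ fun h => hc ?_
    rw [← Quotient.out_eq c]
    refine (mk_eq_iff_mem _ _).2 ?_
    simpa using (nrm H V).inv_mem (mem_nrm.2 ⟨c.out.2, h⟩)

/-- A choice of an `H`-conjugate that belongs to `P`. -/
theorem exists_conj_choice (H : Subgroup G) (P : Set (Subgroup G)) :
    ∃ r : Subgroup G → Subgroup G, (∀ h ∈ H, ∀ W, r (rconj W h) = r W) ∧
      ∀ W, (∃ h ∈ H, rconj W h ∈ P) → r W ∈ P ∧ ∃ h ∈ H, r W = rconj W h := by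
  refine ⟨fun W => Classical.epsilon fun V => V ∈ P ∧ ∃ h ∈ H, V = rconj W h,
    fun h hh W => ?_, fun W ⟨h, hh, hW⟩ => ?_⟩
  · simp only
    congr 1
    ext V
    refine and_congr_right fun _ => ⟨?_, ?_⟩
    · rintro ⟨k, hk, rfl⟩
      exact ⟨h * k, H.mul_mem hh hk, rconj_rconj W h k⟩
    · rintro ⟨k, hk, rfl⟩
      exact ⟨h⁻¹ * k, H.mul_mem (H.inv_mem hh) hk, by rw [rconj_rconj]; simp⟩
  · exact Classical.epsilon_spec (p := fun V => V ∈ P ∧ ∃ h ∈ H, V = rconj W h)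
      ⟨_, hW, h, hh, rfl⟩

variable [TopologicalSpace G]

theorem isTraceFamily_delta (S : TruncationSet H) {V : Subgroup G} (hV : V ≤ H) {z : Z}
    (hz : z ∈ C.grp V) (hVS : V ∈ S.carrier) :
    IsTraceFamily C (S.restrict V hV) (delta V z) where
  equivariant := delta_equivariant hz
  eq_zero W hW := if_neg <| by
    rintro rfl
    exact hW ⟨hVS, le_rfl⟩
  isTr W hW := by
    rw [delta]
    split_ifs with h
    · subst h
      have : nrm W W = W := le_antisymm (nrm_le W W) (le_nrm le_rfl)
      rw [this]
      exact isTr_self hz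
    · exact IsTr.zero _ _

/-- The support of `p` consists of subgroups with an `H`-conjugate in `K`. In each such class a
member `V ≤ K` is chosen; `p(V)` is the trace of some `z`, and `delta V z` induced first from `V` to
`K` and then from `K` to `H` reproduces `p` on the class of `V`. -/
theorem IsTraceFamily.exists_ver [IsTopologicalGroup G] [CompactSpace G] [K.FiniteIndex]
    (S : TruncationSet H) (hK : K ≤ H) {p : Subgroup G → Z} (hp : IsTraceFamily C S p)
    (h0 : ∀ V ∈ (S.diff K).carrier, p V = 0) :
    ∃ q, IsTraceFamily C (S.restrict K hK) q ∧
      ∀ W, relTrace K H (fun c => (c : G) • q (rconj W c)) = p W := by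
  classical
  obtain ⟨r, hr, hr'⟩ := exists_conj_choice H (S.restrict K hK).carrier
  choose z hz using hp.isTr
  -- `t L V` is the one-point family at `V`, induced from `V` to `L`.
  let t : Subgroup G → Subgroup G → Subgroup G → Z := fun L V W => if h : V ∈ S.carrier then
    relTrace V L (fun k => (k : G) • delta V (z V h) (rconj W k)) else 0
  have ht : ∀ V ∈ (S.restrict K hK).carrier, IsTraceFamily C (S.restrict K hK) (t K V) := by
    intro V hV
    have hVS : V ∈ S.carrier := hV.1
    have := S.finiteIndex hVS
    simp only [t, dif_pos hVS]
    have hS : ∀ U, U ∈ (S.restrict V (S.le V hVS)).carrier ↔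
        U ∈ (S.restrict K hK).carrier ∧ U ≤ V :=
      fun U => ⟨fun h => ⟨⟨h.1, h.2.trans hV.2⟩, h.2⟩, fun h => ⟨h.1.1, h.2⟩⟩
    exact (isTraceFamily_delta S (S.le V hVS) (hz V hVS).1 hVS).ver hV.2 hS
  have htr : ∀ V ∈ (S.restrict K hK).carrier, ∀ W,
      relTrace K H (fun c => (c : G) • t K V (rconj W c)) = t H V W := by
    intro V hV W
    have hVS : V ∈ S.carrier := hV.1
    have := S.finiteIndex hVS
    simp only [t, dif_pos hVS]
    rw [← relTrace_trans hV.2 hK (equivariant_rightInv (delta_equivariant (hz V hVS).1) W)]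
    refine relTrace_congr fun c => ?_
    rw [← DistribSMul.toAddMonoidHom_apply, map_relTrace]
    refine relTrace_congr fun b => ?_
    simp [mul_smul, rconj_rconj]
  have hmem : ∀ W ∈ (S.restrict K hK).carrier, r W ∈ (S.restrict K hK).carrier :=
    fun W hW => (hr' W ⟨1, H.one_mem, by rwa [rconj_one]⟩).1
  -- No sum over classes is needed: `t K V` is supported on conjugates of `V`, and `r` is constant
  -- on `H`-classes, so one term survives at each `W`.
  refine ⟨fun W => if W ∈ (S.restrict K hK).carrier then t K (r W) W else 0,
    ⟨fun k hk W => ?_, fun V hV => if_neg hV, fun V hV => ?_⟩, fun W => ?_⟩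
  · simp only [(S.restrict K hK).rconj_mem_iff hk]
    split_ifs with hW
    · rw [hr k (hK hk)]
      exact (ht _ (hmem W hW)).equivariant k hk W
    · exact smul_zero _
  · rw [if_pos hV]
    exact (ht _ (hmem V hV)).isTr V hV
  · by_cases hW : ∃ h ∈ H, rconj W h ∈ (S.restrict K hK).carrier
    · obtain ⟨hV, g, hg, e⟩ := hr' W hW
      have hVS : r W ∈ S.carrier := hV.1
      have := S.finiteIndex hVS
      trans relTrace K H (fun c => (c : G) • t K (r W) (rconj W c))
      · refine relTrace_congr fun c => ?_
        beta_reduce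
        split_ifs with hc
        · rw [hr _ c.2]
        · rw [(ht _ hV).eq_zero _ hc]
      · rw [htr _ hV]
        simp only [t, dif_pos hVS]
        -- By equivariance the comparison is moved from `W` to its conjugate `r W`, where
        -- `relTrace_delta` computes the value.
        rw [← relTrace_equivariant (delta_equivariant (hz _ hVS).1) hg W, ← e,
          relTrace_delta (S.le _ hVS) (hz _ hVS).1, ← (hz _ hVS).2]
        conv_lhs => rw [e]
        exact hp.equivariant g hg W
    · rw [relTrace_eq_zero]
      · by_cases hWS : W ∈ S.carrier
        · refine (h0 W ⟨hWS, fun ⟨h, hh, hW'⟩ => hW ⟨h, hh, S.conj W hWS h hh, hW'⟩⟩).symm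
        · exact (hp.eq_zero W hWS).symm
      · intro c
        beta_reduce
        rw [if_neg fun h => hW ⟨c, c.2, h⟩, smul_zero]

theorem IsGhost.exists_ver [IsTopologicalGroup G] [CompactSpace G] [K.FiniteIndex]
    (S : TruncationSet H) (hK : K ≤ H) {α : Subgroup G → Z} (hα : IsGhost C S α)
    (h0 : ∀ V ∈ (S.diff K).carrier, α V = 0) :
    ∃ β, IsGhost C (S.restrict K hK) β ∧
      ∀ U, relTrace K H (fun c => (c : G) • β (rconj U c)) = α U := by
  classical
  obtain ⟨p, hp, h⟩ := hα
  obtain ⟨q, hq, e⟩ := hp.exists_ver S hK (by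
    intro V hV
    have := (S.diff K).finiteIndex hV
    -- Since `S ∖ K` is upwards closed, the vanishing of `α` on it forces `p` to vanish there as
    -- well.
    refine eq_zero_of_zeta_eq_zero fun W hW => ?_
    by_cases hWH : W ≤ H
    · have hWS := (S.diff K).mem_of_le hV hW hWH
      have := h0 W hWS
      rwa [h, if_pos hWS.1] at this
    · exact zeta_eq_zero fun V' hV' => hp.eq_zero _ fun h => hWH (hV'.trans (S.le _ h)))
  refine ⟨fun U => if U ∈ (S.restrict K hK).carrier then zeta q U else 0, ⟨q, hq, fun _ => rfl⟩,
    fun U => ?_⟩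
  rw [h]
  split_ifs with hU
  · have := S.finiteIndex hU
    have := finite_overgroups U
    rw [zeta, finsum_congr fun W : {W // U ≤ W} => (e W.1).symm, ← relTrace_finsum]
    refine relTrace_congr fun b => ?_
    trans (b : G) • zeta q (rconj U b)
    · beta_reduce
      split_ifs with hb
      · rfl
      · rw [zeta_eq_zero]
        intro W hW
        refine hq.eq_zero W fun hW' => hb ⟨S.conj U hU b b.2, hW.trans ?_⟩
        exact (S.restrict K hK).le W hW'
    · rw [smul_zeta]
      exact (zeta_rconj (fun W => (b : G) • q W) U b).symm
  · refine relTrace_eq_zero fun b => ?_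
    beta_reduce
    rw [if_neg, smul_zero]
    exact fun h => hU ((S.rconj_mem_iff b.2).1 h.1)

end Kernel

/-! ### Free coefficients -/

section FreeCoeff

variable {G : Type v} [Group G]

variable (G) in
/-- Monomials: an exponent with rational entries and a function on `G`. -/
def GMono (A B : Type u) : Type (max u v) := (A →₀ ℚ) × (G → B)

variable (G) in
/-- The free abelian group on the monomials. -/
abbrev GSpace (A B : Type u) : Type (max u v) := GMono G A B →₀ ℤ

variable {A B : Type u}

/-- Right translation is the action that turns the isomorphisms `act` into multiplication by `g`,
see `iota_act`. -/
instance : MulAction G (GMono G A B) where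
  smul g x := (x.1, fun a => x.2 (a * g))
  one_smul x := Prod.ext rfl (funext fun a => congrArg x.2 (mul_one a))
  mul_smul g h x := Prod.ext rfl (funext fun a => congrArg x.2 (mul_assoc a g h).symm)

/-- A monomial as an element of the free abelian group. -/
def gsingle (x : GMono G A B) : GSpace G A B := Finsupp.single x 1

instance : DistribMulAction G (GSpace G A B) where
  smul g z := Finsupp.mapDomain (g • · : GMono G A B → GMono G A B) z
  one_smul z := by
    change Finsupp.mapDomain (fun x : GMono G A B => (1 : G) • x) z = z
    simp only [one_smul]
    exact Finsupp.mapDomain_id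
  mul_smul g h z := by
    change Finsupp.mapDomain (fun x : GMono G A B => (g * h) • x) z =
      Finsupp.mapDomain _ (Finsupp.mapDomain _ z)
    rw [← Finsupp.mapDomain_comp]
    simp only [mul_smul]
    rfl
  smul_zero g := Finsupp.mapDomain_zero
  smul_add g := fun z z' => Finsupp.mapDomain_add

theorem smul_gsingle (g : G) (x : GMono G A B) : g • gsingle x = gsingle (g • x) :=
  Finsupp.mapDomain_single

variable (A) in
/-- The monomial `t • ⨂ b(x)` of `Q^{⊗ G/U}`. -/
def tmono (U : Subgroup G) (t : A →₀ ℕ) (b : G ⧸ U → B) :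
    TP (MvPolynomial A ℤ) (B →₀ MvPolynomial A ℤ) U :=
  (MvPolynomial.monomial t (1 : ℤ) • PiTensorProduct.tprod (MvPolynomial A ℤ)
    (fun x => Finsupp.single (b x) 1) :
    ⨂[MvPolynomial A ℤ] _ : G ⧸ U, (B →₀ MvPolynomial A ℤ))

variable (A B) in
/-- The basis of monomials. -/
def monoBasis (U : Subgroup G) [Finite (G ⧸ U)] :
    Module.Basis ((A →₀ ℕ) × (G ⧸ U → B)) ℤ
      (⨂[MvPolynomial A ℤ] _ : G ⧸ U, (B →₀ MvPolynomial A ℤ)) :=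
  (MvPolynomial.basisMonomials A ℤ).smulTower
    (Basis.piTensorProduct fun _ : G ⧸ U => Finsupp.basisSingleOne (R := MvPolynomial A ℤ) (ι := B))

variable (A B) in
/-- The coordinates with respect to the basis of monomials. -/
def monoRepr (U : Subgroup G) [Finite (G ⧸ U)] :
    TP (MvPolynomial A ℤ) (B →₀ MvPolynomial A ℤ) U ≃+ ((A →₀ ℕ) × (G ⧸ U → B) →₀ ℤ) :=
  (monoBasis A B U).repr.toAddEquiv

theorem monoBasis_apply (U : Subgroup G) [Finite (G ⧸ U)] (t : A →₀ ℕ) (b : G ⧸ U → B) :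
    monoBasis A B U (t, b) = MvPolynomial.monomial t (1 : ℤ) •
      PiTensorProduct.tprod (MvPolynomial A ℤ) (fun x => Finsupp.single (b x) 1) := by
  rw [monoBasis, Module.Basis.smulTower_apply, MvPolynomial.coe_basisMonomials,
    Basis.piTensorProduct_apply]
  simp only [Finsupp.coe_basisSingleOne]

theorem monoRepr_tmono (U : Subgroup G) [Finite (G ⧸ U)] (t : A →₀ ℕ) (b : G ⧸ U → B) :
    monoRepr A B U (tmono A U t b) = Finsupp.single (t, b) 1 := by
  have := (monoBasis A B U).repr_self (t, b)
  rw [monoBasis_apply] at this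
  exact this

/-- Additive maps out of `Q^{⊗ G/U}` are determined on monomials. -/
theorem TP.hom_ext {U : Subgroup G} [Finite (G ⧸ U)] {Y : Type*} [AddCommGroup Y]
    {φ ψ : TP (MvPolynomial A ℤ) (B →₀ MvPolynomial A ℤ) U →+ Y}
    (h : ∀ t b, φ (tmono A U t b) = ψ (tmono A U t b)) : φ = ψ := by
  have : φ.comp (monoRepr A B U).symm.toAddMonoidHom =
      ψ.comp (monoRepr A B U).symm.toAddMonoidHom := by
    refine Finsupp.addHom_ext' fun x => AddMonoidHom.ext_int ?_
    have hx : (monoRepr A B U).symm (Finsupp.single x 1) = tmono A U x.1 x.2 := by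
      rw [AddEquiv.symm_apply_eq, monoRepr_tmono]
    change φ ((monoRepr A B U).symm (Finsupp.single x 1)) =
      ψ ((monoRepr A B U).symm (Finsupp.single x 1))
    rw [hx, h]
  ext x
  have := DFunLike.congr_fun this (monoRepr A B U x)
  simpa using this

/-- The monomial, with normalised exponent. -/
def toGMono (U : Subgroup G) (t : A →₀ ℕ) (b : G ⧸ U → B) : GMono G A B :=
  ((U.index : ℚ)⁻¹ • t.mapRange (Nat.cast : ℕ → ℚ) Nat.cast_zero, fun a => b a)

theorem toGMono_injective (U : Subgroup G) [U.FiniteIndex] :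
    Function.Injective fun x : (A →₀ ℕ) × (G ⧸ U → B) => toGMono U x.1 x.2 := by
  rintro ⟨t, b⟩ ⟨t', b'⟩ h
  have h1 := congrArg Prod.fst h
  have h2 := congrArg Prod.snd h
  simp only [toGMono] at h1 h2
  have hk : (U.index : ℚ)⁻¹ ≠ 0 := inv_ne_zero (by exact_mod_cast Subgroup.FiniteIndex.index_ne_zero)
  refine Prod.ext ?_ (funext fun c => ?_)
  · exact Finsupp.mapRange_injective _ Nat.cast_zero Nat.cast_injective
      (smul_right_injective _ hk h1)
  · obtain ⟨a, rfl⟩ := QuotientGroup.mk_surjective c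
    exact congrFun h2 a

open Classical in
/-- The embedding of `Q^{⊗ G/U}` into the free abelian group on the monomials. -/
def iota (U : Subgroup G) :
    TP (MvPolynomial A ℤ) (B →₀ MvPolynomial A ℤ) U →+ GSpace G A B :=
  if _h : U.FiniteIndex then
    have : Finite (G ⧸ U) := Subgroup.finite_quotient_of_finiteIndex
    (Finsupp.mapDomain.addMonoidHom fun x : (A →₀ ℕ) × (G ⧸ U → B) => toGMono U x.1 x.2).comp
      (monoRepr A B U).toAddMonoidHom
  -- A dummy value: open subgroups of a compact group have finite index.
  else 0

theorem iota_tmono (U : Subgroup G) [h : U.FiniteIndex] (t : A →₀ ℕ) (b : G ⧸ U → B) :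
    iota U (tmono A U t b) = gsingle (toGMono U t b) := by
  have : Finite (G ⧸ U) := Subgroup.finite_quotient_of_finiteIndex
  rw [iota, dif_pos h]
  change Finsupp.mapDomain _ (monoRepr A B U (tmono A U t b)) = _
  rw [monoRepr_tmono, Finsupp.mapDomain_single]
  rfl

theorem iota_injective (U : Subgroup G) [h : U.FiniteIndex] :
    Function.Injective (iota (A := A) (B := B) U) := by
  rw [iota, dif_pos h]
  exact (Finsupp.mapDomain_injective (toGMono_injective U)).comp
    (monoRepr A B U).injective

theorem act_tmono (g : G) (U : Subgroup G) (t : A →₀ ℕ) (b : G ⧸ rconj U g → B) :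
    act g U (tmono A (rconj U g) t b) = tmono A U t fun x => b ((cosetEquiv U g).symm x) := by
  change PiTensorProduct.reindex (MvPolynomial A ℤ) (fun _ => B →₀ MvPolynomial A ℤ)
    (cosetEquiv U g) (_ • PiTensorProduct.tprod (MvPolynomial A ℤ) _) = _
  rw [map_smul, PiTensorProduct.reindex_tprod]
  rfl

/-- The exponent is compatible because conjugate subgroups have the same index. -/
theorem iota_act (g : G) (U : Subgroup G)
    (x : TP (MvPolynomial A ℤ) (B →₀ MvPolynomial A ℤ) (rconj U g)) :
    iota U (act g U x) = g • iota (rconj U g) x := by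
  by_cases h : U.FiniteIndex
  · have : Finite (G ⧸ rconj U g) := Subgroup.finite_quotient_of_finiteIndex
    refine DFunLike.congr_fun (f := (iota U).comp (act g U))
      (g := (DistribSMul.toAddMonoidHom _ g).comp (iota (rconj U g))) (TP.hom_ext fun t b => ?_) x
    simp only [AddMonoidHom.comp_apply, DistribSMul.toAddMonoidHom_apply]
    rw [act_tmono, iota_tmono, iota_tmono, smul_gsingle]
    congr 1
    refine Prod.ext ?_ (funext fun a => rfl)
    simp only [toGMono, index_rconj]
    rfl
  · have h' : ¬ (rconj U g).FiniteIndex := fun h' => h ⟨by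
      rw [← index_rconj U g]
      exact h'.index_ne_zero⟩
    rw [iota, iota, dif_neg h, dif_neg h']
    simp

theorem range_iota_le {U : Subgroup G} [U.FiniteIndex] {P : AddSubgroup (GSpace G A B)}
    (hP : ∀ t b, gsingle (toGMono U t b) ∈ P) : (iota U).range ≤ P := by
  have : Finite (G ⧸ U) := Subgroup.finite_quotient_of_finiteIndex
  have : (QuotientAddGroup.mk' P).comp (iota U) = 0 := TP.hom_ext fun t b => by
    rw [AddMonoidHom.comp_apply, iota_tmono]
    exact (QuotientAddGroup.eq_zero_iff _).2 (hP t b)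
  rintro _ ⟨x, rfl⟩
  exact (QuotientAddGroup.eq_zero_iff _).1 (DFunLike.congr_fun this x)

/-- The purpose of dividing exponents by the index: a monomial at `V` is identified with its tensor
power over `V/U`, whose exponent is multiplied by `[V : U]`. This gives `C(V) ≤ C(U)` in
`freeCoeff`. -/
theorem toGMono_mono {U V : Subgroup G} [U.FiniteIndex] (hUV : U ≤ V) (t : A →₀ ℕ)
    (b : G ⧸ V → B) : toGMono V t b = toGMono U (U.relIndex V • t)
      (fun x => b (Quotient.map' id (fun _ _ h => by
        rw [QuotientGroup.leftRel_apply] at h ⊢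
        exact hUV h) x)) := by
  refine Prod.ext ?_ rfl
  ext a
  have h0 : (U.index : ℚ) ≠ 0 := by exact_mod_cast Subgroup.FiniteIndex.index_ne_zero
  have h1 : (U.index : ℚ) = U.relIndex V * V.index := by
    exact_mod_cast (Subgroup.relIndex_mul_index hUV).symm
  have h2 : (U.relIndex V : ℚ) ≠ 0 := fun h => h0 (by rw [h1, h, zero_mul])
  have h3 : (V.index : ℚ) ≠ 0 := fun h => h0 (by rw [h1, h, mul_zero])
  simp only [toGMono, Finsupp.smul_apply, Finsupp.mapRange_apply, smul_eq_mul, Nat.cast_mul, h1]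
  field_simp

variable (G A B) in
/-- The coefficient system of free coefficients. -/
def freeCoeff : CoeffSystem G (GSpace G A B) where
  grp U := (iota U).range
  anti {U V} hU hUV := by
    have : V.FiniteIndex := Subgroup.finiteIndex_of_le hUV
    refine range_iota_le fun t b => ?_
    rw [toGMono_mono hUV, ← iota_tmono]
    exact ⟨_, rfl⟩
  smul_mem U g := by
    rintro _ ⟨x, rfl⟩
    exact ⟨_, iota_act g U x⟩
  smul_eq {U u z} hu hz := by
    by_cases h : U.FiniteIndex
    · have := range_iota_le (U := U)
        (P := ((DistribSMul.toAddMonoidHom (GSpace G A B) u) - AddMonoidHom.id _).ker) (by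
          intro t b
          rw [AddMonoidHom.mem_ker, AddMonoidHom.sub_apply, DistribSMul.toAddMonoidHom_apply,
            AddMonoidHom.id_apply, sub_eq_zero, smul_gsingle]
          refine congrArg gsingle (Prod.ext rfl (funext fun a => ?_))
          refine congrArg b (QuotientGroup.eq.2 ?_)
          simpa using hu) hz
      exact sub_eq_zero.1 this
    · rw [iota, dif_neg h] at hz
      obtain ⟨x, rfl⟩ := hz
      exact smul_zero _

end FreeCoeff

/-! ### Expansion of tensor powers -/

section Expansion

variable {G : Type v} [Group G] {A B : Type u}

theorem tpow_eq {R M X Y : Type*} [CommRing R] [AddCommGroup M] [Module R M] [h : Finite Y]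
    (n : ⨂[R] _ : X, M) : tpow (Y := Y) n = PiTensorProduct.reindex R (fun _ => M)
      (Equiv.prodCongr (Equiv.refl X) (Finite.equivFin Y).symm)
      (nestFin R M X (Nat.card Y) fun _ => n) := by
  rw [tpow, dif_pos h]

/-- The tensor product over `V / U` of elements of `M^{⊗ G/V}`, as an element of `M^{⊗ G/U}`. -/
def cosetProd {R M : Type u} [CommRing R] [AddCommGroup M] [Module R M] {U V : Subgroup G}
    (h : U ≤ V) [Finite (V ⧸ U.subgroupOf V)] :
    MultilinearMap R (fun _ : Fin (Nat.card (V ⧸ U.subgroupOf V)) => ⨂[R] _ : G ⧸ V, M)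
      (⨂[R] _ : G ⧸ U, M) :=
  ((PiTensorProduct.reindex R (fun _ => M) (Subgroup.quotientEquivProdOfLE h).symm).toLinearMap ∘ₗ
    (PiTensorProduct.reindex R (fun _ => M) (Equiv.prodCongr (Equiv.refl (G ⧸ V))
      (Finite.equivFin (V ⧸ U.subgroupOf V)).symm)).toLinearMap).compMultilinearMap
    (nestFin R M (G ⧸ V) (Nat.card (V ⧸ U.subgroupOf V)))

theorem cosetPow_eq_cosetProd {R M : Type u} [CommRing R] [AddCommGroup M] [Module R M]
    {U V : Subgroup G} (h : U ≤ V) [Finite (V ⧸ U.subgroupOf V)] (n : TP R M V) :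
    cosetPow h n = cosetProd h fun _ => n := by
  exact congrArg (PiTensorProduct.reindex R (fun _ => M)
    (Subgroup.quotientEquivProdOfLE h).symm) (tpow_eq n)

theorem cosetProd_tprod {R M : Type u} [CommRing R] [AddCommGroup M] [Module R M]
    {U V : Subgroup G} (h : U ≤ V) [Finite (V ⧸ U.subgroupOf V)]
    (m : Fin (Nat.card (V ⧸ U.subgroupOf V)) → G ⧸ V → M) :
    cosetProd (R := R) h (fun j => PiTensorProduct.tprod R (m j)) =
      PiTensorProduct.tprod R fun x => m
        (Finite.equivFin (V ⧸ U.subgroupOf V) (Subgroup.quotientEquivProdOfLE h x).2)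
        (Subgroup.quotientEquivProdOfLE h x).1 := by
  simp only [cosetProd, LinearMap.compMultilinearMap_apply, nestFin_tprod, LinearMap.comp_apply,
    LinearEquiv.coe_coe, PiTensorProduct.reindex_tprod]
  rfl

/-- Expansion of the tensor power of a linear combination of monomials. -/
theorem cosetPow_sum {U V : Subgroup G} (h : U ≤ V) [Fintype (V ⧸ U.subgroupOf V)]
    {I : Type*} [Fintype I] [Fintype (V ⧸ U.subgroupOf V → I)] (c : I → ℤ) (t : I → A →₀ ℕ) (b : I → G ⧸ V → B) :
    cosetPow h (∑ i, c i • tmono A V (t i) (b i)) =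
      ∑ f : V ⧸ U.subgroupOf V → I, (∏ y, c (f y)) • tmono A U (∑ y, t (f y)) fun x =>
        b (f (Subgroup.quotientEquivProdOfLE h x).2) (Subgroup.quotientEquivProdOfLE h x).1 := by
  classical
  let e := Finite.equivFin (V ⧸ U.subgroupOf V)
  have key : ∀ U (c : ℤ) (t : A →₀ ℕ) (b : G ⧸ U → B), c • tmono A U t b =
      (MvPolynomial.monomial t c • PiTensorProduct.tprod (MvPolynomial A ℤ)
        (fun x => Finsupp.single (b x) 1) :
        ⨂[MvPolynomial A ℤ] _ : G ⧸ U, (B →₀ MvPolynomial A ℤ)) := by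
    intro U c t b
    have : MvPolynomial.monomial t c = (c : MvPolynomial A ℤ) * MvPolynomial.monomial t 1 := by
      rw [← eq_intCast MvPolynomial.C c, MvPolynomial.C_mul_monomial, mul_one]
    rw [this, mul_smul]
    exact (Int.cast_smul_eq_zsmul (MvPolynomial A ℤ) c
      (MvPolynomial.monomial t (1 : ℤ) • PiTensorProduct.tprod (MvPolynomial A ℤ)
        (fun x => Finsupp.single (b x) 1) :
          ⨂[MvPolynomial A ℤ] _ : G ⧸ U, (B →₀ MvPolynomial A ℤ))).symm
  rw [cosetPow_eq_cosetProd]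
  have e1 : (∑ i, c i • tmono A V (t i) (b i)) =
      (∑ i, MvPolynomial.monomial (t i) (c i) • PiTensorProduct.tprod (MvPolynomial A ℤ)
        (fun x => Finsupp.single (b i x) 1) :
        ⨂[MvPolynomial A ℤ] _ : G ⧸ V, (B →₀ MvPolynomial A ℤ)) :=
    Finset.sum_congr rfl fun i _ => key V _ _ _
  refine (congrArg (cosetProd h) (funext fun _ => e1)).trans ?_
  -- Multilinearity expands the power into a sum over functions from the enumerated set `V/U` to
  -- `I`.
  refine (MultilinearMap.map_sum (cosetProd h) (fun _ i => _)).trans ?_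
  refine Fintype.sum_equiv (Equiv.arrowCongr e.symm (Equiv.refl I)) _ _ fun f => ?_
  refine (MultilinearMap.map_smul_univ (cosetProd h) _ _).trans ?_
  rw [cosetProd_tprod, key, ← MvPolynomial.monomial_sum_prod]
  have e2 : ∑ j, t (f j) = ∑ y, t (Equiv.arrowCongr e.symm (Equiv.refl I) f y) :=
    (e.sum_comp fun j => t (f j)).symm
  have e3 : ∏ j, c (f j) = ∏ y, c (Equiv.arrowCongr e.symm (Equiv.refl I) f y) :=
    (e.prod_comp fun j => c (f j)).symm
  rw [e2, e3]
  rfl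

end Expansion

/-! ### Monomials attached to functions on V -/

section Norm

variable {G : Type v} [Group G] {A B : Type u}

/-- Functions on `V`, with `V` acting by translation of the argument. -/
def VFun (V : Subgroup G) (I : Type*) : Type _ := V → I

instance (V : Subgroup G) (I : Type*) : MulAction V (VFun V I) where
  smul v f := fun s => f (s * v)
  one_smul f := funext fun s => congrArg f (mul_one s)
  mul_smul v w f := funext fun s => congrArg f (mul_assoc s v w).symm

theorem stab_le {N : Subgroup G} {Ω : Type*} [MulAction N Ω] (ω : Ω) : stab N ω ≤ N :=
  fun _ h => (mem_stab.1 h).1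

theorem rconj_stab_smul {N : Subgroup G} {Ω : Type*} [MulAction N Ω] (n : N) (ω : Ω) :
    rconj (stab N (n • ω)) (n : G) = stab N ω := by
  ext x
  rw [mem_rconj, mem_stab, mem_stab]
  constructor
  · rintro ⟨h, e⟩
    have hx : x ∈ N := by
      have := N.mul_mem (N.mul_mem (N.inv_mem n.2) h) n.2
      simpa [mul_assoc] using this
    refine ⟨hx, ?_⟩
    have e' : (⟨(n : G) * x * (n : G)⁻¹, h⟩ : N) = n * ⟨x, hx⟩ * n⁻¹ := rfl
    rw [e', ← mul_smul, inv_mul_cancel_right, mul_smul] at e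
    exact smul_left_cancel n e
  · rintro ⟨hx, e⟩
    refine ⟨N.mul_mem (N.mul_mem n.2 hx) (N.inv_mem n.2), ?_⟩
    have e' : (⟨(n : G) * x * (n : G)⁻¹, N.mul_mem (N.mul_mem n.2 hx) (N.inv_mem n.2)⟩ : N) =
      n * ⟨x, hx⟩ * n⁻¹ := rfl
    rw [e', ← mul_smul, inv_mul_cancel_right, mul_smul, e]

theorem stab_smul {N : Subgroup G} {Ω : Type*} [MulAction N Ω] (n : N) (ω : Ω) :
    stab N (n • ω) = rconj (stab N ω) (n : G)⁻¹ := by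
  rw [← rconj_eq_iff, rconj_stab_smul]

theorem VFun.rightInv {V U : Subgroup G} {I Y : Type*} {f : VFun V I} (hf : U ≤ stab V f)
    (φ : I → Y) : RightInv U fun v : V => φ (f v) := fun g a ha => by
  obtain ⟨h, e⟩ := mem_stab.1 (hf ha)
  exact congrArg φ (congrFun e g)

/-- A rational exponent attached to a natural exponent. -/
def castExp (t : A →₀ ℕ) : A →₀ ℚ := t.mapRange (Nat.cast : ℕ → ℚ) Nat.cast_zero

/-- The average of the exponents `t(f(v))`. -/
def avgExp {V : Subgroup G} {I : Type*} (t : I → A →₀ ℕ) (f : VFun V I) : A →₀ ℚ :=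
  ((stab V f).index : ℚ)⁻¹ • relTrace (stab V f) V fun v => castExp (t (f v))

/-- Passing from the stabiliser to a smaller subgroup `U` multiplies both the trace and the index by
`[stab : U]`, so any such `U` computes the same exponent. -/
theorem avgExp_eq {V : Subgroup G} {I : Type*} (t : I → A →₀ ℕ) {f : VFun V I} {U : Subgroup G}
    [U.FiniteIndex] (hU : U ≤ stab V f) :
    avgExp t f = (U.index : ℚ)⁻¹ • relTrace U V fun v => castExp (t (f v)) := by
  have hf := VFun.rightInv hU fun i => castExp (t i)
  have hf' := VFun.rightInv (le_refl (stab V f)) fun i => castExp (t i)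
  have : (stab V f).FiniteIndex := Subgroup.finiteIndex_of_le hU
  rw [← relTrace_trans hU (stab_le f) hf]
  have e : ∀ c : V, relTrace U (stab V f) (fun b => castExp (t (f (c * ⟨b, stab_le f b.2⟩)))) =
      (U.relIndex (stab V f)) • castExp (t (f c)) := by
    intro c
    rw [← relTrace_const]
    exact relTrace_congr fun b => hf' c ⟨b, stab_le f b.2⟩ b.2
  have e2 := map_relTrace (stab V f) V
    (nsmulAddMonoidHom (α := A →₀ ℚ) (U.relIndex (stab V f))) fun v => castExp (t (f v))
  simp only [nsmulAddMonoidHom_apply] at e2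
  rw [relTrace_congr e, ← e2, avgExp, ← Nat.cast_smul_eq_nsmul ℚ, smul_smul]
  congr 1
  have h0 : (U.index : ℚ) ≠ 0 := by exact_mod_cast Subgroup.FiniteIndex.index_ne_zero
  have h1 : (U.index : ℚ) = U.relIndex (stab V f) * (stab V f).index := by
    exact_mod_cast (Subgroup.relIndex_mul_index hU).symm
  have h2 : (U.relIndex (stab V f) : ℚ) ≠ 0 := fun h => h0 (by rw [h1, h, zero_mul])
  rw [h1, mul_inv, mul_right_comm, inv_mul_cancel₀ h2, one_mul]

theorem avgExp_smul {V : Subgroup G} {I : Type*} (t : I → A →₀ ℕ) (v : V) (f : VFun V I) :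
    avgExp t (v • f) = avgExp t f := by
  have hf := VFun.rightInv (le_refl (stab V f)) fun i => castExp (t i)
  have e : rconj (stab V (v • f)) (v : G) = stab V f := rconj_stab_smul v f
  rw [← e] at hf
  have := relTrace_mul_right v hf
  rw [avgExp, avgExp, ← e, index_rconj, ← this]
  rfl

theorem out_inv_mul_mem' {V : Subgroup G} (a : G) :
    (QuotientGroup.mk a : G ⧸ V).out⁻¹ * a ∈ V := by
  rw [← QuotientGroup.eq]
  exact Quotient.out_eq _

/-- The monomial attached to a function from `V` to an index set of monomials. -/
def zmono {V : Subgroup G} {I : Type*} (t : I → A →₀ ℕ) (b : I → G ⧸ V → B) (f : VFun V I) :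
    GMono G A B :=
  (avgExp t f, fun a => b (f ⟨_, out_inv_mul_mem' a⟩) a)

/-- Right translation by `v ∈ V` fixes the coset `aV` and its chosen representative, and changes
only the component of `a` in `V`. Translating `f` has the same effect. -/
theorem zmono_smul {V : Subgroup G} {I : Type*} (t : I → A →₀ ℕ) (b : I → G ⧸ V → B)
    (v : V) (f : VFun V I) : zmono t b (v • f) = (v : G) • zmono t b f := by
  refine Prod.ext (avgExp_smul t v f) (funext fun a => ?_)
  have e : (QuotientGroup.mk (a * v) : G ⧸ V) = QuotientGroup.mk a :=
    QuotientGroup.mk_mul_of_mem a v.2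
  change b (f (⟨_, out_inv_mul_mem' a⟩ * v)) (QuotientGroup.mk a) =
    b (f ⟨_, out_inv_mul_mem' (a * v)⟩) (QuotientGroup.mk (a * v))
  have e2 : (⟨_, out_inv_mul_mem' a⟩ * v : V) = ⟨_, out_inv_mul_mem' (a * v)⟩ := by
    refine Subtype.ext ?_
    simp only [Subgroup.coe_mul]
    rw [e, mul_assoc]
  exact congrArg₂ (fun s x => b (f s) x) e2 e.symm

/-- The function on `V` induced by a function on `V / U`. -/
def VFun.ofQuot {U V : Subgroup G} {I : Type*} (f : V ⧸ U.subgroupOf V → I) : VFun V I :=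
  fun v => f v

theorem VFun.le_stab_ofQuot {U V : Subgroup G} (hU : U ≤ V) {I : Type*}
    (f : V ⧸ U.subgroupOf V → I) : U ≤ stab V (VFun.ofQuot f) := by
  intro u hu
  refine mem_stab.2 ⟨hU hu, funext fun s => congrArg f ?_⟩
  exact QuotientGroup.mk_mul_of_mem s hu

theorem VFun.exists_ofQuot {U V : Subgroup G} {I : Type*} {f : VFun V I}
    (hf : U ≤ stab V f) : ∃ f' : V ⧸ U.subgroupOf V → I, VFun.ofQuot f' = f := by
  refine ⟨fun c => f c.out, funext fun v => ?_⟩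
  exact ((VFun.rightInv hf id).eq (out_inv_mul_mem v)).symm

/-- The terms of the expansion at `U` depend only on the function pulled back to `V`. This is what
allows expansions at different `U` to be compared. -/
theorem zmono_ofQuot {U V : Subgroup G} (hU : U ≤ V) [U.FiniteIndex]
    [Fintype (V ⧸ U.subgroupOf V)] {I : Type*} (t : I → A →₀ ℕ) (b : I → G ⧸ V → B)
    (f : V ⧸ U.subgroupOf V → I) :
    toGMono U (∑ y, t (f y)) (fun x => b (f (Subgroup.quotientEquivProdOfLE hU x).2)
      (Subgroup.quotientEquivProdOfLE hU x).1) = zmono t b (VFun.ofQuot f) := by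
  refine Prod.ext ?_ (funext fun a => rfl)
  simp only [toGMono, zmono]
  rw [avgExp_eq t (VFun.le_stab_ofQuot hU f)]
  congr 1
  change castExp _ = _
  have : ∀ s : Finset (V ⧸ U.subgroupOf V), castExp (∑ y ∈ s, t (f y)) =
      ∑ y ∈ s, castExp (t (f y)) := by
    intro s
    exact map_sum (Finsupp.mapRange.addMonoidHom (Nat.castAddMonoidHom ℚ) : (A →₀ ℕ) →+ _) _ _
  rw [this, relTrace, finsum_eq_sum_of_fintype]
  refine Finset.sum_congr rfl fun y _ => ?_
  conv_lhs => rw [← Quotient.out_eq y]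
  rfl

/-- The coefficient at `U` of the monomial attached to `f`. -/
def vcoef {V : Subgroup G} {I : Type*} (c : I → ℤ) (U : Subgroup G) (f : VFun V I) : ℤ :=
  -- A trace in the additive copy of the multiplicative monoid `ℤ`: a product over `V/U`.
  Additive.toMul (relTrace U V fun v => Additive.ofMul (c (f v)))

theorem vcoef_ofQuot {U V : Subgroup G} [Fintype (V ⧸ U.subgroupOf V)]
    {I : Type*} (c : I → ℤ) (f : V ⧸ U.subgroupOf V → I) :
    vcoef c U (VFun.ofQuot f) = ∏ y, c (f y) := by
  rw [vcoef, relTrace, finsum_eq_sum_of_fintype]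
  refine Finset.prod_congr rfl fun y _ => ?_
  conv_rhs => rw [← Quotient.out_eq y]
  rfl

theorem vcoef_smul {V U : Subgroup G} {I : Type*} (c : I → ℤ) (v : V) {f : VFun V I}
    (hf : rconj U (v : G) ≤ stab V f) : vcoef c U (v • f) = vcoef c (rconj U (v : G)) f := by
  rw [vcoef, vcoef, ← relTrace_mul_right v (VFun.rightInv hf fun i => Additive.ofMul (c i))]
  rfl

theorem finite_vfun {V U : Subgroup G} (hU : U ≤ V) [U.FiniteIndex] (I : Type*) [Finite I] :
    Finite {f : VFun V I // U ≤ stab V f} :=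
  Finite.of_surjective (fun f' : V ⧸ U.subgroupOf V → I =>
    (⟨VFun.ofQuot f', VFun.le_stab_ofQuot hU f'⟩ : {f : VFun V I // U ≤ stab V f}))
    fun f => (VFun.exists_ofQuot f.2).imp fun _ h => Subtype.ext h

/-- Functions on `V/U` are the functions on `V` whose stabiliser contains `U`. All tensor powers are
thereby sums over parts of one `V`-set, and apart from the range of summation only the coefficients
depend on `U`. -/
theorem iota_cosetPow {U V : Subgroup G} (hU : U ≤ V) [U.FiniteIndex] {I : Type*} [Fintype I]
    (c : I → ℤ) (t : I → A →₀ ℕ) (b : I → G ⧸ V → B) :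
    iota U (cosetPow hU (∑ i, c i • tmono A V (t i) (b i))) =
      ∑ᶠ f : {f : VFun V I // U ≤ stab V f}, vcoef c U f.1 • gsingle (zmono t b f.1) := by
  classical
  have := Fintype.ofFinite (V ⧸ U.subgroupOf V)
  rw [cosetPow_sum, map_sum, ← finsum_eq_sum_of_fintype]
  refine finsum_eq_of_bijective (fun f' : V ⧸ U.subgroupOf V → I =>
    (⟨VFun.ofQuot f', VFun.le_stab_ofQuot hU f'⟩ : {f : VFun V I // U ≤ stab V f}))
    ⟨fun f f' h => funext fun y => ?_,
      fun f => (VFun.exists_ofQuot f.2).imp fun _ h => Subtype.ext h⟩ fun f => ?_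
  · obtain ⟨v, rfl⟩ := QuotientGroup.mk_surjective y
    exact congrFun (congrArg (fun x => x.1) h) v
  · rw [map_zsmul, iota_tmono, zmono_ofQuot, vcoef_ofQuot]

theorem gsingle_zmono_mem {U V : Subgroup G} (hU : U ≤ V) [U.FiniteIndex] {I : Type*}
    (t : I → A →₀ ℕ) (b : I → G ⧸ V → B) {f : VFun V I} (hf : U ≤ stab V f) :
    gsingle (zmono t b f) ∈ (freeCoeff G A B).grp U := by
  have := Fintype.ofFinite (V ⧸ U.subgroupOf V)
  obtain ⟨f', rfl⟩ := VFun.exists_ofQuot hf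
  rw [← zmono_ofQuot hU, ← iota_tmono]
  exact ⟨_, rfl⟩

end Norm

/-! ### Moebius inversion and sums over functions with given stabiliser -/

section NormGhost

variable {G : Type v} [Group G]

theorem zeta_sub {Z : Type*} [AddCommGroup Z] (p q : Subgroup G → Z) (U : Subgroup G)
    [U.FiniteIndex] : zeta (fun W => p W - q W) U = zeta p U - zeta q U := by
  simp only [sub_eq_add_neg]
  rw [zeta_add, zeta_neg]

/-- If all sums of `p` lie in a decreasing family of subgroups, then so does `p`. -/
theorem mem_of_zeta_mem {Z : Type*} [AddCommGroup Z] {p : Subgroup G → Z}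
    {P : Subgroup G → AddSubgroup Z}
    (hP : ∀ {U V : Subgroup G}, U.FiniteIndex → U ≤ V → P V ≤ P U) {U : Subgroup G}
    [hU : U.FiniteIndex] (h : ∀ W, U ≤ W → zeta p W ∈ P W) : p U ∈ P U := by
  obtain ⟨n, hn⟩ : ∃ n, U.index = n := ⟨_, rfl⟩
  induction n using Nat.strong_induction_on generalizing U with
  | _ n ih =>
    have h0 := h U le_rfl
    rw [zeta_eq_self_add] at h0
    refine (AddSubgroup.add_mem_cancel_right _ ?_).1 h0
    refine finsum_induction (· ∈ P U) (zero_mem _) (fun _ _ => add_mem) ?_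
    rintro ⟨W, hW⟩
    have : W.FiniteIndex := Subgroup.finiteIndex_of_le hW.le
    exact hP hU hW.le (ih W.index (hn ▸ Subgroup.index_strictAnti hW)
      (fun W' hW' => h W' (hW.le.trans hW')) rfl)

open Classical in
/-- Moebius inversion over the members of `P`. -/
def moebius {Z : Type*} [AddCommGroup Z] (P : Set (Subgroup G)) (α : Subgroup G → Z)
    (U : Subgroup G) : Z :=
  -- The condition on indices serves termination; for `U` of finite index it follows from `U < W`.
  if U ∈ P then α U - ∑ᶠ W : {W : Subgroup G // U < W ∧ W.index < U.index}, moebius P α W.1 else 0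
termination_by U.index
decreasing_by exact W.2.2

theorem zeta_moebius {Z : Type*} [AddCommGroup Z] {P : Set (Subgroup G)} (α : Subgroup G → Z)
    {U : Subgroup G} [U.FiniteIndex] (hU : U ∈ P) : zeta (moebius P α) U = α U := by
  rw [zeta_eq_self_add, moebius, if_pos hU, sub_add_eq_add_sub, sub_eq_iff_eq_add]
  congr 1
  exact finsum_eq_of_bijective (fun W : {W : Subgroup G // U < W} =>
    (⟨W.1, W.2, Subgroup.index_strictAnti W.2⟩ : {W : Subgroup G // U < W ∧ W.index < U.index}))
    ⟨fun W W' h => Subtype.ext (congrArg (fun x => x.1) h), fun W => ⟨⟨W.1, W.2.1⟩, rfl⟩⟩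
    fun _ => rfl

theorem moebius_eq_zero {Z : Type*} [AddCommGroup Z] {P : Set (Subgroup G)} (α : Subgroup G → Z)
    {U : Subgroup G} (hU : U ∉ P) : moebius P α U = 0 := by
  rw [moebius, if_neg hU]

theorem eq_of_zeta_eq {Z : Type*} [AddCommGroup Z] {H : Subgroup G} [TopologicalSpace G]
    [IsTopologicalGroup G] [CompactSpace G] (S : TruncationSet H) {p q : Subgroup G → Z}
    (hp : ∀ V ∉ S.carrier, p V = 0) (hq : ∀ V ∉ S.carrier, q V = 0)
    (h : ∀ U ∈ S.carrier, zeta p U = zeta q U) : p = q := by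
  funext V
  by_cases hV : V ∈ S.carrier
  · have := S.finiteIndex hV
    refine sub_eq_zero.1 (eq_zero_of_zeta_eq_zero (p := fun W => p W - q W) fun W hW => ?_)
    have : W.FiniteIndex := Subgroup.finiteIndex_of_le hW
    rw [zeta_sub, sub_eq_zero]
    by_cases hWH : W ≤ H
    · exact h W (S.mem_of_le hV hW hWH)
    · rw [zeta_eq_zero fun W' hW' => hp W' fun h => hWH (hW'.trans (S.le _ h)),
        zeta_eq_zero fun W' hW' => hq W' fun h => hWH (hW'.trans (S.le _ h))]
  · rw [hp V hV, hq V hV]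

variable {A B : Type u}

/-- The sum of the monomials attached to the functions with stabiliser `W`. -/
def orbitSum {V : Subgroup G} {I : Type*} (t : I → A →₀ ℕ) (b : I → G ⧸ V → B)
    (W : Subgroup G) : GSpace G A B :=
  ∑ᶠ f : {f : VFun V I // stab V f = W}, gsingle (zmono t b f.1)

theorem finite_vfun_stab {V W : Subgroup G} [W.FiniteIndex] (I : Type*) [Finite I] :
    Finite {f : VFun V I // stab V f = W} := by
  by_cases hW : W ≤ V
  · have := finite_vfun hW I
    exact Finite.of_injective (fun f : {f : VFun V I // stab V f = W} =>
      (⟨f.1, f.2.ge⟩ : {f : VFun V I // W ≤ stab V f})) fun _ _ h =>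
        Subtype.ext (congrArg (fun x => x.1) h)
  · have : IsEmpty {f : VFun V I // stab V f = W} := ⟨fun f => hW (f.2.ge.trans (stab_le f.1))⟩
    infer_instance

/-- Functions fixed by `U` are sorted by their exact stabiliser. When all coefficients are `1`,
`orbitSum` is thus the inverse of the family of tensor powers. -/
theorem zeta_orbitSum {U V : Subgroup G} (hU : U ≤ V) [U.FiniteIndex] {I : Type*} [Finite I]
    (t : I → A →₀ ℕ) (b : I → G ⧸ V → B) :
    zeta (orbitSum t b) U =
      ∑ᶠ f : {f : VFun V I // U ≤ stab V f}, gsingle (zmono t b f.1) := by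
  classical
  have := finite_overgroups U
  have := finite_vfun hU I
  have := Fintype.ofFinite {f : VFun V I // U ≤ stab V f}
  have := Fintype.ofFinite {W : Subgroup G // U ≤ W}
  let φ : {f : VFun V I // U ≤ stab V f} → {W : Subgroup G // U ≤ W} := fun f => ⟨stab V f.1, f.2⟩
  have e2 : ∀ W : {W // U ≤ W}, orbitSum t b W.1 =
      ∑ f : {f : {f : VFun V I // U ≤ stab V f} // φ f = W}, gsingle (zmono t b f.1.1) := by
    intro W
    rw [← finsum_eq_sum_of_fintype]
    exact finsum_eq_of_bijective (fun f => ⟨⟨f.1, f.2.symm ▸ W.2⟩, Subtype.ext f.2⟩)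
      ⟨fun f f' h => Subtype.ext (congrArg (fun x => x.1.1) h),
        fun f => ⟨⟨f.1.1, congrArg Subtype.val f.2⟩, rfl⟩⟩ fun _ => rfl
  rw [zeta, finsum_congr e2, finsum_eq_sum_of_fintype, finsum_eq_sum_of_fintype]
  exact Fintype.sum_fiberwise φ fun f => gsingle (zmono t b f.1)

/-- `N_V(W)` permutes the functions with stabiliser exactly `W`, and the stabiliser of each in
`N_V(W)` is `W`. Every orbit therefore contributes a trace from `W`. -/
theorem isTr_orbitSum {V W : Subgroup G} (hW : W ≤ V) [W.FiniteIndex] {I : Type*} [Finite I]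
    (t : I → A →₀ ℕ) (b : I → G ⧸ V → B) :
    IsTr (freeCoeff G A B) W (nrm V W) (orbitSum t b W) := by
  have := finite_vfun_stab (V := V) (W := W) I
  have hst : ∀ (n : nrm V W) (f : VFun V I), stab V f = W →
      stab V ((⟨n, nrm_le V W n.2⟩ : V) • f) = W := by
    intro n f hf
    rw [stab_smul, hf]
    exact (mem_nrm.1 ((nrm V W).inv_mem n.2)).2
  let a : MulAction (nrm V W) {f : VFun V I // stab V f = W} :=
    { smul := fun n f => ⟨(⟨n, nrm_le V W n.2⟩ : V) • f.1, hst n f.1 f.2⟩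
      one_smul := fun f => Subtype.ext (one_smul V f.1)
      mul_smul := fun m n f => Subtype.ext
        (mul_smul (⟨m, nrm_le V W m.2⟩ : V) (⟨n, nrm_le V W n.2⟩ : V) f.1) }
  refine IsTr.of_orbits (N := nrm V W) ?_ ?_
  · intro n f
    rw [smul_gsingle]
    exact congrArg gsingle (zmono_smul t b (⟨n, nrm_le V W n.2⟩ : V) f.1)
  · intro f _
    have hs : stab (nrm V W) f = W := by
      ext x
      rw [mem_stab]
      conv_rhs => rw [← f.2]
      rw [mem_stab]
      constructor
      · rintro ⟨h, e⟩
        exact ⟨nrm_le V W h, congrArg Subtype.val e⟩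
      · rintro ⟨h, e⟩
        have hx : x ∈ W := by
          rw [← f.2]
          exact mem_stab.2 ⟨h, e⟩
        exact ⟨le_nrm hW hx, Subtype.ext e⟩
    rw [hs]
    exact ⟨le_rfl, isTr_self (gsingle_zmono_mem hW t b f.2.ge)⟩

variable [TopologicalSpace G] [IsTopologicalGroup G] [CompactSpace G]

open Classical in
/-- The family of tensor powers of `n`. -/
def normFam (V : Subgroup G) (n : TP (MvPolynomial A ℤ) (B →₀ MvPolynomial A ℤ) V)
    (U : Subgroup G) : GSpace G A B :=
  if h : U ∈ (TruncationSet.all V).carrier then iota U (cosetPow h.2 n) else 0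

/-- Translation by `v` matches the functions fixed by `U^v` with those fixed by `U`, preserving
coefficients and translating monomials. -/
theorem normFam_equivariant {V : Subgroup G} {I : Type*} [Fintype I]
    (c : I → ℤ) (t : I → A →₀ ℕ) (b : I → G ⧸ V → B) {v : G} (hv : v ∈ V) (U : Subgroup G) :
    v • normFam V (∑ i, c i • tmono A V (t i) (b i)) (rconj U v) =
      normFam V (∑ i, c i • tmono A V (t i) (b i)) U := by
  by_cases hU : U ∈ (TruncationSet.all V).carrier
  · have hU' := (TruncationSet.all V).conj U hU v hv
    have := (TruncationSet.all V).finiteIndex hU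
    rw [normFam, dif_pos hU', normFam, dif_pos hU, iota_cosetPow, iota_cosetPow,
      ← DistribSMul.toAddMonoidHom_apply]
    have := finite_vfun hU'.2 I
    rw [AddMonoidHom.map_finsum _ (Set.toFinite _)]
    have hle : ∀ f : VFun V I, U ≤ stab V ((⟨v, hv⟩ : V) • f) ↔ rconj U v ≤ stab V f := by
      intro f
      rw [stab_smul, ← rconj_le_rconj (g := v), rconj_cancel_inv]
    refine finsum_eq_of_bijective (fun f : {f : VFun V I // rconj U v ≤ stab V f} =>
      (⟨(⟨v, hv⟩ : V) • f.1, (hle f.1).2 f.2⟩ : {f : VFun V I // U ≤ stab V f}))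
      ⟨fun f f' h => ?_, fun f => ?_⟩ fun f => ?_
    · exact Subtype.ext (smul_left_cancel _ (congrArg Subtype.val h))
    · refine ⟨⟨(⟨v, hv⟩ : V)⁻¹ • f.1, (hle _).1 ?_⟩, Subtype.ext (smul_inv_smul _ _)⟩
      rw [smul_inv_smul]
      exact f.2
    · rw [DistribSMul.toAddMonoidHom_apply, smul_comm, smul_gsingle]
      simp only
      rw [zmono_smul, vcoef_smul c ⟨v, hv⟩ f.2]
  · have hU' := fun h => hU (((TruncationSet.all V).rconj_mem_iff hv).1 h)
    rw [normFam, dif_neg hU', normFam, dif_neg hU, smul_zero]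

end NormGhost

/-! ### Tensor powers form a ghost family -/

section NormIsGhost

variable {G : Type v} [Group G] {A B : Type u}

theorem exists_sum_tmono {V : Subgroup G} [V.FiniteIndex]
    (n : TP (MvPolynomial A ℤ) (B →₀ MvPolynomial A ℤ) V) :
    ∃ (I : Finset ((A →₀ ℕ) × (G ⧸ V → B))) (c : I → ℤ),
      n = ∑ i : I, c i • tmono A V i.1.1 i.1.2 := by
  have : Finite (G ⧸ V) := Subgroup.finite_quotient_of_finiteIndex
  refine ⟨(monoRepr A B V n).support, fun i => monoRepr A B V n i, ?_⟩
  apply (monoRepr A B V).injective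
  rw [map_sum]
  simp only [map_zsmul, monoRepr_tmono]
  conv_lhs => rw [← Finsupp.sum_single (monoRepr A B V n)]
  rw [Finsupp.sum, ← Finset.sum_coe_sort]
  refine Finset.sum_congr rfl fun i _ => ?_
  simp

theorem vcoef_modEq {V U : Subgroup G} [U.FiniteIndex] {I : Type*} {c c' : I → ℤ} {N : ℤ}
    (h : ∀ i, c i ≡ c' i [ZMOD N]) {f : VFun V I} (hf : U ≤ stab V f) :
    vcoef c U f ≡ vcoef c' U f [ZMOD N] := by
  have := Fintype.ofFinite (V ⧸ U.subgroupOf V)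
  obtain ⟨f', rfl⟩ := VFun.exists_ofQuot hf
  rw [vcoef_ofQuot, vcoef_ofQuot]
  exact Int.ModEq.prod fun y _ => h _

theorem IsTr.smul_eq {Z : Type*} [AddCommGroup Z] [DistribMulAction G Z] {C : CoeffSystem G Z}
    {A N : Subgroup G} [A.FiniteIndex] {y : Z} (hy : IsTr C A N y) {n : G} (hn : n ∈ N) :
    n • y = y := by
  obtain ⟨z, hz, rfl⟩ := hy
  conv_rhs => rw [← relTrace_mul_left (C.rightInv hz) ⟨n, hn⟩]
  rw [← DistribSMul.toAddMonoidHom_apply, map_relTrace]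
  refine relTrace_congr fun b => ?_
  simp [mul_smul]

variable [TopologicalSpace G] [IsTopologicalGroup G] [CompactSpace G]

/-- Repeating the `i`-th monomial `c' i` times with coefficient `1` gives an element whose powers
are sums over functions without coefficients. Congruent coefficients have congruent products, so the
two expansions agree modulo `N`. -/
theorem normFam_sub_mem {V : Subgroup G} {I : Type*} [Fintype I] {c : I → ℤ}
    {c' : I → ℕ} {N : ℕ} (hc : ∀ i, c i ≡ c' i [ZMOD N]) (t : I → A →₀ ℕ) (b : I → G ⧸ V → B)
    {U : Subgroup G} (hU : U ∈ (TruncationSet.all V).carrier) :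
    normFam V (∑ i, c i • tmono A V (t i) (b i)) U -
      zeta (orbitSum (fun j : Σ i, Fin (c' i) => t j.1) (fun j => b j.1)) U ∈
        ((freeCoeff G A B).grp U).map (nsmulAddMonoidHom N) := by
  have := (TruncationSet.all V).finiteIndex hU
  have e1 : zeta (orbitSum (fun j : Σ i, Fin (c' i) => t j.1) (fun j => b j.1)) U =
      iota U (cosetPow hU.2 (∑ j : Σ i, Fin (c' i), (1 : ℤ) • tmono A V (t j.1) (b j.1))) := by
    rw [iota_cosetPow hU.2 (fun _ => 1), zeta_orbitSum hU.2]
    refine finsum_congr fun f => ?_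
    have : vcoef (fun _ : Σ i, Fin (c' i) => (1 : ℤ)) U f.1 = 1 := by
      have := Fintype.ofFinite (V ⧸ U.subgroupOf V)
      obtain ⟨f', hf'⟩ := VFun.exists_ofQuot f.2
      rw [← hf', vcoef_ofQuot, Finset.prod_const_one]
    rw [this, one_smul]
  have e2 : ∑ j : Σ i, Fin (c' i), (1 : ℤ) • tmono A V (t j.1) (b j.1) =
      ∑ i, (c' i : ℤ) • tmono A V (t i) (b i) := by
    rw [Fintype.sum_sigma]
    refine Finset.sum_congr rfl fun i _ => ?_
    simp
  have := finite_vfun hU.2 I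
  rw [e1, e2, normFam, dif_pos hU, iota_cosetPow, iota_cosetPow,
    ← finsum_sub_distrib (Set.toFinite _) (Set.toFinite _)]
  refine finsum_induction (· ∈ ((freeCoeff G A B).grp U).map (nsmulAddMonoidHom N))
    (zero_mem _) (fun _ _ => add_mem) fun f => ?_
  obtain ⟨k, hk⟩ := (vcoef_modEq hc f.2).symm.dvd
  rw [← sub_smul, hk]
  refine ⟨k • gsingle (zmono t b f.1), zsmul_mem (gsingle_zmono_mem hU.2 t b f.2) k, ?_⟩
  rw [nsmulAddMonoidHom_apply, mul_smul, natCast_zsmul]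

/-- The arithmetic core, in the role of Dwork's congruences. The Moebius inverse of the powers at
`W` has to be a trace from `W` to `N_V(W)`. Modulo `N = [N_V(W) : W]` it equals `orbitSum`, which is
such a trace; the error is `N • y` with `y` fixed by `N_V(W)`, hence the trace of `y`. -/
theorem normFam_isGhost {V : Subgroup G} (hV : IsOpen (V : Set G))
    (n : TP (MvPolynomial A ℤ) (B →₀ MvPolynomial A ℤ) V) :
    IsGhost (freeCoeff G A B) (TruncationSet.all V) (normFam V n) := by
  classical
  have := finiteIndex_of_isOpen hV
  obtain ⟨I, c, rfl⟩ := exists_sum_tmono n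
  set α := normFam V (∑ i : I, c i • tmono A V i.1.1 i.1.2) with hα
  -- Equivariance of the inverse follows from that of the tensor powers, because inversion is
  -- unique.
  have hequiv : ∀ v ∈ V, ∀ U, v • moebius (TruncationSet.all V).carrier α (rconj U v) =
      moebius (TruncationSet.all V).carrier α U := by
    intro v hv U
    refine congrFun (eq_of_zeta_eq (TruncationSet.all V)
      (p := fun U => v • moebius (TruncationSet.all V).carrier α (rconj U v))
      (fun W hW => ?_) (fun W hW => moebius_eq_zero α hW) fun W hW => ?_) U
    · rw [moebius_eq_zero, smul_zero]
      exact fun h => hW (((TruncationSet.all V).rconj_mem_iff hv).1 h)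
    · have hW' := (TruncationSet.all V).conj W hW v hv
      have := (TruncationSet.all V).finiteIndex hW
      rw [zeta_moebius α hW, zeta_rconj (fun W => v • moebius (TruncationSet.all V).carrier α W),
        ← smul_zeta, zeta_moebius α hW']
      exact normFam_equivariant c (fun i : I => i.1.1) (fun i => i.1.2) hv W
  refine ⟨moebius (TruncationSet.all V).carrier α, ⟨hequiv, fun W hW => moebius_eq_zero α hW,
    fun W hW => ?_⟩, fun U => ?_⟩
  · have := (TruncationSet.all V).finiteIndex hW
    set N := W.relIndex (nrm V W) with hN
    have hN0 : N ≠ 0 := (W.subgroupOf (nrm V W)).index_ne_zero_of_finite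
    -- Non-negative residues are needed because `c' i` counts copies of a monomial.
    let c' : I → ℕ := fun i => (c i % N).toNat
    have hc : ∀ i, c i ≡ c' i [ZMOD N] := by
      intro i
      have : ((c' i : ℕ) : ℤ) = c i % N :=
        Int.toNat_of_nonneg (Int.emod_nonneg _ (by exact_mod_cast hN0))
      rw [this]
      exact (Int.mod_modEq _ _).symm
    let q : Subgroup G → GSpace G A B :=
      orbitSum (fun j : Σ i : I, Fin (c' i) => j.1.1.1) (fun j => j.1.1.2)
    have hq : IsTr (freeCoeff G A B) W (nrm V W) (q W) := isTr_orbitSum hW.2 _ _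
    -- The congruence modulo `N` of all sums passes to the summands, since the subgroups `N • C(U)`
    -- are nested.
    have hd : moebius (TruncationSet.all V).carrier α W - q W ∈
        ((freeCoeff G A B).grp W).map (nsmulAddMonoidHom N) := by
      refine mem_of_zeta_mem (p := fun W => moebius (TruncationSet.all V).carrier α W - q W)
        (P := fun U => ((freeCoeff G A B).grp U).map (nsmulAddMonoidHom N))
        (fun hU h => AddSubgroup.map_mono ((freeCoeff G A B).anti hU h)) fun U hU => ?_
      have : U.FiniteIndex := Subgroup.finiteIndex_of_le hU
      by_cases hUV : U ≤ V
      · have hU' := (TruncationSet.all V).mem_of_le hW hU hUV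
        rw [zeta_sub, zeta_moebius α hU']
        exact normFam_sub_mem hc _ _ hU'
      · rw [zeta_eq_zero]
        · exact zero_mem _
        · intro W' hW'
          rw [moebius_eq_zero α fun h => hUV (hW'.trans h.2), zero_sub, neg_eq_zero]
          have : IsEmpty {f : VFun V (Σ i : I, Fin (c' i)) // stab V f = W'} :=
            ⟨fun f => hUV (hW'.trans (f.2.ge.trans (stab_le f.1)))⟩
          exact finsum_of_isEmpty _
    obtain ⟨y, hy, e⟩ := hd
    rw [nsmulAddMonoidHom_apply] at e
    have hfix : ∀ k ∈ nrm V W, k • y = y := by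
      intro k hk
      -- The space of monomials is torsion-free and `N • y` is a difference of fixed elements.
      refine nsmul_right_injective hN0 ?_
      have h1 := hequiv k hk.1 W
      rw [(mem_nrm.1 hk).2] at h1
      simp only
      rw [← smul_comm, e, smul_sub, h1, hq.smul_eq hk]
    rw [← sub_add_cancel (moebius (TruncationSet.all V).carrier α W) (q W), ← e]
    refine IsTr.add ⟨y, hy, ?_⟩ hq
    -- The trace of a fixed element is the index times the element.
    rw [hN, ← relTrace_const]
    exact relTrace_congr fun k => (hfix k k.2).symm
  · split_ifs with hU
    · have := (TruncationSet.all V).finiteIndex hU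
      exact (zeta_moebius α hU).symm
    · rw [hα, normFam, dif_neg hU]

theorem cosetPow_self {V : Subgroup G} (hV : IsOpen (V : Set G)) (h : V ≤ V)
    (n : TP (MvPolynomial A ℤ) (B →₀ MvPolynomial A ℤ) V) : cosetPow h n = n := by
  classical
  have := finiteIndex_of_isOpen hV
  obtain ⟨I, c, rfl⟩ := exists_sum_tmono n
  have hu : Subsingleton (V ⧸ V.subgroupOf V) := by
    rw [Subgroup.subgroupOf_self]
    exact QuotientGroup.subsingleton_quotient_top
  let _ : Unique (V ⧸ V.subgroupOf V) := Unique.mk' _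
  rw [cosetPow_sum h c (fun i : I => i.1.1) (fun i => i.1.2)]
  refine Fintype.sum_equiv (Equiv.funUnique _ I) _ _ fun f => ?_
  have hf : ∀ y, f y = f default := fun y => congrArg f (Subsingleton.elim _ _)
  simp only [hf, Finset.univ_unique, Finset.prod_singleton, Finset.sum_singleton,
    Equiv.funUnique_apply]
  have hx : ∀ x : G ⧸ V, (Subgroup.quotientEquivProdOfLE h x).1 = x := by
    intro x
    obtain ⟨a, rfl⟩ := QuotientGroup.mk_surjective x
    rfl
  simp only [hx]

/-- A conjugate of `V` contained in `V` has the same index, so it equals `V`. -/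
theorem normFam_rconj_self {V : Subgroup G} (hV : IsOpen (V : Set G))
    (n : TP (MvPolynomial A ℤ) (B →₀ MvPolynomial A ℤ) V) {c : G} :
    normFam V n (rconj V c) = delta V (iota V n) (rconj V c) := by
  have := finiteIndex_of_isOpen hV
  rw [delta]
  split_ifs with h
  · rw [h, normFam, dif_pos (show V ∈ (TruncationSet.all V).carrier from ⟨hV, le_rfl⟩),
      cosetPow_self hV]
  · rw [normFam, dif_neg]
    rintro ⟨-, h'⟩
    rcases h'.lt_or_eq with h' | h'
    · have := Subgroup.index_strictAnti h'
      rw [index_rconj] at this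
      exact lt_irrefl _ this
    · exact h h'

end NormIsGhost

/-! ### The image of the ghost map is the group of ghost families -/

section Total

variable {G : Type v} [Group G] [TopologicalSpace G] {H K : Subgroup G}

section Families

variable {Z : Type*} [AddCommGroup Z] [DistribMulAction G Z] {C : CoeffSystem G Z}

theorem zeta_eq_zero_of_not_le {S : TruncationSet H} {p : Subgroup G → Z}
    (hp : IsTraceFamily C S p) {U : Subgroup G} (hU : ¬ U ≤ H) : zeta p U = 0 :=
  zeta_eq_zero fun W hW => hp.eq_zero W fun h => hU (hW.trans (S.le W h))

theorem IsGhost.eq_zero {S : TruncationSet H} {α : Subgroup G → Z} (hα : IsGhost C S α)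
    {U : Subgroup G} (hU : U ∉ S.carrier) : α U = 0 := by
  obtain ⟨p, -, h⟩ := hα
  rw [h, if_neg hU]

variable [IsTopologicalGroup G] [CompactSpace G]

theorem IsTraceFamily.eq_zero_of_forall {S : TruncationSet H} {p : Subgroup G → Z}
    (hp : IsTraceFamily C S p) {U : Subgroup G} (hU : U ∈ S.carrier)
    (h : ∀ W ∈ S.carrier, U ≤ W → zeta p W = 0) : p U = 0 := by
  have := S.finiteIndex hU
  refine eq_zero_of_zeta_eq_zero fun W hW => ?_
  by_cases hWH : W ≤ H
  · exact h W (S.mem_of_le hU hW hWH) hW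
  · exact zeta_eq_zero_of_not_le hp hWH

/-- A locally finite sum of ghost families is a ghost family. -/
theorem IsGhost.finsum {S : TruncationSet H} {E : Type*} {α : E → Subgroup G → Z}
    (hα : ∀ e, IsGhost C S (α e)) (hfin : ∀ U ∈ S.carrier, {e | α e U ≠ 0}.Finite) :
    IsGhost C S fun U => ∑ᶠ e, α e U := by
  choose p hp hpα using hα
  -- Local finiteness passes from `α` to `p`: a value of `p` is determined by `α` at the finitely
  -- many overgroups in `S`.
  have hpfin : ∀ U ∈ S.carrier, {e | ∃ W, U ≤ W ∧ p e W ≠ 0}.Finite := by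
    intro U hU
    have := S.finiteIndex hU
    have := finite_overgroups U
    have : Finite {W : Subgroup G // U ≤ W ∧ W ∈ S.carrier} :=
      Finite.of_injective (fun W => (⟨W.1, W.2.1⟩ : {W : Subgroup G // U ≤ W}))
        fun a b h => Subtype.ext (Subtype.mk.inj h)
    refine (Set.finite_iUnion fun W : {W : Subgroup G // U ≤ W ∧ W ∈ S.carrier} =>
      hfin W.1 W.2.2).subset ?_
    · rintro e ⟨W, hW, he⟩
      by_contra hne
      refine he ?_
      by_cases hWS : W ∈ S.carrier
      · refine (hp e).eq_zero_of_forall hWS fun W' hW' hWW' => ?_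
        by_contra h0
        refine hne (Set.mem_iUnion.2 ⟨⟨W', hW.trans hWW', hW'⟩, ?_⟩)
        rwa [Set.mem_ofPred_eq, hpα, if_pos hW']
      · exact (hp e).eq_zero W hWS
  refine ⟨fun U => ∑ᶠ e, p e U, ⟨fun h hh U => ?_, fun V hV => ?_, fun V hV => ?_⟩, fun U => ?_⟩
  · rw [← DistribSMul.toAddMonoidHom_apply,
      AddMonoidHom.map_finsum_of_injective _ (MulAction.injective h)]
    exact finsum_congr fun e => (hp e).equivariant h hh U
  · exact finsum_eq_zero_of_forall_eq_zero fun e => (hp e).eq_zero V hV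
  · have := S.finiteIndex hV
    exact IsTr.finsum fun e => (hp e).isTr V hV
  · split_ifs with hU
    · have := S.finiteIndex hU
      have := finite_overgroups U
      have hs : ∀ W, U ≤ W → (∑ᶠ e, p e W) = ∑ e ∈ (hpfin U hU).toFinset, p e W := fun W hW =>
        finsum_eq_sum_of_support_subset _ fun e he => by
          rw [Set.Finite.coe_toFinset]
          exact ⟨W, hW, he⟩
      beta_reduce
      rw [zeta_congr hs, zeta, finsum_sum_comm _ _ fun _ _ => Set.toFinite _]
      rw [finsum_eq_sum_of_support_subset (s := (hpfin U hU).toFinset)]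
      · refine Finset.sum_congr rfl fun e _ => ?_
        rw [hpα, if_pos hU, zeta]
      · intro e he
        rw [Set.Finite.coe_toFinset]
        by_contra hne
        refine he ((hpα e U).trans ?_)
        rw [if_pos hU]
        refine zeta_eq_zero fun W hW => ?_
        by_contra h0
        exact hne ⟨W, hW, h0⟩
    · refine finsum_eq_zero_of_forall_eq_zero fun e => ?_
      rw [hpα, if_neg hU]

theorem IsGhost.sub {S : TruncationSet H} {α β : Subgroup G → Z} (hα : IsGhost C S α)
    (hβ : IsGhost C S β) : IsGhost C S (fun U => α U - β U) := by
  simpa only [sub_eq_add_neg] using hα.add hβ.neg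

/-- A leading-term principle: if `α` vanishes strictly above `V`, then so does `p`, and `α(V) =
p(V)`. It makes the next ghost equation solvable in `exists_ghost_eq`. -/
theorem IsGhost.isTr_of_zero_above {S : TruncationSet H} {α : Subgroup G → Z}
    (hα : IsGhost C S α) {V : Subgroup G} (hV : V ∈ S.carrier)
    (h : ∀ U ∈ S.carrier, V < U → α U = 0) : IsTr C V (nrm H V) (α V) := by
  obtain ⟨p, hp, e⟩ := hα
  have := S.finiteIndex hV
  rw [e, if_pos hV, zeta_eq_self_add, finsum_eq_zero_of_forall_eq_zero, add_zero]
  · exact hp.isTr V hV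
  · rintro ⟨W, hW⟩
    by_cases hWS : W ∈ S.carrier
    · refine hp.eq_zero_of_forall hWS fun W' hW' hWW' => ?_
      have := h W' hW' (hW.trans_le hWW')
      rwa [e, if_pos hW'] at this
    · exact hp.eq_zero W hWS

end Families

theorem finsum_subtype_eq {E Y : Type*} [AddCommMonoid Y] (p : E → Prop) [DecidablePred p]
    (f : E → Y) : ∑ᶠ e : {e // p e}, f e.1 = ∑ᶠ e : E, if p e then f e else 0 :=
  (finsum_set_coe_eq_finsum_mem {e | p e}).trans
    (finsum_congr fun e => finsum_eq_if.trans (by congr))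

variable {A B : Type u}

open Classical in
/-- The family of ghost components of `a`, as elements of the space of monomials. -/
def tot {S : TruncationSet H} (a : GhostProd S (MvPolynomial A ℤ) (B →₀ MvPolynomial A ℤ))
    (U : Subgroup G) : GSpace G A B :=
  if h : U ∈ S.carrier then iota U (a ⟨U, h⟩) else 0

section

variable {S : TruncationSet H} (a b : GhostProd S (MvPolynomial A ℤ) (B →₀ MvPolynomial A ℤ))

theorem tot_of_mem {U : Subgroup G} (hU : U ∈ S.carrier) : tot a U = iota U (a ⟨U, hU⟩) :=
  dif_pos hU

theorem tot_of_notMem {U : Subgroup G} (hU : U ∉ S.carrier) : tot a U = 0 := dif_neg hU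

theorem tot_add : tot (a + b) = fun U => tot a U + tot b U := by
  funext U
  by_cases hU : U ∈ S.carrier
  · simp only [tot_of_mem _ hU, Pi.add_apply, map_add]
  · simp only [tot_of_notMem _ hU, add_zero]

theorem tot_neg : tot (-a) = fun U => - tot a U := by
  funext U
  by_cases hU : U ∈ S.carrier
  · simp only [tot_of_mem _ hU, Pi.neg_apply, map_neg]
  · simp only [tot_of_notMem _ hU, neg_zero]

theorem tot_zero : tot (0 : GhostProd S (MvPolynomial A ℤ) (B →₀ MvPolynomial A ℤ)) =
    fun _ => 0 := by
  funext U
  by_cases hU : U ∈ S.carrier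
  · rw [tot_of_mem _ hU]
    exact map_zero _
  · exact tot_of_notMem _ hU

theorem tot_injective [IsTopologicalGroup G] [CompactSpace G] {a b : GhostProd S (MvPolynomial A ℤ) (B →₀ MvPolynomial A ℤ)}
    (h : tot a = tot b) : a = b := by
  funext U
  have := S.finiteIndex U.2
  have := congrFun h U.1
  rw [tot_of_mem _ U.2, tot_of_mem _ U.2] at this
  exact iota_injective U.1 this

theorem tot_ghostFrob {S' : TruncationSet K}
    (hS : ∀ U, U ∈ S'.carrier ↔ U ∈ S.carrier ∧ U ≤ K) {U : Subgroup G} (hU : U ∈ S'.carrier) :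
    tot (ghostFrob S S' hS a) U = tot a U := by
  rw [tot_of_mem _ hU, tot_of_mem _ ((hS U).1 hU).1, ghostFrob]

theorem tot_ghostTrunc {S' : TruncationSet H} (hS : S'.carrier ⊆ S.carrier) {U : Subgroup G}
    (hU : U ∈ S'.carrier) : tot (ghostTrunc S S' hS a) U = tot a U := by
  rw [tot_of_mem _ hU, tot_of_mem _ (hS hU), ghostTrunc]

theorem tot_ghostConj {S' : TruncationSet K} {g : G}
    (hS : ∀ U, U ∈ S'.carrier ↔ rconj U g ∈ S.carrier) :
    tot (ghostConj g S S' hS a) = fun U => g • tot a (rconj U g) := by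
  funext U
  by_cases hU : U ∈ S'.carrier
  · rw [tot_of_mem _ hU, tot_of_mem _ ((hS U).1 hU), ghostConj, iota_act]
  · rw [tot_of_notMem _ hU, tot_of_notMem _ fun h => hU ((hS U).2 h), smul_zero]

variable [IsTopologicalGroup G] [CompactSpace G]

theorem tot_ghostVer {S' : TruncationSet K}
    (hS : ∀ U, U ∈ S'.carrier ↔ U ∈ S.carrier ∧ U ≤ K)
    (a : GhostProd S' (MvPolynomial A ℤ) (B →₀ MvPolynomial A ℤ)) :
    tot (ghostVer S S' hS a) = fun U => relTrace K H fun c => (c : G) • tot a (rconj U c) := by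
  funext U
  by_cases hU : U ∈ S.carrier
  · have := S.finiteIndex hU
    rw [tot_of_mem _ hU, ghostVer, AddMonoidHom.map_finsum_of_injective _ (iota_injective U),
      relTrace]
    refine finsum_congr fun c => ?_
    split_ifs with h
    · rw [iota_act, tot_of_mem]
    -- Terms outside `K` need no case distinction on the right, because `tot` is zero off the
    -- truncation set.
    · rw [map_zero, tot_of_notMem _ fun h' => h ((hS _).1 h').2, smul_zero]
  · rw [tot_of_notMem _ hU]
    refine (relTrace_eq_zero fun c => ?_).symm
    rw [tot_of_notMem _ fun h' => hU ((S.rconj_mem_iff c.2).1 ((hS _).1 h').1), smul_zero]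

end

section Ghost

/-- Every such `V` contains the normal core of `U`, which has finite index. This makes the outer sum
in the ghost map finite. -/
theorem finite_reps_rconj_le [IsTopologicalGroup G] [CompactSpace G] {S : TruncationSet H}
    {U : Subgroup G} (hU : U ∈ S.carrier) :
    {V : S.reps | ∃ c ∈ H, rconj U c ≤ V.1.1}.Finite := by
  have := S.finiteIndex hU
  have := finite_overgroups U.normalCore
  refine Set.Finite.of_finite_image
    (f := fun V : S.reps => V.1.1) ?_ fun V _ W _ h => Subtype.ext (Subtype.ext h)
  refine (Set.toFinite (Set.range (Subtype.val : {W // U.normalCore ≤ W} → _))).subset ?_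
  rintro _ ⟨V, ⟨c, hc, hcV⟩, rfl⟩
  exact ⟨⟨V.1.1, fun x hx => hcV (hx c)⟩, rfl⟩

theorem reps_eq_of_rconj {S : TruncationSet H} {V W : S.reps} {h : G} (hh : h ∈ H)
    (e : W.1.1 = rconj V.1.1 h) : V = W := by
  obtain ⟨⟨_, x, rfl⟩, ⟨_, y, rfl⟩⟩ := V, W
  have : x = y := Quotient.out_equiv_out.1 (show S.setoid _ _ from ⟨h, hh, e⟩)
  subst this
  rfl

theorem exists_reps_rconj {S : TruncationSet H} {U : Subgroup G} (hU : U ∈ S.carrier) :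
    ∃ V : S.reps, ∃ h ∈ H, V.1.1 = rconj U h := by
  obtain ⟨h, hh, e⟩ := S.setoid.symm (Quotient.mk_out (s := S.setoid) ⟨U, hU⟩)
  exact ⟨⟨_, _, rfl⟩, h, hh, e⟩

variable (S : TruncationSet H)

open Classical in
/-- The contribution of `n ∈ Q^{⊗ G/V}` to the ghost components. -/
def verNorm (V : Subgroup G) [IsTopologicalGroup G]
    (n : TP (MvPolynomial A ℤ) (B →₀ MvPolynomial A ℤ) V)
    (U : Subgroup G) : GSpace G A B :=
  if U ∈ S.carrier then relTrace V H fun c => (c : G) • normFam V n (rconj U c) else 0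

variable [IsTopologicalGroup G]

theorem normFam_of_not_le {V U : Subgroup G}
    (n : TP (MvPolynomial A ℤ) (B →₀ MvPolynomial A ℤ) V) (h : ¬ U ≤ V) :
    normFam V n U = 0 := by
  rw [normFam, dif_neg fun h' => h h'.2]

theorem exists_of_verNorm_ne_zero {S : TruncationSet H} {V U : Subgroup G}
    {n : TP (MvPolynomial A ℤ) (B →₀ MvPolynomial A ℤ) V} (h : verNorm S V n U ≠ 0) :
    ∃ c ∈ H, rconj U c ≤ V := by
  by_contra! hc
  refine h ?_
  rw [verNorm]
  split_ifs
  · refine relTrace_eq_zero fun c => ?_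
    rw [normFam_of_not_le n (hc c c.2), smul_zero]
  · rfl

variable [CompactSpace G]

/-- The contribution of one coordinate is the Verschiebung from `V` of a truncated family of tensor
powers. -/
theorem isGhost_verNorm {V : Subgroup G} (hV : V ∈ S.carrier)
    (n : TP (MvPolynomial A ℤ) (B →₀ MvPolynomial A ℤ) V) :
    IsGhost (freeCoeff G A B) S (verNorm S V n) := by
  classical
  have := S.finiteIndex hV
  have h1 : IsGhost (freeCoeff G A B) (S.restrict V (S.le V hV))
      (fun U => if U ∈ (S.restrict V (S.le V hV)).carrier then normFam V n U else 0) :=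
    (normFam_isGhost (S.isOpen V hV) n).trunc (show (S.restrict V (S.le V hV)).carrier ⊆ (TruncationSet.all V).carrier from
        fun U hU => ⟨S.isOpen U hU.1, hU.2⟩)
      (fun U hU => if_pos hU) (fun U hU => if_neg hU)
  convert h1.ver (S.le V hV) (S.mem_restrict V (S.le V hV)) using 1
  funext U
  rw [verNorm]
  split_ifs with hU
  · refine relTrace_congr fun c => ?_
    split_ifs with h
    · rfl
    · rw [normFam_of_not_le n fun h' => h ⟨S.conj U hU c c.2, h'⟩]
  · refine (relTrace_eq_zero fun c => ?_).symm
    rw [if_neg fun h => hU ((S.rconj_mem_iff c.2).1 h.1), smul_zero]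

theorem finite_verNorm {U : Subgroup G} (hU : U ∈ S.carrier)
    (n : ∀ V : S.reps, TP (MvPolynomial A ℤ) (B →₀ MvPolynomial A ℤ) V.1.1) :
    {V : S.reps | verNorm S V.1.1 (n V) U ≠ 0}.Finite :=
  (finite_reps_rconj_le hU).subset fun _ hV => exists_of_verNorm_ne_zero hV

theorem tot_ghost (n : ∀ V : S.reps, TP (MvPolynomial A ℤ) (B →₀ MvPolynomial A ℤ) V.1.1)
    (U : Subgroup G) : tot (ghost S _ _ n) U = ∑ᶠ V : S.reps, verNorm S V.1.1 (n V) U := by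
  by_cases hU : U ∈ S.carrier
  · have := S.finiteIndex hU
    rw [tot_of_mem _ hU, ghost, AddMonoidHom.map_finsum_of_injective _ (iota_injective U)]
    refine finsum_congr fun V => ?_
    rw [AddMonoidHom.map_finsum_of_injective _ (iota_injective U), verNorm, if_pos hU, relTrace]
    refine finsum_congr fun c => ?_
    split_ifs with h
    · rw [iota_act, normFam, dif_pos ⟨S.isOpen _ (S.conj U hU c.out c.out.2), h⟩]
    · rw [normFam_of_not_le _ h, smul_zero, map_zero]
  · rw [tot_of_notMem _ hU]
    refine (finsum_eq_zero_of_forall_eq_zero fun V => ?_).symm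
    rw [verNorm, if_neg hU]

theorem isGhost_ghost (n : ∀ V : S.reps, TP (MvPolynomial A ℤ) (B →₀ MvPolynomial A ℤ) V.1.1) :
    IsGhost (freeCoeff G A B) S (tot (ghost S _ _ n)) := by
  rw [funext (tot_ghost S n)]
  exact IsGhost.finsum (fun V => isGhost_verNorm S V.1.2 (n V))
    fun U hU => finite_verNorm S hU n

theorem verNorm_self (V : S.reps)
    (n : TP (MvPolynomial A ℤ) (B →₀ MvPolynomial A ℤ) V.1.1) :
    verNorm S V.1.1 n V.1.1 = relTrace V.1.1 (nrm H V.1.1) fun k => (k : G) • iota V.1.1 n := by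
  have := S.finiteIndex V.1.2
  rw [verNorm, if_pos V.1.2, ← relTrace_delta (C := freeCoeff G A B) (S.le _ V.1.2) ⟨n, rfl⟩]
  exact relTrace_congr fun c => by rw [normFam_rconj_self (S.isOpen _ V.1.2)]

/-- Triangularity: the coordinate at `V` affects only subconjugates of `V`, so among subgroups of no
larger index only conjugates of `V`. -/
theorem verNorm_eq_zero {S : TruncationSet H} {V : S.reps} {U : Subgroup G} (hU : U ∈ S.carrier)
    (h : U.index ≤ V.1.1.index) (hVU : ¬ ∃ h ∈ H, V.1.1 = rconj U h)
    (n : TP (MvPolynomial A ℤ) (B →₀ MvPolynomial A ℤ) V.1.1) :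
    verNorm S V.1.1 n U = 0 := by
  have := S.finiteIndex hU
  by_contra h0
  obtain ⟨c, hc, hcV⟩ := exists_of_verNorm_ne_zero h0
  rcases hcV.lt_or_eq with h' | h'
  · have := Subgroup.index_strictAnti h'
    rw [index_rconj] at this
    omega
  · exact hVU ⟨c, hc, h'.symm⟩

/-- The coordinates are found by recursion on the index. Subtracting the contributions of smaller
index leaves a ghost family that vanishes above `V`; its value at `V` is a trace from `V` to
`N_H(V)`, which is exactly what the coordinate at `V` contributes by `verNorm_self`. -/
theorem exists_ghost_eq {α : Subgroup G → GSpace G A B} (hα : IsGhost (freeCoeff G A B) S α) :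
    ∃ n, tot (ghost S (MvPolynomial A ℤ) (B →₀ MvPolynomial A ℤ) n) = α := by
  classical
  let wf : WellFounded fun V W : S.reps => V.1.1.index < W.1.1.index :=
    InvImage.wf (fun V : S.reps => V.1.1.index) Nat.lt_wfRel.wf
  -- The recursion step picks a solution of the equation at `V`; the default `0` is never used, as
  -- `hex` shows.
  let F : ∀ V : S.reps, (∀ W : S.reps, W.1.1.index < V.1.1.index →
      TP (MvPolynomial A ℤ) (B →₀ MvPolynomial A ℤ) W.1.1) →
      TP (MvPolynomial A ℤ) (B →₀ MvPolynomial A ℤ) V.1.1 := fun V r =>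
    if h : ∃ z, relTrace V.1.1 (nrm H V.1.1) (fun k => (k : G) • iota V.1.1 z) =
      α V.1.1 - ∑ᶠ W : {W : S.reps // W.1.1.index < V.1.1.index},
        verNorm S W.1.1.1 (r W.1 W.2) V.1.1 then h.choose else 0
  let n := wf.fix F
  have hn : ∀ V, n V = F V fun W _ => n W := fun V => wf.fix_eq F V
  refine ⟨n, funext fun U => ?_⟩
  have hG := isGhost_ghost S n
  induction hk : U.index using Nat.strong_induction_on generalizing U with
  | _ k ih =>
  subst hk
  by_cases hU : U ∈ S.carrier
  swap
  · rw [hα.eq_zero hU, hG.eq_zero hU]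
  obtain ⟨V, h, hh, e⟩ := exists_reps_rconj hU
  -- Both sides are `H`-equivariant, so the representative of the class of `U` may replace it.
  rw [← hα.equivariant hh U, ← hG.equivariant hh U, ← e]
  congr 1
  have hidx : V.1.1.index = U.index := by rw [e, index_rconj]
  rw [← hidx] at ih
  clear hU
  have hsplit : ∀ W ∈ S.carrier, W.index < V.1.1.index → tot (ghost S _ _ n) W =
      ∑ᶠ W' : {W : S.reps // W.1.1.index < V.1.1.index}, verNorm S W'.1.1.1 (n W'.1) W := by
    intro W hW hWV
    rw [tot_ghost]
    symm
    refine (finsum_subtype_eq (fun W' : S.reps => W'.1.1.index < V.1.1.index)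
      fun W' => verNorm S W'.1.1 (n W') W).trans ?_
    refine finsum_congr fun W' => ?_
    by_cases hlt : W'.1.1.index < V.1.1.index
    · rw [if_pos hlt]
    · rw [if_neg hlt, verNorm_eq_zero hW (by omega)]
      rintro ⟨g, -, e⟩
      rw [e, index_rconj] at hlt
      exact hlt hWV
  set σ : Subgroup G → GSpace G A B := fun U =>
    ∑ᶠ W : {W : S.reps // W.1.1.index < V.1.1.index}, verNorm S W.1.1.1 (n W.1) U with hσ
  have hσG : IsGhost (freeCoeff G A B) S σ :=
    IsGhost.finsum (fun W => isGhost_verNorm S W.1.1.2 (n W.1)) fun U hU =>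
      (finite_verNorm S hU n).preimage Subtype.val_injective.injOn
  -- Above `V` the partial sum `σ` is the whole ghost vector, which equals `α` there by induction.
  have htr := (hα.sub hσG).isTr_of_zero_above V.1.2 fun W hW hVW => by
    have := S.finiteIndex V.1.2
    have hlt := Subgroup.index_strictAnti hVW
    rw [← ih _ hlt W rfl, hsplit W hW hlt, sub_self]
  have hex : ∃ z, relTrace V.1.1 (nrm H V.1.1) (fun k => (k : G) • iota V.1.1 z) =
      α V.1.1 - σ V.1.1 := by
    obtain ⟨_, ⟨z, rfl⟩, e⟩ := htr
    exact ⟨z, e.symm⟩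
  have hnV := hex.choose_spec
  have hnV' : n V = hex.choose := by
    rw [hn V]
    exact dif_pos hex
  rw [← hnV', ← verNorm_self] at hnV
  have hσV : σ V.1.1 = ∑ᶠ W : S.reps, if W.1.1.index < V.1.1.index then
      verNorm S W.1.1 (n W) V.1.1 else 0 :=
    finsum_subtype_eq (fun W' : S.reps => W'.1.1.index < V.1.1.index)
      fun W' => verNorm S W'.1.1 (n W') V.1.1
  rw [sub_eq_iff_eq_add'.1 hnV.symm, tot_ghost, hσV]
  have hV : verNorm S V.1.1 (n V) V.1.1 =
      ∑ᶠ W : S.reps, if W = V then verNorm S W.1.1 (n W) V.1.1 else 0 := by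
    rw [finsum_eq_single (fun W : S.reps => if W = V then verNorm S W.1.1 (n W) V.1.1 else 0) V
      fun W hW => if_neg hW, if_pos rfl]
  rw [hV, ← finsum_add_distrib]
  · refine finsum_congr fun W => ?_
    by_cases hWV : W = V
    · subst hWV
      rw [if_neg (lt_irrefl _), if_pos rfl, zero_add]
    · rw [if_neg hWV, add_zero]
      by_cases hlt : W.1.1.index < V.1.1.index
      · rw [if_pos hlt]
      · rw [if_neg hlt, verNorm_eq_zero V.1.2 (by omega)]
        rintro ⟨g, hg, e⟩
        exact hWV (reps_eq_of_rconj hg e).symm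
  · refine (finite_verNorm S V.1.2 n).subset fun W hW h0 => hW ?_
    beta_reduce
    rw [h0, ite_self]
  · refine (finite_verNorm S V.1.2 n).subset fun W hW h0 => hW ?_
    beta_reduce
    rw [h0, ite_self]

/-- The criterion used for all operators: being a ghost family involves neither coset
representatives nor representatives of conjugacy classes, and is visibly additive. -/
theorem mem_ghostImage_iff
    {a : GhostProd S (MvPolynomial A ℤ) (B →₀ MvPolynomial A ℤ)} :
    a ∈ ghostImage S (MvPolynomial A ℤ) (B →₀ MvPolynomial A ℤ) ↔
      IsGhost (freeCoeff G A B) S (tot a) := by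
  constructor
  · intro h
    induction h using AddSubgroup.closure_induction with
    | mem x hx =>
      obtain ⟨n, rfl⟩ := hx
      exact isGhost_ghost S n
    | zero =>
      rw [tot_zero]
      exact IsGhost.zero S
    | add x y _ _ hx hy =>
      rw [tot_add]
      exact hx.add hy
    | neg x _ hx =>
      rw [tot_neg]
      exact hx.neg
  · intro h
    obtain ⟨n, hn⟩ := exists_ghost_eq S h
    exact AddSubgroup.subset_closure ⟨n, tot_injective hn⟩

/-- Every ghost family is the family of components of an element of the image of the ghost
map. -/
theorem exists_mem_ghostImage {α : Subgroup G → GSpace G A B}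
    (hα : IsGhost (freeCoeff G A B) S α) :
    ∃ a ∈ ghostImage S (MvPolynomial A ℤ) (B →₀ MvPolynomial A ℤ), tot a = α := by
  obtain ⟨n, hn⟩ := exists_ghost_eq S hα
  exact ⟨_, AddSubgroup.subset_closure ⟨n, rfl⟩, hn⟩

end Ghost

end Total

/-! ### Naturality in the coefficients -/

section Naturality

variable {R R' M M' : Type u} [CommRing R] [CommRing R'] [AddCommGroup M] [Module R M]
  [AddCommGroup M'] [Module R' M'] (α : R →+* R') (f : M →ₛₗ[α] M')

section

variable {X Y : Type*}

theorem tensorMap_smul (r : R) (x : ⨂[R] _ : X, M) :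
    tensorMap α f X (r • x) = α r • tensorMap α f X x := by
  let _ : Module R (⨂[R'] _ : X, M') := Module.compHom _ α
  exact LinearMap.map_smul (PiTensorProduct.lift (R := R) _) r x

theorem reindex_const_tprod (e : X ≃ Y) (m : X → M) :
    PiTensorProduct.reindex R (fun _ => M) e (PiTensorProduct.tprod R m) =
      PiTensorProduct.tprod R fun y => m (e.symm y) :=
  PiTensorProduct.reindex_tprod e m

theorem tmulEquiv_tprod (m : X → M) (n : Y → M) :
    PiTensorProduct.tmulEquiv R M (PiTensorProduct.tprod R m ⊗ₜ PiTensorProduct.tprod R n) =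
      PiTensorProduct.tprod R (Sum.elim m n) :=
  PiTensorProduct.tmulEquiv_apply R M m n

theorem tensorMap_reindex (e : X ≃ Y) (x : ⨂[R] _ : X, M) :
    tensorMap α f Y (PiTensorProduct.reindex R (fun _ => M) e x) =
      PiTensorProduct.reindex R' (fun _ => M') e (tensorMap α f X x) := by
  induction x using PiTensorProduct.induction_on with
  | smul_tprod r m =>
    rw [LinearEquiv.map_smul, tensorMap_smul, tensorMap_smul, LinearEquiv.map_smul,
      reindex_const_tprod, tensorMap_tprod, tensorMap_tprod, reindex_const_tprod]
  | add x y hx hy => rw [map_add, map_add, hx, hy, map_add, map_add]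

theorem tensorMap_tmulEquiv (x : ⨂[R] _ : X, M) (y : ⨂[R] _ : Y, M) :
    tensorMap α f (X ⊕ Y) (PiTensorProduct.tmulEquiv R M (x ⊗ₜ y)) =
      PiTensorProduct.tmulEquiv R' M' (tensorMap α f X x ⊗ₜ tensorMap α f Y y) := by
  induction x using PiTensorProduct.induction_on with
  | smul_tprod r m =>
    induction y using PiTensorProduct.induction_on with
    | smul_tprod s n =>
      rw [← TensorProduct.smul_tmul', TensorProduct.tmul_smul, LinearEquiv.map_smul,
        LinearEquiv.map_smul, tmulEquiv_tprod]
      simp only [tensorMap_smul, tensorMap_tprod]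
      rw [← TensorProduct.smul_tmul', TensorProduct.tmul_smul, LinearEquiv.map_smul,
        LinearEquiv.map_smul, tmulEquiv_tprod]
      congr 3
      funext i
      cases i <;> rfl
    | add x y hx hy => simp only [TensorProduct.tmul_add, map_add, hx, hy]
  | add x y hx hy => simp only [TensorProduct.add_tmul, map_add, hx, hy]

theorem tensorMap_nestFin (k : ℕ) (m : Fin k → ⨂[R] _ : X, M) :
    tensorMap α f (X × Fin k) (nestFin R M X k m) =
      nestFin R' M' X k fun i => tensorMap α f X (m i) := by
  induction k with
  | zero =>
    simp only [nestFin, MultilinearMap.constOfIsEmpty_apply]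
    refine (tensorMap_tprod α f _ _).trans ?_
    exact congrArg (PiTensorProduct.tprod R') (funext fun p : X × Fin 0 => p.2.elim0)
  | succ k ih =>
    simp only [nestFin, LinearMap.uncurryLeft_apply, LinearMap.coe_mk, AddHom.coe_mk,
      LinearMap.compMultilinearMap_apply, LinearMap.compr₂_apply,
      TensorProduct.mk_apply, LinearMap.comp_apply, LinearEquiv.coe_coe]
    rw [tensorMap_reindex, tensorMap_tmulEquiv, ih]
    rfl

theorem tensorMap_tpow (x : ⨂[R] _ : X, M) :
    tensorMap α f (X × Y) (tpow x) = tpow (tensorMap α f X x) := by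
  rw [tpow, tpow]
  split_ifs with h
  · rw [tensorMap_reindex, tensorMap_nestFin]
  · exact map_zero _

end

variable {G : Type v} [Group G]

theorem tensorMap_act (g : G) (U : Subgroup G) (x : TP R M (rconj U g)) :
    tensorMap α f (G ⧸ U) (act g U x) = act g U (tensorMap α f (G ⧸ rconj U g) x) :=
  tensorMap_reindex α f (cosetEquiv U g) x

theorem tensorMap_cosetPow {U V : Subgroup G} (h : U ≤ V) (n : TP R M V) :
    tensorMap α f (G ⧸ U) (cosetPow h n) = cosetPow h (tensorMap α f (G ⧸ V) n) := by
  exact (tensorMap_reindex α f _ _).trans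
    (congrArg (PiTensorProduct.reindex R' (fun _ => M') (Subgroup.quotientEquivProdOfLE h).symm)
      (tensorMap_tpow α f _))

variable [TopologicalSpace G] {H K : Subgroup G}

/-- The map induced by `(α; f)` on `M^{⊗ G/U}`. -/
def tpMap (U : Subgroup G) : TP R M U →+ TP R' M' U := tensorMap α f (G ⧸ U)

theorem ghostProdMap_ghostConj {S : TruncationSet H} {S' : TruncationSet K} {g : G}
    (hS : ∀ U, U ∈ S'.carrier ↔ rconj U g ∈ S.carrier) (a : GhostProd S R M) :
    ghostProdMap S' α f (ghostConj g S S' hS a) = ghostConj g S S' hS (ghostProdMap S α f a) :=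
  funext fun _ => tensorMap_act α f _ _ _

theorem ghostProdMap_ghostVer [K.FiniteIndex] {S : TruncationSet H} {S' : TruncationSet K}
    (hS : ∀ U, U ∈ S'.carrier ↔ U ∈ S.carrier ∧ U ≤ K) (a : GhostProd S' R M) :
    ghostProdMap S α f (ghostVer S S' hS a) = ghostVer S S' hS (ghostProdMap S' α f a) := by
  funext U
  refine ((tpMap α f U.1).map_finsum (Set.toFinite _)).trans (finsum_congr fun c => ?_)
  split_ifs with h
  · exact tensorMap_act α f _ _ _
  · exact map_zero _

variable [IsTopologicalGroup G] [CompactSpace G]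

theorem ghostProdMap_ghost (S : TruncationSet H) (n : ∀ V : S.reps, TP R M V.1.1) :
    ghostProdMap S α f (ghost S R M n) =
      ghost S R' M' fun V => tpMap α f V.1.1 (n V) := by
  funext U
  refine ((tpMap α f U.1).map_finsum ?_).trans (finsum_congr fun V => ?_)
  · refine (finite_reps_rconj_le U.2).subset fun V hV => ?_
    by_contra hc
    refine hV (finsum_eq_zero_of_forall_eq_zero fun c => ?_)
    exact dif_neg fun h => hc ⟨c.out, c.out.2, h⟩
  · have := S.finiteIndex V.1.2
    refine ((tpMap α f U.1).map_finsum (Set.toFinite _)).trans (finsum_congr fun c => ?_)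
    split_ifs with h
    · refine (tensorMap_act α f _ _ _).trans ?_
      rw [tensorMap_cosetPow]
      rfl
    · exact map_zero _

theorem ghostProdMap_mem (S : TruncationSet H) {a : GhostProd S R M}
    (ha : a ∈ ghostImage S R M) : ghostProdMap S α f a ∈ ghostImage S R' M' := by
  have : ghostImage S R M ≤ (ghostImage S R' M').comap (ghostProdMap S α f) := by
    refine (AddSubgroup.closure_le _).2 ?_
    rintro _ ⟨n, rfl⟩
    refine AddSubgroup.subset_closure ?_
    rw [ghostProdMap_ghost]
    exact ⟨_, rfl⟩
  exact this ha

end Naturality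

/-! ### Descent of the ghost operators to Witt vectors -/

section Induced

variable {G : Type v} [Group G] [TopologicalSpace G] {H K : Subgroup G}
  {R M : Type u} [CommRing R] [AddCommGroup M] [Module R M]

variable (R M) in
/-- The difference of the two maps of the canonical resolution. -/
abbrev resolutionDiff (S : TruncationSet H) :
    GhostProd S (FreeR (FreeR R)) (FreeM (FreeR R) (FreeM R M)) →+
      GhostProd S (FreeR R) (FreeM R M) :=
  ghostProdMap S (counitR (FreeR R)) (counitM (FreeR R) (FreeM R M)) -
    ghostProdMap S (freeMapR (counitR R)) (freeMapM (counitR R) (counitM R M))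

theorem mem_resolutionRel {S : TruncationSet H} {x : GhostProd S (FreeR R) (FreeM R M)} :
    x ∈ resolutionRel S R M ↔
      ∃ a ∈ ghostImage S (FreeR (FreeR R)) (FreeM (FreeR R) (FreeM R M)),
        resolutionDiff R M S a = x := Iff.rfl

theorem resolutionRel_le [IsTopologicalGroup G] [CompactSpace G] (S : TruncationSet H) :
    resolutionRel S R M ≤ ghostImage S (FreeR R) (FreeM R M) := by
  rintro _ ⟨a, ha, rfl⟩
  exact sub_mem (ghostProdMap_mem _ _ S ha) (ghostProdMap_mem _ _ S ha)

theorem Witt.mk_surjective {S : TruncationSet H} :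
    Function.Surjective (Witt.mk : _ → Witt S R M) := QuotientAddGroup.mk_surjective

theorem Witt.mk_sub {S : TruncationSet H} (a b : ghostImage S (FreeR R) (FreeM R M)) :
    Witt.mk (a - b) = Witt.mk a - Witt.mk b := rfl

theorem Witt.mk_eq_zero {S : TruncationSet H} {a : ghostImage S (FreeR R) (FreeM R M)} :
    Witt.mk a = 0 ↔ a.1 ∈ resolutionRel S R M :=
  QuotientAddGroup.eq_zero_iff _

/-- `θ₁` is the same operator one stage further up the resolution. Commuting with both maps of the
resolution, it carries witnesses of relations to witnesses of relations. -/
theorem exists_isInduced {S : TruncationSet H} {S' : TruncationSet K}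
    {θ : GhostProd S (FreeR R) (FreeM R M) → GhostProd S' (FreeR R) (FreeM R M)}
    {θ₁ : GhostProd S (FreeR (FreeR R)) (FreeM (FreeR R) (FreeM R M)) →
      GhostProd S' (FreeR (FreeR R)) (FreeM (FreeR R) (FreeM R M))}
    (hadd : ∀ a b, θ (a + b) = θ a + θ b)
    (hθ : ∀ a ∈ ghostImage S (FreeR R) (FreeM R M),
      θ a ∈ ghostImage S' (FreeR R) (FreeM R M))
    (hθ₁ : ∀ a ∈ ghostImage S (FreeR (FreeR R)) (FreeM (FreeR R) (FreeM R M)),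
      θ₁ a ∈ ghostImage S' (FreeR (FreeR R)) (FreeM (FreeR R) (FreeM R M)))
    (h₁ : ∀ a, ghostProdMap S' (counitR (FreeR R)) (counitM (FreeR R) (FreeM R M)) (θ₁ a) =
      θ (ghostProdMap S (counitR (FreeR R)) (counitM (FreeR R) (FreeM R M)) a))
    (h₂ : ∀ a, ghostProdMap S' (freeMapR (counitR R)) (freeMapM (counitR R) (counitM R M))
      (θ₁ a) = θ (ghostProdMap S (freeMapR (counitR R)) (freeMapM (counitR R) (counitM R M)) a)) :
    IsInduced θ (wittOp θ) := by
  let Θ : GhostProd S (FreeR R) (FreeM R M) →+ GhostProd S' (FreeR R) (FreeM R M) :=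
    AddMonoidHom.mk' θ hadd
  let Θ' : ghostImage S (FreeR R) (FreeM R M) →+ ghostImage S' (FreeR R) (FreeM R M) :=
    (Θ.comp (AddSubgroup.subtype _)).codRestrict _ fun a => hθ a.1 a.2
  have hker : (resolutionRel S R M).addSubgroupOf (ghostImage S (FreeR R) (FreeM R M)) ≤
      ((resolutionRel S' R M).addSubgroupOf (ghostImage S' (FreeR R) (FreeM R M))).comap Θ' := by
    rintro ⟨_, ha'⟩ ⟨a, ha, rfl⟩
    refine ⟨θ₁ a, hθ₁ a ha, ?_⟩
    rw [AddMonoidHom.sub_apply, h₁, h₂]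
    exact (map_sub Θ _ _).symm
  have h : ∃ Φ : Witt S R M →+ Witt S' R M, IsInduced θ Φ :=
    ⟨QuotientAddGroup.map _ _ Θ' hker, fun a => ⟨hθ a.1 a.2, rfl⟩⟩
  rw [wittOp, dif_pos h]
  exact h.choose_spec

variable [IsTopologicalGroup G] [CompactSpace G]

section FreeOperators

variable {A B : Type u} {S : TruncationSet H}

theorem ghostVer_add {S' : TruncationSet K} [K.FiniteIndex]
    (hS : ∀ U, U ∈ S'.carrier ↔ U ∈ S.carrier ∧ U ≤ K)
    (a b : GhostProd S' (MvPolynomial A ℤ) (B →₀ MvPolynomial A ℤ)) :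
    ghostVer S S' hS (a + b) = ghostVer S S' hS a + ghostVer S S' hS b := by
  refine tot_injective ?_
  simp only [tot_ghostVer, tot_add, smul_add, relTrace_add]

theorem ghostVer_mem {S' : TruncationSet K} [K.FiniteIndex] (hKH : K ≤ H)
    (hS : ∀ U, U ∈ S'.carrier ↔ U ∈ S.carrier ∧ U ≤ K)
    {a : GhostProd S' (MvPolynomial A ℤ) (B →₀ MvPolynomial A ℤ)}
    (ha : a ∈ ghostImage S' _ _) : ghostVer S S' hS a ∈ ghostImage S _ _ := by
  rw [mem_ghostImage_iff, tot_ghostVer]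
  exact ((mem_ghostImage_iff S').1 ha).ver hKH hS

theorem ghostFrob_mem {S' : TruncationSet K} (hKH : K ≤ H)
    (hS : ∀ U, U ∈ S'.carrier ↔ U ∈ S.carrier ∧ U ≤ K)
    {a : GhostProd S (MvPolynomial A ℤ) (B →₀ MvPolynomial A ℤ)}
    (ha : a ∈ ghostImage S _ _) : ghostFrob S S' hS a ∈ ghostImage S' _ _ := by
  rw [mem_ghostImage_iff] at ha ⊢
  exact ha.frob hKH hS (fun U hU => tot_ghostFrob a hS hU) fun U hU => tot_of_notMem _ hU

theorem ghostTrunc_mem {S' : TruncationSet H} (hS : S'.carrier ⊆ S.carrier)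
    {a : GhostProd S (MvPolynomial A ℤ) (B →₀ MvPolynomial A ℤ)}
    (ha : a ∈ ghostImage S _ _) : ghostTrunc S S' hS a ∈ ghostImage S' _ _ := by
  rw [mem_ghostImage_iff] at ha ⊢
  exact ha.trunc hS (fun U hU => tot_ghostTrunc a hS hU) fun U hU => tot_of_notMem _ hU

theorem ghostConj_mem {S' : TruncationSet K} {g : G} (hK : rconj K g = H)
    (hS : ∀ U, U ∈ S'.carrier ↔ rconj U g ∈ S.carrier)
    {a : GhostProd S (MvPolynomial A ℤ) (B →₀ MvPolynomial A ℤ)}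
    (ha : a ∈ ghostImage S _ _) : ghostConj g S S' hS a ∈ ghostImage S' _ _ := by
  rw [mem_ghostImage_iff] at ha ⊢
  rw [tot_ghostConj]
  exact ha.conj hK hS

end FreeOperators

theorem isInduced_ver {S : TruncationSet H} {S' : TruncationSet K} [K.FiniteIndex] (hKH : K ≤ H)
    (hS : ∀ U, U ∈ S'.carrier ↔ U ∈ S.carrier ∧ U ≤ K) :
    IsInduced (ghostVer S S' hS) (ver R M S S' hS) :=
  exists_isInduced (ghostVer_add hS) (fun _ => ghostVer_mem hKH hS)
    (fun _ => ghostVer_mem hKH hS) (ghostProdMap_ghostVer _ _ hS) (ghostProdMap_ghostVer _ _ hS)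

theorem isInduced_frob {S : TruncationSet H} {S' : TruncationSet K} (hKH : K ≤ H)
    (hS : ∀ U, U ∈ S'.carrier ↔ U ∈ S.carrier ∧ U ≤ K) :
    IsInduced (ghostFrob S S' hS) (frob R M S S' hS) :=
  exists_isInduced (fun _ _ => rfl) (fun _ => ghostFrob_mem hKH hS)
    (fun _ => ghostFrob_mem hKH hS) (fun _ => rfl) (fun _ => rfl)

theorem isInduced_trunc {S S' : TruncationSet H} (hS : S'.carrier ⊆ S.carrier) :
    IsInduced (ghostTrunc S S' hS) (trunc R M S S' hS) :=
  exists_isInduced (fun _ _ => rfl) (fun _ => ghostTrunc_mem hS)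
    (fun _ => ghostTrunc_mem hS) (fun _ => rfl) (fun _ => rfl)

theorem isInduced_conjOp {S : TruncationSet H} {S' : TruncationSet K} {g : G} (hK : rconj K g = H)
    (hS : ∀ U, U ∈ S'.carrier ↔ rconj U g ∈ S.carrier) :
    IsInduced (ghostConj g S S' hS) (conjOp R M g S S' hS) :=
  exists_isInduced (fun _ _ => funext fun _ => map_add _ _ _) (fun _ => ghostConj_mem hK hS)
    (fun _ => ghostConj_mem hK hS) (ghostProdMap_ghostConj _ _ hS)
    (ghostProdMap_ghostConj _ _ hS)

end Induced

/-! ### Exactness on maximal Hausdorff quotients -/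

section TopologicalGroups

open SeparationQuotient in
theorem exists_separationQuotient_map {A B : Type*} [AddCommGroup A] [TopologicalSpace A]
    [IsTopologicalAddGroup A] [AddCommGroup B] [TopologicalSpace B] [IsTopologicalAddGroup B]
    (φ : A →+ B) (hφ : Continuous φ) :
    ∃ φ' : SeparationQuotient A →+ SeparationQuotient B,
      (∀ x, φ' (mk x) = mk (φ x)) ∧ Continuous φ' := by
  let g : SeparationQuotient A → SeparationQuotient B :=
    SeparationQuotient.lift (fun x => mk (φ x)) fun x y h => mk_eq_mk.2 (h.map hφ)
  have hg : ∀ x, g (mk x) = mk (φ x) := fun x => rfl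
  refine ⟨AddMonoidHom.mk' g fun x y => ?_, hg, ?_⟩
  · obtain ⟨x, rfl⟩ := surjective_mk x
    obtain ⟨y, rfl⟩ := surjective_mk y
    rw [← mk_add, hg, hg, hg, map_add, mk_add]
  · exact isQuotientMap_mk.continuous_iff.2 (continuous_mk.comp hφ)

open SeparationQuotient in
-- The kernel of the composite to the Hausdorff quotient of `C` is `ψ⁻¹` of the closure of `0`.
-- Since `ψ` is open, this is the closure of `ker ψ = im φ`, and it is `im φ` itself if `C` is
-- Hausdorff.
theorem separationQuotient_exact {A B C : Type*} [AddCommGroup A] [TopologicalSpace A]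
    [IsTopologicalAddGroup A] [AddCommGroup B] [TopologicalSpace B] [IsTopologicalAddGroup B]
    [AddCommGroup C] [TopologicalSpace C] [IsTopologicalAddGroup C] (φ : A →+ B) (ψ : B →+ C)
    (hφ : Continuous φ) (hψ : Continuous ψ) (ho : IsOpenMap ψ) (hs : Function.Surjective ψ)
    (hex : φ.range = ψ.ker) :
    ∃ (φ' : SeparationQuotient A →+ SeparationQuotient B)
      (ψ' : SeparationQuotient B →+ SeparationQuotient C),
      (∀ x, φ' (mk x) = mk (φ x)) ∧ (∀ x, ψ' (mk x) = mk (ψ x)) ∧ Continuous φ' ∧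
      Topology.IsQuotientMap ψ' ∧ closure (Set.range φ') = (ψ'.ker : Set (SeparationQuotient B)) ∧
      (T2Space C → φ'.range = ψ'.ker) := by
  obtain ⟨φ', hφ', cφ⟩ := exists_separationQuotient_map φ hφ
  obtain ⟨ψ', hψ', cψ⟩ := exists_separationQuotient_map ψ hψ
  have hrange : Set.range φ' = mk '' (φ.range : Set B) := by
    ext y
    constructor
    · rintro ⟨x, rfl⟩
      obtain ⟨x, rfl⟩ := surjective_mk x
      exact ⟨φ x, ⟨x, rfl⟩, (hφ' x).symm⟩
    · rintro ⟨_, ⟨x, rfl⟩, rfl⟩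
      exact ⟨mk x, hφ' x⟩
  refine ⟨φ', ψ', hφ', hψ', cφ, ?_, ?_, fun hT => ?_⟩
  · refine Topology.IsQuotientMap.of_comp (f := mk) continuous_mk cψ ?_
    rw [show ψ' ∘ mk = mk ∘ ψ from funext hψ']
    exact isQuotientMap_mk.comp (ho.isQuotientMap hψ hs)
  · ext y
    obtain ⟨x, rfl⟩ := surjective_mk y
    have h1 : mk x ∈ closure (Set.range φ') ↔ x ∈ closure (φ.range : Set B) := by
      rw [hrange, isInducing_mk.closure_eq_preimage_closure_image (φ.range : Set B)]
      rfl
    rw [h1, SetLike.mem_coe, AddMonoidHom.mem_ker, hψ', hex]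
    -- Specialisation is symmetric in a topological group, so lying in the closure of `0` means
    -- being inseparable from `0`.
    have h2 : (ψ.ker : Set B) = ψ ⁻¹' {0} := by ext; simp
    rw [h2, ← ho.preimage_closure_eq_closure_preimage hψ, ← mk_zero, mk_eq_mk, Set.mem_preimage,
      ← specializes_iff_mem_closure]
    exact ⟨fun h => h.symm.inseparable, fun h => h.symm.specializes⟩
  · ext y
    rw [AddMonoidHom.mem_ker, ← SetLike.mem_coe, AddMonoidHom.coe_range, hrange]
    obtain ⟨x, rfl⟩ := surjective_mk y
    rw [hψ']
    constructor
    · rintro ⟨z, hz, e⟩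
      rw [hex] at hz
      rw [← hψ', ← e, hψ', hz, mk_zero]
    · intro h
      refine ⟨x, ?_, rfl⟩
      rw [hex]
      exact (mk_eq_mk.1 h).eq

end TopologicalGroups

/-! ### The right exact sequence -/

section RightExact

variable {G : Type v} [Group G] [TopologicalSpace G] {H K : Subgroup G}
  {R M : Type u} [CommRing R] [AddCommGroup M] [Module R M]

theorem Witt.isOpenQuotientMap_mk {S : TruncationSet H} :
    IsOpenQuotientMap (Witt.mk : ghostImage S (FreeR R) (FreeM R M) → Witt S R M) :=
  QuotientAddGroup.isOpenQuotientMap_mk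

theorem IsInduced.continuous {S : TruncationSet H} {S' : TruncationSet K}
    {θ : GhostProd S (FreeR R) (FreeM R M) → GhostProd S' (FreeR R) (FreeM R M)}
    {Φ : Witt S R M →+ Witt S' R M} (h : IsInduced θ Φ) (hθ : Continuous θ) : Continuous Φ := by
  refine Witt.isOpenQuotientMap_mk.isQuotientMap.continuous_iff.2 ?_
  choose h1 h2 using h
  rw [show Φ ∘ Witt.mk = Witt.mk ∘ fun a => ⟨θ a.1, h1 a⟩ from funext h2]
  exact Witt.isOpenQuotientMap_mk.continuous.comp
    ((hθ.comp continuous_subtype_val).subtype_mk _)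

/-- For finite `S` the ghost product is a finite product of discrete groups, so it and its
subquotients are discrete. -/
theorem discreteTopology_witt {S : TruncationSet H} (hS : S.carrier.Finite) :
    DiscreteTopology (Witt S R M) := by
  have : Finite S.carrier := hS
  refine discreteTopology_iff_forall_isOpen.2 fun s => ?_
  rw [← Witt.isOpenQuotientMap_mk.isQuotientMap.isOpen_preimage]
  exact isOpen_discrete _

theorem continuous_ghostTrunc {S S' : TruncationSet H} (hS : S'.carrier ⊆ S.carrier) :
    Continuous (ghostTrunc (R := R) (M := M) S S' hS) :=
  continuous_pi fun _ => continuous_apply _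

theorem continuous_ghostVer {S : TruncationSet H} {S' : TruncationSet K} [K.FiniteIndex]
    (hS : ∀ U, U ∈ S'.carrier ↔ U ∈ S.carrier ∧ U ≤ K) :
    Continuous (ghostVer (R := R) (M := M) S S' hS) := by
  refine continuous_pi fun U => continuous_finsum (fun c => ?_) (locallyFinite_of_finite _)
  split_ifs with h
  · exact (continuous_of_discreteTopology (f := act (R := R) (M := M) (c.out : G) U.1)).comp
      (continuous_apply _)
  · exact continuous_const

theorem ghostTrunc_ghostVer {S : TruncationSet H} (hK : K ≤ H)
    (a : GhostProd (S.restrict K hK) R M) :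
    ghostTrunc S (S.diff K) (S.diff_subset K)
      (ghostVer S (S.restrict K hK) (S.mem_restrict K hK) a) = 0 := by
  funext U
  refine finsum_eq_zero_of_forall_eq_zero fun c => dif_neg fun h => ?_
  exact U.2.2 ⟨c.out, c.out.2, h⟩

variable [IsTopologicalGroup G] [CompactSpace G]

section

variable {A B : Type u}

/-- The last clause, control over the zeros of the lift, is what makes truncation open. -/
theorem exists_ghostTrunc_eq {S S' : TruncationSet H} (hS : S'.carrier ⊆ S.carrier)
    {b : GhostProd S' (MvPolynomial A ℤ) (B →₀ MvPolynomial A ℤ)} (hb : b ∈ ghostImage S' _ _) :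
    ∃ a ∈ ghostImage S (MvPolynomial A ℤ) (B →₀ MvPolynomial A ℤ), ghostTrunc S S' hS a = b ∧
      ∀ U : S.carrier, (∀ V : S'.carrier, U.1 ≤ V.1 → b V = 0) → a U = 0 := by
  obtain ⟨α, hα, h1, h2⟩ := ((mem_ghostImage_iff S').1 hb).extend hS
  obtain ⟨a, ha, rfl⟩ := exists_mem_ghostImage S hα
  refine ⟨a, ha, tot_injective (funext fun U => ?_), fun U hU => ?_⟩
  · by_cases hU : U ∈ S'.carrier
    · rw [tot_ghostTrunc a hS hU, h1 U hU]
    · rw [tot_of_notMem _ hU, tot_of_notMem _ hU]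
  · have := S.finiteIndex U.2
    have h := h2 U.1 U.2 fun V hV hUV => by rw [tot_of_mem _ hV, hU ⟨V, hV⟩ hUV, map_zero]
    rw [tot_of_mem _ U.2] at h
    exact iota_injective U.1 (h.trans (map_zero _).symm)

theorem exists_ghostVer_eq {S : TruncationSet H} [K.FiniteIndex] (hK : K ≤ H)
    {a : GhostProd S (MvPolynomial A ℤ) (B →₀ MvPolynomial A ℤ)} (ha : a ∈ ghostImage S _ _)
    (h : ghostTrunc S (S.diff K) (S.diff_subset K) a = 0) :
    ∃ b ∈ ghostImage (S.restrict K hK) (MvPolynomial A ℤ) (B →₀ MvPolynomial A ℤ),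
      ghostVer S (S.restrict K hK) (S.mem_restrict K hK) b = a := by
  obtain ⟨β, hβ, h1⟩ := ((mem_ghostImage_iff S).1 ha).exists_ver S hK fun V hV => by
    rw [← tot_ghostTrunc a (S.diff_subset K) hV, h, tot_zero]
  obtain ⟨b, hb, rfl⟩ := exists_mem_ghostImage _ hβ
  refine ⟨b, hb, tot_injective ?_⟩
  rw [tot_ghostVer]
  exact funext h1

/-- As `n` normalises `K`, replacing `c` by `c * n` permutes the cosets `H/K`. -/
theorem ghostVer_ghostConj {S : TruncationSet H} (hK : K ≤ H) {n : G} (hn : n ∈ H)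
    (hnK : rconj K n = K)
    {a : GhostProd (S.restrict K hK) (MvPolynomial A ℤ) (B →₀ MvPolynomial A ℤ)}
    (ha : a ∈ ghostImage _ _ _) :
    ghostVer S (S.restrict K hK) (S.mem_restrict K hK)
      (ghostConj n _ _ (restrict_conj S hK hn hnK) a) =
      ghostVer S (S.restrict K hK) (S.mem_restrict K hK) a := by
  refine tot_injective (funext fun U => ?_)
  have hf : RightInv K fun c : H => (c : G) • tot a (rconj U c) :=
    equivariant_rightInv (fun k hk U => ((mem_ghostImage_iff _).1 ha).equivariant hk U) U
  have hf' : RightInv (rconj K ((⟨n, hn⟩ : H) : G)) fun c : H => (c : G) • tot a (rconj U c) := by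
    rwa [hnK]
  rw [tot_ghostVer, tot_ghostVer, tot_ghostConj]
  have := relTrace_mul_right ⟨n, hn⟩ hf'
  rw [hnK] at this
  beta_reduce
  rw [← this]
  refine relTrace_congr fun c => ?_
  rw [rconj_rconj, smul_smul]
  rfl

end

theorem trunc_surjective {S S' : TruncationSet H} (hS : S'.carrier ⊆ S.carrier) :
    Function.Surjective (trunc R M S S' hS) := by
  intro x
  obtain ⟨⟨b, hb⟩, rfl⟩ := Witt.mk_surjective x
  obtain ⟨a, ha, rfl, -⟩ := exists_ghostTrunc_eq hS hb
  exact ⟨Witt.mk ⟨a, ha⟩, (isInduced_trunc hS ⟨a, ha⟩).2⟩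

/-- A basic neighbourhood of `0` constrains finitely many components `U`. If the components of `b`
above these `U` vanish, `b` has a lift whose components at these `U` are zero. -/
theorem isOpenMap_trunc {S S' : TruncationSet H} (hS : S'.carrier ⊆ S.carrier) :
    IsOpenMap (trunc R M S S' hS) := by
  let θ : ghostImage S (FreeR R) (FreeM R M) →+ ghostImage S' (FreeR R) (FreeM R M) :=
    AddMonoidHom.mk' (fun a => ⟨ghostTrunc S S' hS a.1, ghostTrunc_mem hS a.2⟩) fun _ _ => rfl
  have hθ : IsOpenMap θ := by
    refine IsTopologicalAddGroup.isOpenMap_iff_nhds_zero.2 fun s hs => ?_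
    obtain ⟨t, ht, hts⟩ := (mem_nhds_subtype _ _ _).1 (Filter.mem_map.1 hs)
    rw [nhds_pi] at ht
    obtain ⟨I, hI, u, hu, hut⟩ := Filter.mem_pi.1 ht
    -- Each of the finitely many constrained `U` has finitely many overgroups, so the prescribed
    -- zeros define an open set.
    have hF : {V : S'.carrier | ∃ U ∈ I, U.1 ≤ V.1}.Finite := by
      refine Set.Finite.of_finite_image (f := Subtype.val) ?_ Subtype.val_injective.injOn
      refine (hI.biUnion fun U _ => ?_ :
        (⋃ U ∈ I, Set.range (Subtype.val : {W // U.1 ≤ W} → Subgroup G)).Finite).subset ?_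
      · have := S.finiteIndex U.2
        have := finite_overgroups U.1
        exact Set.finite_range _
      · rintro _ ⟨V, ⟨U, hU, hUV⟩, rfl⟩
        exact Set.mem_biUnion hU ⟨⟨V.1, hUV⟩, rfl⟩
    have hN : (⋂ V ∈ {V : S'.carrier | ∃ U ∈ I, U.1 ≤ V.1},
        {b : ghostImage S' (FreeR R) (FreeM R M) | b.1 V = 0}) ∈ nhds 0 := by
      refine (Filter.biInter_mem hF).2 fun V _ => ?_
      refine IsOpen.mem_nhds ?_ rfl
      have hc : Continuous fun b : ghostImage S' (FreeR R) (FreeM R M) => b.1 V :=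
        (continuous_apply V).comp continuous_subtype_val
      exact (isOpen_discrete {0}).preimage hc
    refine Filter.mem_of_superset hN fun b hb => ?_
    rw [Set.mem_iInter₂] at hb
    obtain ⟨a, ha, e, h0⟩ := exists_ghostTrunc_eq hS b.2
    have hab : θ ⟨a, ha⟩ = b := Subtype.ext e
    rw [← hab]
    refine hts (hut fun U hU => ?_)
    have : a U = 0 := h0 U fun V hUV => hb V ⟨U, hU, hUV⟩
    change a U ∈ u U
    rw [this]
    exact mem_of_mem_nhds (hu U)
  have hc : IsOpenMap (trunc R M S S' hS ∘ Witt.mk) := by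
    rw [show trunc R M S S' hS ∘ Witt.mk = Witt.mk ∘ θ from
      funext fun a => (isInduced_trunc hS a).2]
    exact Witt.isOpenQuotientMap_mk.isOpenMap.comp hθ
  intro O hO
  rw [← Set.image_preimage_eq O Witt.mk_surjective, ← Set.image_comp]
  exact hc _ (hO.preimage Witt.isOpenQuotientMap_mk.continuous)

theorem ver_conjOp [K.FiniteIndex] {S : TruncationSet H} (hK : K ≤ H) {n : G} (hn : n ∈ H)
    (hnK : rconj K n = K) (x : Witt (S.restrict K hK) R M) :
    ver R M S (S.restrict K hK) (S.mem_restrict K hK)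
      (conjOp R M n _ _ (restrict_conj S hK hn hnK) x) =
      ver R M S (S.restrict K hK) (S.mem_restrict K hK) x := by
  obtain ⟨a, rfl⟩ := Witt.mk_surjective x
  obtain ⟨h1, e1⟩ := isInduced_conjOp hnK (restrict_conj S hK hn hnK) a
  rw [e1, (isInduced_ver hK (S.mem_restrict K hK) ⟨_, h1⟩).2,
    (isInduced_ver hK (S.mem_restrict K hK) a).2]
  congr 2
  exact ghostVer_ghostConj hK hn hnK a.2

/-- In the hard direction, the truncation of a representative is only a relation, not zero. Its
witness lifts along truncation over the second stage of the resolution; subtracting the resulting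
relation makes the truncation vanish identically, and the statement for ghost families applies. -/
theorem range_ver [K.FiniteIndex] (S : TruncationSet H) (hK : K ≤ H) :
    (ver R M S (S.restrict K hK) (S.mem_restrict K hK)).range =
      (trunc R M S (S.diff K) (S.diff_subset K)).ker := by
  ext x
  constructor
  · rintro ⟨y, rfl⟩
    obtain ⟨a, rfl⟩ := Witt.mk_surjective y
    obtain ⟨h1, e1⟩ := isInduced_ver hK (S.mem_restrict K hK) a
    rw [AddMonoidHom.mem_ker, e1, (isInduced_trunc (S.diff_subset K) ⟨_, h1⟩).2, Witt.mk_eq_zero]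
    change ghostTrunc S (S.diff K) (S.diff_subset K)
      (ghostVer S (S.restrict K hK) (S.mem_restrict K hK) a.1) ∈ _
    rw [ghostTrunc_ghostVer]
    exact zero_mem _
  · intro hx
    obtain ⟨⟨a, ha⟩, rfl⟩ := Witt.mk_surjective x
    rw [AddMonoidHom.mem_ker, (isInduced_trunc (S.diff_subset K) ⟨a, ha⟩).2, Witt.mk_eq_zero] at hx
    obtain ⟨b, hb, e⟩ := mem_resolutionRel.1 hx
    obtain ⟨b', hb', rfl, -⟩ := exists_ghostTrunc_eq (S.diff_subset K) hb
    have hr : resolutionDiff R M S b' ∈ resolutionRel S R M := mem_resolutionRel.2 ⟨b', hb', rfl⟩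
    obtain ⟨c, hc, e'⟩ := exists_ghostVer_eq hK (sub_mem ha (resolutionRel_le S hr))
      (show ghostTrunc S (S.diff K) (S.diff_subset K) (a - resolutionDiff R M S b') = 0 from
        sub_eq_zero.2 e.symm)
    refine ⟨Witt.mk ⟨c, hc⟩, ?_⟩
    rw [(isInduced_ver hK (S.mem_restrict K hK) ⟨c, hc⟩).2, ← sub_eq_zero, ← Witt.mk_sub,
      Witt.mk_eq_zero]
    change ghostVer S (S.restrict K hK) (S.mem_restrict K hK) c - a ∈ _
    rw [e', sub_sub_cancel_left]
    exact neg_mem hr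

variable (R M)

theorem right_exact (S : TruncationSet H) (hKo : IsOpen (K : Set G)) (hK : K ≤ H) :
    ∃ V : WeylOrbits R M S hK →+ Witt S R M,
        (∀ x : Witt (S.restrict K hK) R M,
          V (QuotientAddGroup.mk x) = ver R M S (S.restrict K hK) (S.mem_restrict K hK) x) ∧
        Continuous V ∧
        V.range = (trunc R M S (S.diff K) (S.diff_subset K)).ker ∧
        Topology.IsQuotientMap (trunc R M S (S.diff K) (S.diff_subset K)) ∧
        ∃ (V' : SeparationQuotient (WeylOrbits R M S hK) →+ SeparationQuotient (Witt S R M))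
          (R' : SeparationQuotient (Witt S R M) →+ SeparationQuotient (Witt (S.diff K) R M)),
          (∀ x, V' (SeparationQuotient.mk x) = SeparationQuotient.mk (V x)) ∧
          (∀ x, R' (SeparationQuotient.mk x) =
            SeparationQuotient.mk (trunc R M S (S.diff K) (S.diff_subset K) x)) ∧
          Continuous V' ∧ Topology.IsQuotientMap R' ∧
          closure (Set.range V') = (R'.ker : Set (SeparationQuotient (Witt S R M))) ∧
          (T2Space (Witt (S.diff K) R M) → V'.range = R'.ker) := by
  have := finiteIndex_of_isOpen hKo
  let V : WeylOrbits R M S hK →+ Witt S R M :=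
    QuotientAddGroup.lift _ (ver R M S (S.restrict K hK) (S.mem_restrict K hK)) <| by
      refine (AddSubgroup.closure_le _).2 ?_
      rintro _ ⟨n, hn, hnK, x, rfl⟩
      rw [SetLike.mem_coe, AddMonoidHom.mem_ker, map_sub, ver_conjOp hK hn hnK, sub_self]
  have hcV : Continuous V :=
    QuotientAddGroup.isQuotientMap_mk _ |>.continuous_iff.2
      ((isInduced_ver hK (S.mem_restrict K hK)).continuous (continuous_ghostVer _))
  have hcR : Continuous (trunc R M S (S.diff K) (S.diff_subset K)) :=
    (isInduced_trunc (S.diff_subset K)).continuous (continuous_ghostTrunc _)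
  have hV : V.range = (trunc R M S (S.diff K) (S.diff_subset K)).ker := by
    rw [← range_ver S hK]
    ext y
    constructor
    · rintro ⟨x, rfl⟩
      obtain ⟨x, rfl⟩ := QuotientAddGroup.mk_surjective x
      exact ⟨x, rfl⟩
    · rintro ⟨x, rfl⟩
      exact ⟨QuotientAddGroup.mk x, rfl⟩
  exact ⟨V, fun x => rfl, hcV, hV, (isOpenMap_trunc _).isQuotientMap hcR (trunc_surjective _),
    separationQuotient_exact V _ hcV hcR (isOpenMap_trunc _) (trunc_surjective _) hV⟩

end RightExact

/-! ### The Mackey axioms for Witt vectors -/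

section MackeyAxioms

theorem rconj_eq_of_eq {G : Type v} [Group G] {K L : Subgroup G} {h : G} (e : L = rconj K h⁻¹) : rconj L h = K := by
  rw [e, rconj_cancel_inv]

theorem le_rconj_inv_iff {G : Type v} [Group G] {U K : Subgroup G} {h : G} : U ≤ rconj K h⁻¹ ↔ rconj U h ≤ K := by
  rw [← rconj_le_rconj (g := h), rconj_cancel_inv]

variable {G : Type v} [Group G] [TopologicalSpace G] {H K : Subgroup G}
  {R M : Type u} [CommRing R] [AddCommGroup M] [Module R M]

/-- The Witt vector `x` is represented by an element of `im(w)` with ghost components `α`. -/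
def Witt.IsRep {S : TruncationSet H} (x : Witt S R M) (α : Subgroup G → GSpace G R M) : Prop :=
  ∃ a, Witt.mk a = x ∧ tot a.1 = α

namespace Witt

theorem exists_isRep {S : TruncationSet H} (x : Witt S R M) : ∃ α, x.IsRep α := by
  obtain ⟨a, rfl⟩ := Witt.mk_surjective x
  exact ⟨_, a, rfl, rfl⟩

namespace IsRep

variable {S : TruncationSet H} {x y : Witt S R M} {α β : Subgroup G → GSpace G R M}

theorem eq_zero (h : x.IsRep α) {U : Subgroup G} (hU : U ∉ S.carrier) : α U = 0 := by
  obtain ⟨a, -, rfl⟩ := h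
  exact tot_of_notMem _ hU

theorem add (h : x.IsRep α) (h' : y.IsRep β) : (x + y).IsRep fun U => α U + β U := by
  obtain ⟨a, rfl, rfl⟩ := h
  obtain ⟨b, rfl, rfl⟩ := h'
  exact ⟨a + b, rfl, tot_add _ _⟩

theorem zero : (0 : Witt S R M).IsRep fun _ => 0 := ⟨0, rfl, tot_zero⟩

theorem finsum {E : Type*} [Finite E] {x : E → Witt S R M}
    {α : E → Subgroup G → GSpace G R M} (h : ∀ e, (x e).IsRep (α e)) :
    (∑ᶠ e, x e).IsRep fun U => ∑ᶠ e, α e U := by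
  have := Fintype.ofFinite E
  simp only [finsum_eq_sum_of_fintype]
  induction (Finset.univ : Finset E) using Finset.cons_induction with
  | empty => simpa only [Finset.sum_empty] using zero
  | cons e s he ih =>
    simp only [Finset.sum_cons]
    exact (h e).add ih

variable [IsTopologicalGroup G] [CompactSpace G]

theorem eq (h : x.IsRep α) (h' : y.IsRep β) (hαβ : ∀ U, α U = β U) : x = y := by
  obtain ⟨a, rfl, rfl⟩ := h
  obtain ⟨b, rfl, rfl⟩ := h'
  rw [Subtype.ext (tot_injective (funext hαβ))]

theorem isGhost (h : x.IsRep α) : IsGhost (freeCoeff G R M) S α := by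
  obtain ⟨a, -, rfl⟩ := h
  exact (mem_ghostImage_iff S).1 a.2

theorem ver [K.FiniteIndex] {S' : TruncationSet K} (hKH : K ≤ H)
    (hS : ∀ U, U ∈ S'.carrier ↔ U ∈ S.carrier ∧ U ≤ K) {x : Witt S' R M} (h : x.IsRep α) :
    (ver R M S S' hS x).IsRep fun U => relTrace K H fun c => (c : G) • α (rconj U c) := by
  obtain ⟨a, rfl, rfl⟩ := h
  obtain ⟨hb, e⟩ := isInduced_ver hKH hS a
  exact ⟨_, e.symm, tot_ghostVer hS a.1⟩

open Classical in
theorem frob {S' : TruncationSet K} (hKH : K ≤ H)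
    (hS : ∀ U, U ∈ S'.carrier ↔ U ∈ S.carrier ∧ U ≤ K) (h : x.IsRep α) :
    (frob R M S S' hS x).IsRep fun U => if U ≤ K then α U else 0 := by
  obtain ⟨a, rfl, rfl⟩ := h
  obtain ⟨hb, e⟩ := isInduced_frob hKH hS a
  refine ⟨_, e.symm, funext fun U => ?_⟩
  by_cases hU : U ∈ S'.carrier
  · rw [if_pos ((hS U).1 hU).2]
    exact tot_ghostFrob a.1 hS hU
  · rw [tot_of_notMem _ hU]
    split_ifs with hUK
    · rw [tot_of_notMem _ fun h' => hU ((hS U).2 ⟨h', hUK⟩)]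
    · rfl

theorem conjOp {S' : TruncationSet K} {g : G} (hK : rconj K g = H)
    (hS : ∀ U, U ∈ S'.carrier ↔ rconj U g ∈ S.carrier) (h : x.IsRep α) :
    (conjOp R M g S S' hS x).IsRep fun U => g • α (rconj U g) := by
  obtain ⟨a, rfl, rfl⟩ := h
  obtain ⟨hb, e⟩ := isInduced_conjOp hK hS a
  exact ⟨_, e.symm, tot_ghostConj a.1 hS⟩

open Classical in
theorem trunc {S' : TruncationSet H} (hS : S'.carrier ⊆ S.carrier) (h : x.IsRep α) :
    (trunc R M S S' hS x).IsRep fun U => if U ∈ S'.carrier then α U else 0 := by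
  obtain ⟨a, rfl, rfl⟩ := h
  obtain ⟨hb, e⟩ := isInduced_trunc hS a
  refine ⟨_, e.symm, funext fun U => ?_⟩
  by_cases hU : U ∈ S'.carrier
  · rw [if_pos hU]
    exact tot_ghostTrunc a.1 hS hU
  · rw [tot_of_notMem _ hU, if_neg hU]

theorem rightInv (h : x.IsRep α) (L : Subgroup G) (U : Subgroup G) :
    RightInv H fun c : L => (c : G) • α (rconj U c) :=
  equivariant_rightInv (fun _ hk U => h.isGhost.equivariant hk U) U

end IsRep

end Witt

variable [IsTopologicalGroup G] [CompactSpace G]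

/-- Every axiom already holds for ghost families over the free resolution, so it is checked on
representatives, where it is an identity of traces. -/
theorem isMackey_wittMackey [Finite G] (S : TruncationSet H) : (wittMackey S R M).IsMackey where
  tr_self K x := by
    obtain ⟨α, hx⟩ := Witt.exists_isRep x
    refine (hx.ver le_rfl (restrict_restrict S le_rfl)).eq
      (hx) fun U => ?_
    rw [relTrace_self (hx.rightInv K.1 U), OneMemClass.coe_one, one_smul, rconj_one]
  res_self K x := by
    obtain ⟨α, hx⟩ := Witt.exists_isRep x
    refine (hx.frob le_rfl (restrict_restrict S le_rfl)).eq
      (hx) fun U => ?_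
    split_ifs with h
    · rfl
    · exact (hx.eq_zero fun h' => h h'.2).symm
  conj_self K h hK e x := by
    obtain ⟨α, hx⟩ := Witt.exists_isRep x
    refine (hx.conjOp (rconj_eq_of_eq e) (restrict_rconj S h (K.2 hK) e)).eq
      (hx) fun U => ?_
    exact hx.isGhost.equivariant hK U
  tr_tr {J K L} i i' x := by
    obtain ⟨α, hx⟩ := Witt.exists_isRep x
    refine ((hx.ver i (restrict_restrict S i)).ver i' (restrict_restrict S i')).eq
      (hx.ver (i.trans i') (restrict_restrict S (i.trans i'))) fun U => ?_
    rw [← relTrace_trans i i' (hx.rightInv L.1 U)]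
    refine relTrace_congr fun c => ?_
    rw [← DistribSMul.toAddMonoidHom_apply, map_relTrace]
    refine relTrace_congr fun b => ?_
    rw [DistribSMul.toAddMonoidHom_apply, smul_smul, rconj_rconj]
    rfl
  res_res {J K L} i i' x := by
    obtain ⟨α, hx⟩ := Witt.exists_isRep x
    refine ((hx.frob i' (restrict_restrict S i')).frob i (restrict_restrict S i)).eq
      (hx.frob (i.trans i') (restrict_restrict S (i.trans i'))) fun U => ?_
    split_ifs with h1 h2
    · rfl
    · exact absurd (h1.trans i) h2
    · rfl
  conj_conj {J K L} g h hg hh e e' e'' x := by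
    obtain ⟨α, hx⟩ := Witt.exists_isRep x
    refine ((hx.conjOp (rconj_eq_of_eq e) (restrict_rconj S h hh e)).conjOp (rconj_eq_of_eq e')
      (restrict_rconj S g hg e')).eq
      (hx.conjOp (rconj_eq_of_eq e'') (restrict_rconj S _ (H.mul_mem hg hh) e'')) fun U => ?_
    rw [smul_smul, rconj_rconj]
  conj_tr {K L K' L'} h hh e e' i i' x := by
    obtain ⟨α, hx⟩ := Witt.exists_isRep x
    refine ((hx.ver i (restrict_restrict S i)).conjOp (rconj_eq_of_eq e')
      (restrict_rconj S h hh e')).eq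
      ((hx.conjOp (rconj_eq_of_eq e) (restrict_rconj S h hh e)).ver i'
      (restrict_restrict S i')) fun U => ?_
    have hr : RightInv K'.1 fun n : L'.1 => (n : G) • h • α (rconj (rconj U n) h) :=
      (hx.conjOp (rconj_eq_of_eq e) (restrict_rconj S h hh e)).rightInv L'.1 U
    rw [relTrace_rconj h (f := fun n => n • h • α (rconj (rconj U n) h)) hr, rconj_eq_of_eq e,
      rconj_eq_of_eq e', ← DistribSMul.toAddMonoidHom_apply, map_relTrace]
    refine relTrace_congr fun c => ?_
    rw [DistribSMul.toAddMonoidHom_apply, rconj_rconj, rconj_rconj, smul_smul, smul_smul,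
      inv_mul_cancel_right]
  conj_res {K L K' L'} h hh e e' i i' x := by
    obtain ⟨α, hx⟩ := Witt.exists_isRep x
    refine ((hx.frob i (restrict_restrict S i)).conjOp (rconj_eq_of_eq e)
      (restrict_rconj S h hh e)).eq
      ((hx.conjOp (rconj_eq_of_eq e') (restrict_rconj S h hh e')).frob i'
      (restrict_restrict S i')) fun U => ?_
    have hU : U ≤ K'.1 ↔ rconj U h ≤ K.1 := by rw [e, le_rconj_inv_iff]
    by_cases h1 : rconj U h ≤ K.1
    · rw [if_pos h1, if_pos (hU.2 h1)]
    · rw [if_neg h1, if_neg fun h' => h1 (hU.1 h'), smul_zero]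
  res_tr {J K L} hJ hK x := by
    obtain ⟨α, hx⟩ := Witt.exists_isRep x
    have : Finite (DoubleCoset.Quotient (J.1.subgroupOf L.1 : Set L.1) (K.1.subgroupOf L.1)) :=
      Quotient.finite _
    have hd := fun d : DoubleCoset.Quotient (J.1.subgroupOf L.1 : Set L.1) (K.1.subgroupOf L.1) =>
      (((hx.frob (K := rconj J.1 (d.out : G) ⊓ K.1) inf_le_right
        (restrict_restrict S (K := ⟨rconj J.1 (d.out : G) ⊓ K.1, inf_le_right.trans K.2⟩)
          inf_le_right)).conjOp (K := J.1 ⊓ rconj K.1 (d.out : G)⁻¹)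
        (rconj_eq_of_eq (inf_rconj J.1 K.1 (d.out : G)))
        (restrict_rconj S (K := ⟨rconj J.1 (d.out : G) ⊓ K.1, inf_le_right.trans K.2⟩)
          (L := ⟨J.1 ⊓ rconj K.1 (d.out : G)⁻¹, inf_le_left.trans J.2⟩) (d.out : G)
          (L.2 d.out.2) (inf_rconj J.1 K.1 (d.out : G)))).ver (H := J.1) inf_le_left
        (restrict_restrict S (K := ⟨J.1 ⊓ rconj K.1 (d.out : G)⁻¹, inf_le_left.trans J.2⟩)
          inf_le_left))
    refine ((hx.ver hK (restrict_restrict S hK)).frob hJ (restrict_restrict S hJ)).eq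
      (Witt.IsRep.finsum hd) fun U => ?_
    split_ifs with hU
    -- The double coset axiom is the Mackey decomposition of the trace over `L/K`.
    · rw [relTrace_doubleCoset hJ (hx.rightInv L.1 U)]
      refine finsum_congr fun d => relTrace_congr fun j => ?_
      rw [rconj_rconj]
      split_ifs with h
      · rw [smul_smul]
        rfl
      -- For `U ≤ J` and `j ∈ J` the conjugate lies in `J^d`; failing the condition it is not in
      -- `K`, where `α` is supported.
      · have hz : α (rconj U (j * (d.out : G))) = 0 := by
          refine hx.eq_zero fun h' => h (le_inf ?_ h'.2)
          rw [← rconj_rconj]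
          exact rconj_mono (rconj_le hU j.2) _
        rw [smul_zero, smul_zero]
        exact (congrArg _ hz).trans (smul_zero _)
    · refine (finsum_eq_zero_of_forall_eq_zero fun d => relTrace_eq_zero fun j => ?_).symm
      rw [if_neg, smul_zero, smul_zero]
      intro h
      refine hU ?_
      have := rconj_le_rconj.1 (h.trans inf_le_left)
      exact rconj_le_rconj.1 (this.trans (rconj_of_mem j.2).ge)

theorem isHom_trunc [Finite G] (S : TruncationSet H) :
    MackeyData.IsHom (M := (wittMackeyAll G R M).restrict (le_top : H ≤ ⊤))
      (N := wittMackey S R M) fun K =>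
      trunc R M ((TruncationSet.all (⊤ : Subgroup G)).restrict K.1 le_top) (S.restrict K.1 K.2)
        (S.restrict_subset_all K.1 K.2) where
  tr {K L} i x := by
    obtain ⟨α, hx⟩ := Witt.exists_isRep x
    refine ((hx.ver i (restrict_restrict (TruncationSet.all ⊤) (K := ⟨K.1, le_top⟩)
      (L := ⟨L.1, le_top⟩) i)).trunc (S.restrict_subset_all L.1 L.2)).eq
      ((hx.trunc (S.restrict_subset_all K.1 K.2)).ver i (restrict_restrict S i)) fun U => ?_
    split_ifs with hU
    · refine relTrace_congr fun c => ?_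
      split_ifs with h
      · rfl
      · rw [hx.eq_zero fun h' => h ⟨S.conj U hU.1 c (L.2 c.2), h'.2⟩]
    · refine (relTrace_eq_zero fun c => ?_).symm
      rw [if_neg, smul_zero]
      exact fun h => hU (((S.restrict L.1 L.2).rconj_mem_iff c.2).1 ⟨h.1, h.2.trans i⟩)
  res {K L} i x := by
    obtain ⟨α, hx⟩ := Witt.exists_isRep x
    refine ((hx.frob i (restrict_restrict (TruncationSet.all ⊤) (K := ⟨K.1, le_top⟩)
      (L := ⟨L.1, le_top⟩) i)).trunc (S.restrict_subset_all K.1 K.2)).eq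
      ((hx.trunc (S.restrict_subset_all L.1 L.2)).frob i (restrict_restrict S i)) fun U => ?_
    by_cases h1 : U ∈ (S.restrict K.1 K.2).carrier
    · obtain ⟨h2, h3⟩ := (restrict_restrict S i U).1 h1
      rw [if_pos h1, if_pos h3, if_pos h3, if_pos h2]
    · rw [if_neg h1]
      split_ifs with h2 h3
      · exact absurd ((restrict_restrict S i U).2 ⟨h3, h2⟩) h1
      · rfl
      · rfl
  conj {K L} h hh e x := by
    obtain ⟨α, hx⟩ := Witt.exists_isRep x
    refine ((hx.conjOp (rconj_eq_of_eq e) (restrict_rconj (TruncationSet.all ⊤)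
      (K := ⟨K.1, le_top⟩) (L := ⟨L.1, le_top⟩) h trivial e)).trunc
      (S.restrict_subset_all L.1 L.2)).eq
      ((hx.trunc (S.restrict_subset_all K.1 K.2)).conjOp (rconj_eq_of_eq e)
      (restrict_rconj S h hh e)) fun U => ?_
    have hU := restrict_rconj S h hh e U
    by_cases h1 : U ∈ (S.restrict L.1 L.2).carrier
    · rw [if_pos h1, if_pos (hU.1 h1)]
    · rw [if_neg h1, if_neg fun h' => h1 (hU.2 h'), smul_zero]

theorem trunc_trunc {S S' S'' : TruncationSet H} (hS : S'.carrier ⊆ S.carrier)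
    (hS' : S''.carrier ⊆ S'.carrier) (x : Witt S R M) :
    trunc R M S' S'' hS' (trunc R M S S' hS x) = trunc R M S S'' (hS'.trans hS) x := by
  obtain ⟨α, hx⟩ := Witt.exists_isRep x
  refine ((hx.trunc hS).trunc hS').eq
    (hx.trunc (hS'.trans hS)) fun U => ?_
  split_ifs with h1 h2
  · rfl
  · exact absurd (hS' h1) h2
  · rfl

end MackeyAxioms

theorem MackeyData.IsMackey.restrict {G : Type v} [Group G] {H H' : Subgroup G}
    {M : MackeyData.{v, w} H'} (h : M.IsMackey) (hH : H ≤ H') : (M.restrict hH).IsMackey where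
  tr_self K x := h.tr_self ⟨K.1, K.2.trans hH⟩ x
  res_self K x := h.res_self ⟨K.1, K.2.trans hH⟩ x
  conj_self K g hK e x := h.conj_self ⟨K.1, K.2.trans hH⟩ g hK e x
  tr_tr i i' x := h.tr_tr i i' x
  res_res i i' x := h.res_res i i' x
  conj_conj g g' hg hg' e e' e'' x := h.conj_conj g g' (hH hg) (hH hg') e e' e'' x
  conj_tr g hg e e' i i' x := h.conj_tr g (hH hg) e e' i i' x
  conj_res g hg e e' i i' x := h.conj_res g (hH hg) e e' i i' x
  res_tr {J K L} hJ hK x := h.res_tr (J := ⟨J.1, J.2.trans hH⟩) (K := ⟨K.1, K.2.trans hH⟩)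
    (L := ⟨L.1, L.2.trans hH⟩) hJ hK x

/-! ### The kernel of truncation is generated by Verschiebungen -/

section TruncKernel

variable {G : Type v} [Group G] [TopologicalSpace G] {H K : Subgroup G}
  {R M : Type u} [CommRing R] [AddCommGroup M] [Module R M]

theorem TruncationSet.eq_of_carrier_eq {S S' : TruncationSet H} (h : S.carrier = S'.carrier) :
    S = S' := by
  cases S
  cases S'
  cases h
  rfl

theorem TruncationSet.eq_restrict {S : TruncationSet H} (hK : K ≤ H) {T : TruncationSet K}
    (hT : ∀ U, U ∈ T.carrier ↔ U ∈ S.carrier ∧ U ≤ K) : T = S.restrict K hK :=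
  TruncationSet.eq_of_carrier_eq (Set.ext hT)

variable (R M) in
/-- The subgroup generated by the Verschiebungen from the members of `S` that are not in `S'`. -/
def verSpan (S S' : TruncationSet H) : AddSubgroup (Witt S R M) :=
  AddSubgroup.closure {x | ∃ (U : Subgroup G) (T : TruncationSet U)
    (hT : ∀ V, V ∈ T.carrier ↔ V ∈ S.carrier ∧ V ≤ U) (y : Witt T R M),
    U ∈ S.carrier ∧ U ∉ S'.carrier ∧ ver R M S T hT y = x}

variable [IsTopologicalGroup G] [CompactSpace G]

theorem trunc_self (S : TruncationSet H) (hS : S.carrier ⊆ S.carrier) (x : Witt S R M) :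
    trunc R M S S hS x = x := by
  obtain ⟨α, hx⟩ := Witt.exists_isRep x
  refine (hx.trunc hS).eq hx fun U => ?_
  split_ifs with h
  · rfl
  · exact (hx.eq_zero h).symm

theorem trunc_ver {S S₁ : TruncationSet H} (hS : S₁.carrier ⊆ S.carrier) [K.FiniteIndex]
    (hK : K ≤ H) (y : Witt (S.restrict K hK) R M) :
    trunc R M S S₁ hS (ver R M S (S.restrict K hK) (S.mem_restrict K hK) y) =
      ver R M S₁ (S₁.restrict K hK) (S₁.mem_restrict K hK)
        (trunc R M _ _ (TruncationSet.restrict_subset hS K hK) y) := by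
  obtain ⟨α, hy⟩ := Witt.exists_isRep y
  refine ((hy.ver hK (S.mem_restrict K hK)).trunc hS).eq
    ((hy.trunc (TruncationSet.restrict_subset hS K hK)).ver hK (S₁.mem_restrict K hK)) fun U => ?_
  split_ifs with hU
  · refine relTrace_congr fun c => ?_
    split_ifs with h
    · rfl
    · rw [hy.eq_zero fun h' => h ⟨S₁.conj U hU c c.2, h'.2⟩]
  · refine (relTrace_eq_zero fun c => ?_).symm
    rw [if_neg fun h => hU ((S₁.rconj_mem_iff c.2).1 h.1), smul_zero]

/-- Truncation commutes with the Verschiebung and is surjective on its source, so generators lift to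
generators. -/
theorem verSpan_le_map {S S₁ S' : TruncationSet H} (hS : S₁.carrier ⊆ S.carrier) :
    verSpan R M S₁ S' ≤ (verSpan R M S S').map (trunc R M S S₁ hS) := by
  refine (AddSubgroup.closure_le _).2 ?_
  rintro _ ⟨U, T, hT, y, hU, hU', rfl⟩
  have := S₁.finiteIndex hU
  obtain rfl := TruncationSet.eq_restrict (S₁.le U hU) hT
  obtain ⟨z, rfl⟩ := trunc_surjective
    (TruncationSet.restrict_subset hS U (S₁.le U hU)) y
  exact ⟨_, AddSubgroup.subset_closure ⟨U, _, S.mem_restrict U (S₁.le U hU), z, hS hU, hU', rfl⟩,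
    trunc_ver hS (S₁.le U hU) z⟩

/-- The kernel of a truncation map is generated by Verschiebungen. -/
theorem ker_trunc_le {S S' : TruncationSet H} (hfin : S.carrier.Finite)
    (hS : S'.carrier ⊆ S.carrier) : (trunc R M S S' hS).ker ≤ verSpan R M S S' := by
  induction hn : S.carrier.ncard using Nat.strong_induction_on generalizing S with
  | _ n ih =>
  subst hn
  intro x hx
  by_cases h : S.carrier ⊆ S'.carrier
  · obtain rfl := TruncationSet.eq_of_carrier_eq (hS.antisymm h)
    rw [AddMonoidHom.mem_ker, trunc_self] at hx
    rw [hx]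
    exact zero_mem _
  -- Induction on the size of `S`. A member `K` outside `S'` is removed with all its subconjugates;
  -- none of these is in `S'`, which is closed upwards and under conjugation.
  · obtain ⟨K, hK, hK'⟩ := Set.not_subset.1 h
    have hKH := S.le K hK
    have := S.finiteIndex hK
    have hS' : S'.carrier ⊆ (S.diff K).carrier := fun U hU => ⟨hS hU, fun ⟨g, hg, hgK⟩ =>
      hK' (S'.mem_of_le (S'.conj U hU g hg) hgK hKH)⟩
    have hlt : (S.diff K).carrier.ncard < S.carrier.ncard :=
      Set.ncard_lt_ncard ⟨S.diff_subset K, fun h' => (h' hK).2 ⟨1, H.one_mem, (rconj_one K).le⟩⟩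
        hfin
    have h1 : trunc R M S (S.diff K) (S.diff_subset K) x ∈ verSpan R M (S.diff K) S' := by
      refine ih _ hlt (hfin.subset (S.diff_subset K)) hS' rfl ?_
      rw [AddMonoidHom.mem_ker, trunc_trunc]
      exact hx
    -- After correction by a lift `z` from the span, the difference dies in `S ∖ K`, so exactness
    -- puts it in the image of the Verschiebung from `K`.
    obtain ⟨z, hz, e⟩ := verSpan_le_map (S.diff_subset K) h1
    have h2 : x - z ∈ (ver R M S (S.restrict K hKH) (S.mem_restrict K hKH)).range := by
      rw [range_ver, AddMonoidHom.mem_ker, map_sub, e, sub_self]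
    obtain ⟨y, hy⟩ := h2
    rw [← sub_add_cancel x z, ← hy]
    exact add_mem (AddSubgroup.subset_closure ⟨K, _, _, y, hK, hK', rfl⟩) hz

end TruncKernel

/-! ### The action of orbits on a Mackey functor -/

section BoxProduct

variable {G : Type v} [Group G] {H : Subgroup G}

namespace MackeyData

variable {M : MackeyData.{v, w} H}

theorem IsMackey.conj_res_self (hM : M.IsMackey) {A B L : Subgp H} {k : G} (hk : k ∈ L.1)
    (e : B.1 = rconj A.1 k⁻¹) (hA : A.1 ≤ L.1) (hB : B.1 ≤ L.1) (x : M.obj L) :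
    M.conj k (L.2 hk) e (M.res hA x) = M.res hB x := by
  have e' : L.1 = rconj L.1 k⁻¹ := (rconj_of_mem (L.1.inv_mem hk)).symm
  rw [hM.conj_res k (L.2 hk) e e' hA hB, hM.conj_self L k hk e']

theorem IsMackey.tr_conj_self (hM : M.IsMackey) {A B L : Subgp H} {k : G} (hk : k ∈ L.1)
    (e : B.1 = rconj A.1 k⁻¹) (hA : A.1 ≤ L.1) (hB : B.1 ≤ L.1) (x : M.obj A) :
    M.tr hB (M.conj k (L.2 hk) e x) = M.tr hA x := by
  have e' : L.1 = rconj L.1 k⁻¹ := (rconj_of_mem (L.1.inv_mem hk)).symm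
  rw [← hM.conj_tr k (L.2 hk) e e' hA hB, hM.conj_self L k hk e']

/-- Multiplication by the orbit `[L/U]`. -/
def orb (M : MackeyData.{v, w} H) {U L : Subgp H} (i : U.1 ≤ L.1) : M.obj L →+ M.obj L :=
  (M.tr i).comp (M.res i)

theorem orb_apply {U L : Subgp H} (i : U.1 ≤ L.1) (x : M.obj L) :
    M.orb i x = M.tr i (M.res i x) := rfl

theorem IsMackey.orb_self (hM : M.IsMackey) (L : Subgp H) (x : M.obj L) :
    M.orb (le_refl L.1) x = x := by
  rw [orb_apply, hM.res_self, hM.tr_self]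

theorem IsMackey.orb_rconj (hM : M.IsMackey) {U V L : Subgp H} {k : G} (hk : k ∈ L.1)
    (e : V.1 = rconj U.1 k) (i : U.1 ≤ L.1) (j : V.1 ≤ L.1) (x : M.obj L) :
    M.orb i x = M.orb j x := by
  have e' : V.1 = rconj U.1 k⁻¹⁻¹ := by rw [e, inv_inv]
  rw [orb_apply, orb_apply, ← hM.conj_res_self (L.1.inv_mem hk) e' i j,
    hM.tr_conj_self (L.1.inv_mem hk)]

/-- `tr (x · res [L/U])`, as a sum over double cosets. -/
theorem IsMackey.res_orb (hM : M.IsMackey) {J U L : Subgp H} (hJ : J.1 ≤ L.1) (hU : U.1 ≤ L.1)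
    (x : M.obj L) :
    M.res hJ (M.orb hU x) =
      ∑ᶠ d : DoubleCoset.Quotient (J.1.subgroupOf L.1 : Set L.1) (U.1.subgroupOf L.1),
        M.orb (U := ⟨J.1 ⊓ rconj U.1 (d.out : G)⁻¹, inf_le_left.trans J.2⟩) inf_le_left
          (M.res hJ x) := by
  rw [orb_apply, hM.res_tr hJ hU]
  refine finsum_congr fun d => ?_
  rw [orb_apply, hM.res_res, hM.res_res]
  exact congrArg _ (hM.conj_res_self d.out.2 _ _ _ x)

/-- The summand of the double coset formula does not depend on the representative of `JxU`: changing
it conjugates the intersection by an element of `J`. -/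
theorem IsMackey.tr_inf_eq (hM : M.IsMackey) {J U L : Subgp H} (hJ : J.1 ≤ L.1)
    {x y : L.1} {j u : L.1} (hj : (j : G) ∈ J.1) (hu : (u : G) ∈ U.1) (e : y = j * x * u)
    (m : M.obj J) :
    M.tr (K := ⟨J.1 ⊓ rconj U.1 (y : G)⁻¹, inf_le_left.trans J.2⟩) (L := L)
        (inf_le_left.trans hJ) (M.res inf_le_left m) =
      M.tr (K := ⟨J.1 ⊓ rconj U.1 (x : G)⁻¹, inf_le_left.trans J.2⟩) (L := L)
        (inf_le_left.trans hJ) (M.res inf_le_left m) := by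
  have e' : J.1 ⊓ rconj U.1 (y : G)⁻¹ = rconj (J.1 ⊓ rconj U.1 (x : G)⁻¹) (j : G)⁻¹ := by
    rw [rconj_inf, rconj_of_mem (J.1.inv_mem hj), rconj_rconj, e]
    have : ((j * x * u : L.1) : G)⁻¹ = (u : G)⁻¹ * ((x : G)⁻¹ * (j : G)⁻¹) := by
      simp [mul_assoc]
    rw [this, ← rconj_rconj, rconj_of_mem (U.1.inv_mem hu)]
  rw [← hM.conj_res_self (A := ⟨J.1 ⊓ rconj U.1 (x : G)⁻¹, inf_le_left.trans J.2⟩)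
    (B := ⟨J.1 ⊓ rconj U.1 (y : G)⁻¹, inf_le_left.trans J.2⟩) hj e' inf_le_left inf_le_left]
  exact hM.tr_conj_self (A := ⟨J.1 ⊓ rconj U.1 (x : G)⁻¹, inf_le_left.trans J.2⟩)
    (B := ⟨J.1 ⊓ rconj U.1 (y : G)⁻¹, inf_le_left.trans J.2⟩) j.2 e' _ _ _

/-- Frobenius reciprocity `[L/U] · tr m = tr (res [L/U] · m)`, with the restricted orbit written out
over double cosets. -/
theorem IsMackey.orb_tr [Finite G] (hM : M.IsMackey) {J U L : Subgp H} (hJ : J.1 ≤ L.1)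
    (hU : U.1 ≤ L.1) (m : M.obj J) :
    M.orb hU (M.tr hJ m) =
      ∑ᶠ d : DoubleCoset.Quotient (J.1.subgroupOf L.1 : Set L.1) (U.1.subgroupOf L.1),
        M.tr hJ (M.orb (U := ⟨J.1 ⊓ rconj U.1 (d.out : G)⁻¹, inf_le_left.trans J.2⟩)
          inf_le_left m) := by
  have : Finite (DoubleCoset.Quotient (U.1.subgroupOf L.1 : Set L.1) (J.1.subgroupOf L.1)) :=
    Quotient.finite _
  rw [orb_apply, hM.res_tr hU hJ, (M.tr hU).map_finsum (Set.toFinite _)]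
  have hinv : ∀ (A B : Subgroup G) (a b : L.1),
      DoubleCoset.setoid (A.subgroupOf L.1 : Set L.1) (B.subgroupOf L.1) a b →
      DoubleCoset.setoid (B.subgroupOf L.1 : Set L.1) (A.subgroupOf L.1) a⁻¹ b⁻¹ := by
    intro A B a b h
    rw [DoubleCoset.rel_iff] at h ⊢
    obtain ⟨p, hp, q, hq, rfl⟩ := h
    exact ⟨q⁻¹, inv_mem hq, p⁻¹, inv_mem hp, by group⟩
  -- The Mackey axiom sums over `U\L/J`, the restricted orbit over `J\L/U`; inversion exchanges
  -- them.
  let e : DoubleCoset.Quotient (U.1.subgroupOf L.1 : Set L.1) (J.1.subgroupOf L.1) ≃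
      DoubleCoset.Quotient (J.1.subgroupOf L.1 : Set L.1) (U.1.subgroupOf L.1) :=
    { toFun := Quotient.map (·⁻¹) (hinv _ _)
      invFun := Quotient.map (·⁻¹) (hinv _ _)
      left_inv := by refine Quotient.ind fun a => ?_; simp; rfl
      right_inv := by refine Quotient.ind fun a => ?_; simp; rfl }
  refine finsum_eq_of_bijective e e.bijective fun d => ?_
  have hd : DoubleCoset.setoid (J.1.subgroupOf L.1 : Set L.1) (U.1.subgroupOf L.1)
      (d.out)⁻¹ (e d).out :=
    Quotient.exact (Eq.trans (congrArg e (Quotient.out_eq d)) (Quotient.out_eq (e d)).symm)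
  rw [DoubleCoset.rel_iff] at hd
  obtain ⟨j, hj, u, hu, hd⟩ := hd
  rw [orb_apply, hM.tr_tr, hM.tr_tr]
  refine Eq.trans ?_ (hM.tr_inf_eq hJ (Subgroup.mem_subgroupOf.1 hj)
    (Subgroup.mem_subgroupOf.1 hu) hd m).symm
  have e1 : rconj U.1 (d.out : G) ⊓ J.1 = J.1 ⊓ rconj U.1 (((d.out)⁻¹ : L.1) : G)⁻¹ := by
    rw [inf_comm]
    simp
  have e2 := hM.tr_conj_self (A := ⟨rconj U.1 (d.out : G) ⊓ J.1, inf_le_right.trans J.2⟩)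
    (B := ⟨U.1 ⊓ rconj J.1 (d.out : G)⁻¹, inf_le_left.trans U.2⟩) d.out.2
    (inf_rconj U.1 J.1 (d.out : G)) (inf_le_right.trans hJ) (inf_le_left.trans hU)
    (M.res inf_le_right m)
  refine e2.trans ?_
  have key : ∀ (A B : Subgp H) (_ : A.1 = B.1) (hA : A.1 ≤ J.1) (hB : B.1 ≤ J.1),
      M.tr (hA.trans hJ) (M.res hA m) = M.tr (hB.trans hJ) (M.res hB m) := by
    rintro A B h hA hB
    obtain rfl := Subtype.ext h
    rfl
  exact key _ _ e1 _ _

end MackeyData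

variable [TopologicalSpace G] (S : TruncationSet H)

theorem Burn.hom_ext {K : Subgroup G} {A : Type*} [AddCommGroup A] {φ ψ : Burn S K →+ A}
    (h : ∀ U, φ (Burn.cls S U) = ψ (Burn.cls S U)) : φ = ψ := by
  refine AddMonoidHom.ext fun x => ?_
  obtain ⟨x, rfl⟩ := QuotientAddGroup.mk_surjective x
  exact DFunLike.congr_fun (FreeAbelianGroup.lift_ext (φ.comp (QuotientAddGroup.mk' _))
    (ψ.comp (QuotientAddGroup.mk' _)) h) x

end BoxProduct

/-! ### The pairing with the truncated Burnside functor -/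

section OrbitPairing

variable {G : Type v} [Group G] [TopologicalSpace G] {H : Subgroup G}
  {M : MackeyData.{v, w} H} {P : MackeyData.{v, w'} H}

open MackeyData

/-- The pairing `(x, [K/U]) ↦ ρ(x · [K/U])` of `M` and the truncated Burnside functor. -/
def orbitPairing (hM : M.IsMackey) (S : TruncationSet H) (ρ : ∀ K, M.obj K →+ P.obj K)
    (h0 : ∀ (K U : Subgp H) (i : U.1 ≤ K.1), U.1 ∉ S.carrier → ∀ y, ρ K (M.tr i y) = 0)
    (K : Subgp H) : M.obj K →+ Burn S K.1 →+ P.obj K :=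
  AddMonoidHom.flip <| Burn.lift S
    (fun U : Subgp K.1 => (ρ K).comp (M.orb (U := ⟨U.1, U.2.trans K.2⟩) U.2))
    (fun U V k hk e => by
      ext x
      exact congrArg (ρ K) (hM.orb_rconj (U := ⟨U.1, U.2.trans K.2⟩)
        (V := ⟨V.1, V.2.trans K.2⟩) hk e U.2 V.2 x))
    (fun U hU => by
      ext x
      exact h0 K _ _ hU _)

variable {hM : M.IsMackey} {S : TruncationSet H} {ρ : ∀ K, M.obj K →+ P.obj K}
  {h0 : ∀ (K U : Subgp H) (i : U.1 ≤ K.1), U.1 ∉ S.carrier → ∀ y, ρ K (M.tr i y) = 0}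

theorem orbitPairing_cls (K : Subgp H) (x : M.obj K) (U : Subgp K.1) :
    orbitPairing hM S ρ h0 K x (Burn.cls S U) =
      ρ K (M.orb (U := ⟨U.1, U.2.trans K.2⟩) U.2 x) := by
  rw [orbitPairing, AddMonoidHom.flip_apply, Burn.lift_cls]
  rfl

theorem orbitPairing_self (K : Subgp H) (x : M.obj K) :
    orbitPairing hM S ρ h0 K x (Burn.cls S ⟨K.1, le_rfl⟩) = ρ K x := by
  rw [orbitPairing_cls]
  exact congrArg (ρ K) (hM.orb_self K x)

theorem Burn.resOrbit_self {J L : Subgroup G} (i : J ≤ L) :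
    Burn.resOrbit S J (⟨L, le_rfl⟩ : Subgp L) = Burn.cls S ⟨J, le_rfl⟩ := by
  have : Subsingleton (DoubleCoset.Quotient (J.subgroupOf L : Set L) (L.subgroupOf L)) := by
    refine ⟨Quotient.ind₂ fun a b => Quotient.sound ?_⟩
    change DoubleCoset.setoid (J.subgroupOf L : Set L) (L.subgroupOf L) a b
    rw [DoubleCoset.rel_iff]
    exact ⟨1, one_mem _, a⁻¹ * b, (a⁻¹ * b).2, by simp⟩
  refine (finsum_eq_single _ (Quotient.mk'' 1 :
    DoubleCoset.Quotient (J.subgroupOf L : Set L) (L.subgroupOf L))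
    fun d hd => absurd (this.elim _ _) hd).trans ?_
  refine congrArg (Burn.cls S) (Subtype.ext ?_)
  change J ⊓ rconj L _ = J
  rw [rconj_of_mem (L.inv_mem (SetLike.coe_mem _)), inf_eq_left]
  exact i

theorem burnside_res_cls [IsTopologicalGroup G] {J L : Subgp H} (i : J.1 ≤ L.1)
    (U : Subgp L.1) : (burnside S).res i (Burn.cls S U) = Burn.resOrbit S J.1 U :=
  Burn.lift_cls S (Burn.resOrbit S J.1) (fun _ _ k hk h => Burn.resOrbit_conj S _ _ k hk h)
    (fun U h => Burn.resOrbit_eq_zero S L.2 U h) U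

theorem burnside_res_self_cls [IsTopologicalGroup G] {J L : Subgp H} (i : J.1 ≤ L.1) :
    (burnside S).res i (Burn.cls S ⟨L.1, le_rfl⟩) = Burn.cls S ⟨J.1, le_rfl⟩ :=
  (burnside_res_cls i _).trans (Burn.resOrbit_self i)

theorem Burn.tr_cls {J L : Subgroup G} (i : J ≤ L) (U : Subgp J) :
    Burn.tr S i (Burn.cls S U) = Burn.cls S ⟨U.1, U.2.trans i⟩ :=
  Burn.lift_cls S (fun U => Burn.cls S ⟨U.1, U.2.trans i⟩)
    (fun _ _ k hk h => Burn.cls_conj S _ _ k (i hk) h)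
    (fun _ h => Burn.cls_eq_zero S _ h) U

theorem Burn.conj_cls {K L : Subgroup G} (h : G) (hh : h ∈ H) (e : L = rconj K h⁻¹)
    (U : Subgp K) : Burn.conj S h hh e (Burn.cls S U) =
      Burn.cls S ⟨rconj U.1 h⁻¹, e ▸ rconj_mono U.2 h⁻¹⟩ := by
  rw [Burn.conj, Burn.lift_cls]

theorem burnside_conj_self_cls [IsTopologicalGroup G] {K L : Subgp H} (h : G) (hh : h ∈ H)
    (e : L.1 = rconj K.1 h⁻¹) :
    (burnside S).conj h hh e (Burn.cls S ⟨K.1, le_rfl⟩) = Burn.cls S ⟨L.1, le_rfl⟩ :=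
  (Burn.conj_cls h hh e _).trans (congrArg (Burn.cls S) (Subtype.ext e.symm))

theorem Burn.hom_ext_apply {K : Subgroup G} {A : Type*} [AddCommGroup A] {φ ψ : Burn S K →+ A}
    (h : ∀ U, φ (Burn.cls S U) = ψ (Burn.cls S U)) (n : Burn S K) : φ n = ψ n :=
  DFunLike.congr_fun (Burn.hom_ext S h) n

variable [Finite G]

theorem orbitPairing_resOrbit {J L : Subgp H} (U : Subgp L.1) (x : M.obj J) :
    orbitPairing hM S ρ h0 J x (Burn.resOrbit S J.1 U) =
      ∑ᶠ d : DoubleCoset.Quotient (J.1.subgroupOf L.1 : Set L.1) (U.1.subgroupOf L.1),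
        ρ J (M.orb (U := ⟨J.1 ⊓ rconj U.1 (d.out : G)⁻¹, inf_le_left.trans J.2⟩)
          inf_le_left x) := by
  have : Finite (DoubleCoset.Quotient (J.1.subgroupOf L.1 : Set L.1) (U.1.subgroupOf L.1)) :=
    Quotient.finite _
  rw [Burn.resOrbit, AddMonoidHom.map_finsum _ (Set.toFinite _)]
  exact finsum_congr fun d => orbitPairing_cls _ _ _

/-- All identities are additive in the Burnside variable, so orbits suffice. There they become
`res_orb`, compatibility with conjugation, `orb_tr`, and composition of transfers and restrictions.
-/
theorem isPairing_orbitPairing [IsTopologicalGroup G] (hρt : ∀ {K L : Subgp H} (i : K.1 ≤ L.1) x,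
      ρ L (M.tr i x) = P.tr i (ρ K x))
    (hρr : ∀ {K L : Subgp H} (i : K.1 ≤ L.1) x, ρ K (M.res i x) = P.res i (ρ L x))
    (hρc : ∀ {K L : Subgp H} (h : G) (hh : h ∈ H) (e : L.1 = rconj K.1 h⁻¹) x,
      ρ L (M.conj h hh e x) = P.conj h hh e (ρ K x)) :
    IsPairing (M := M) (N := burnside S) (P := P) (orbitPairing hM S ρ h0) where
  res {K L} i m n := by
    let res : Burn S L.1 →+ Burn S K.1 := (burnside S).res i
    refine Burn.hom_ext_apply (φ := (P.res i).comp (orbitPairing hM S ρ h0 L m))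
      (ψ := (orbitPairing hM S ρ h0 K (M.res i m)).comp res) (fun U => ?_) n
    have hres : res (Burn.cls S U) = Burn.resOrbit S K.1 U := burnside_res_cls i U
    have : Finite (DoubleCoset.Quotient (K.1.subgroupOf L.1 : Set L.1) (U.1.subgroupOf L.1)) :=
      Quotient.finite _
    rw [AddMonoidHom.comp_apply, AddMonoidHom.comp_apply, hres,
      orbitPairing_resOrbit, orbitPairing_cls, ← hρr,
      hM.res_orb (U := ⟨U.1, U.2.trans L.2⟩) i U.2, (ρ K).map_finsum (Set.toFinite _)]
  conj {K L} h hh e m n := by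
    refine Burn.hom_ext_apply (φ := (P.conj h hh e).comp (orbitPairing hM S ρ h0 K m))
      (ψ := (orbitPairing hM S ρ h0 L (M.conj h hh e m)).comp (Burn.conj S h hh e))
      (fun U => ?_) n
    rw [AddMonoidHom.comp_apply, AddMonoidHom.comp_apply, Burn.conj_cls, orbitPairing_cls,
      orbitPairing_cls, ← hρc]
    refine congrArg (ρ L) ?_
    have hU : U.1 ≤ H := U.2.trans K.2
    have hU' : rconj U.1 h⁻¹ ≤ L.1 := e ▸ rconj_mono U.2 h⁻¹
    rw [orb_apply, hM.conj_tr (K' := ⟨rconj U.1 h⁻¹, hU'.trans L.2⟩) h hh rfl e _ hU',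
      hM.conj_res (K' := ⟨rconj U.1 h⁻¹, hU'.trans L.2⟩) h hh rfl e _ hU']
    rfl
  tr_left {K L} i m n := by
    let res : Burn S L.1 →+ Burn S K.1 := (burnside S).res i
    refine Burn.hom_ext_apply (φ := (P.tr i).comp ((orbitPairing hM S ρ h0 K m).comp res))
      (ψ := orbitPairing hM S ρ h0 L (M.tr i m)) (fun U => ?_) n
    have hres : res (Burn.cls S U) = Burn.resOrbit S K.1 U := burnside_res_cls i U
    have : Finite (DoubleCoset.Quotient (K.1.subgroupOf L.1 : Set L.1) (U.1.subgroupOf L.1)) :=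
      Quotient.finite _
    rw [AddMonoidHom.comp_apply, AddMonoidHom.comp_apply, hres,
      orbitPairing_resOrbit, orbitPairing_cls, hM.orb_tr (U := ⟨U.1, U.2.trans L.2⟩) i U.2,
      (ρ L).map_finsum (Set.toFinite _), (P.tr i).map_finsum (Set.toFinite _)]
    exact finsum_congr fun d => (hρt _ _).symm
  tr_right {K L} i m n := by
    refine Burn.hom_ext_apply (φ := (P.tr i).comp (orbitPairing hM S ρ h0 K (M.res i m)))
      (ψ := (orbitPairing hM S ρ h0 L m).comp (Burn.tr S i)) (fun U => ?_) n
    rw [AddMonoidHom.comp_apply, AddMonoidHom.comp_apply, Burn.tr_cls, orbitPairing_cls,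
      orbitPairing_cls, ← hρt]
    refine congrArg (ρ L) ?_
    rw [orb_apply, hM.tr_tr, hM.res_res]
    rfl

end OrbitPairing

/-! ### Box products as quotients by transfers -/

section Truncation

variable {G : Type v} [Group G] [TopologicalSpace G] [IsTopologicalGroup G] [Finite G]
  {H : Subgroup G} {S : TruncationSet H} {M P : MackeyData.{v, max u v} H}

open MackeyData

/-- A Mackey functor is the box product of `M` with the truncated Burnside functor if it is the
quotient of `M` by the transfers from the subgroups that are not in `S`. -/
theorem isBoxProduct_orbitPairing (hM : M.IsMackey) (hP : P.IsMackey)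
    {ρ : ∀ K, M.obj K →+ P.obj K} (hρ : IsHom ρ) (hs : ∀ K, Function.Surjective (ρ K))
    (h0 : ∀ (K U : Subgp H) (i : U.1 ≤ K.1), U.1 ∉ S.carrier → ∀ y, ρ K (M.tr i y) = 0)
    (hk : ∀ K, (ρ K).ker ≤ AddSubgroup.closure
      {x | ∃ (U : Subgp H) (i : U.1 ≤ K.1) (y : M.obj U), U.1 ∉ S.carrier ∧ M.tr i y = x}) :
    IsBoxProduct.{v, max u v, v} M (burnside S) P (orbitPairing hM S ρ h0) where
  isMackey := hP
  isPairing := isPairing_orbitPairing hρ.tr hρ.res hρ.conj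
  existsUnique Q hQ γ hγ := by
    -- Pairing with the unit kills transfers from `U ∉ S`: `γ(tr y, [K/K])` is the transfer of `γ(y,
    -- [U/U])`, and `[U/U] = 0`.
    have hker : ∀ K, (ρ K).ker ≤ ((γ K).flip (Burn.cls S ⟨K.1, le_rfl⟩)).ker := by
      intro K
      refine (hk K).trans ((AddSubgroup.closure_le _).2 ?_)
      rintro _ ⟨U, i, y, hU, rfl⟩
      have e : (burnside S).res i (Burn.cls S ⟨K.1, le_rfl⟩) = 0 :=
        (burnside_res_self_cls i).trans (Burn.cls_eq_zero S _ hU)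
      exact (hγ.tr_left i y (Burn.cls S ⟨K.1, le_rfl⟩)).symm.trans
        ((congrArg (fun b => Q.tr i (γ U y b)) e).trans
          ((congrArg (Q.tr i) (map_zero (γ U y))).trans (map_zero _)))
    -- The morphism is forced: it must send `ρ x` to `γ(x, [K/K])`, because `ρ x` is the pairing of
    -- `x` with the unit.
    let φ : ∀ K, P.obj K →+ Q.obj K := fun K =>
      (ρ K).liftOfSurjective (hs K) ⟨_, hker K⟩
    have hφ : ∀ K x, φ K (ρ K x) = γ K x (Burn.cls S ⟨K.1, le_rfl⟩) := fun K x =>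
      (ρ K).liftOfRightInverse_comp_apply _ (Function.rightInverse_surjInv (hs K)) ⟨_, hker K⟩ x
    refine ⟨φ, ⟨⟨fun {K L} i x => ?_, fun {K L} i x => ?_, fun {K L} h hh e x => ?_⟩,
      fun K m n => ?_⟩, ?_⟩
    · obtain ⟨x, rfl⟩ := hs K x
      rw [← hρ.tr, hφ, hφ]
      exact (hγ.tr_left i x (Burn.cls S ⟨L.1, le_rfl⟩)).symm.trans
        (congrArg (fun b => Q.tr i (γ K x b)) (burnside_res_self_cls i))
    · obtain ⟨x, rfl⟩ := hs L x
      rw [← hρ.res, hφ, hφ]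
      exact ((hγ.res i x (Burn.cls S ⟨L.1, le_rfl⟩)).trans
        (congrArg (fun b => γ K (M.res i x) b) (burnside_res_self_cls i))).symm
    · obtain ⟨x, rfl⟩ := hs K x
      rw [← hρ.conj, hφ, hφ]
      exact ((hγ.conj h hh e x (Burn.cls S ⟨K.1, le_rfl⟩)).trans
        (congrArg (fun b => γ L (M.conj h hh e x) b) (burnside_conj_self_cls h hh e))).symm
    -- Compatibility on `[K/U]` follows from writing it as the transfer of the unit `[U/U]` and
    -- using both projection formulas for `γ`.
    · refine Burn.hom_ext_apply (φ := (φ K).comp (orbitPairing hM S ρ h0 K m)) (ψ := γ K m)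
        (fun U => ?_) n
      let U' : Subgp H := ⟨U.1, U.2.trans K.2⟩
      rw [AddMonoidHom.comp_apply, orbitPairing_cls, hφ, orb_apply]
      refine (hγ.tr_left (K := U') U.2 _ (Burn.cls S ⟨K.1, le_rfl⟩)).symm.trans ?_
      refine (congrArg (fun b => Q.tr (K := U') U.2 (γ U' (M.res U.2 m) b))
        (burnside_res_self_cls (J := U') U.2)).trans ?_
      refine (hγ.tr_right (K := U') U.2 m (Burn.cls S ⟨U.1, le_rfl⟩)).trans ?_
      exact congrArg (fun b => γ K m b) (Burn.tr_cls U.2 ⟨U.1, le_rfl⟩)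
    · rintro φ' ⟨-, h'⟩
      funext K
      ext x
      obtain ⟨x, rfl⟩ := hs K x
      rw [hφ]
      exact (congrArg (φ' K) (orbitPairing_self K x).symm).trans (h' K x _)

end Truncation

/-! ### Truncated Witt vectors as a Mackey truncation -/

section WittTruncation

variable {G : Type v} [Group G] [TopologicalSpace G] [IsTopologicalGroup G] [CompactSpace G]
  {H : Subgroup G}

theorem witt_eq_zero_of_isEmpty {S : TruncationSet H} {R M : Type u} [CommRing R]
    [AddCommGroup M] [Module R M] (hS : ∀ U, U ∉ S.carrier) (x : Witt S R M) : x = 0 := by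
  obtain ⟨α, hx⟩ := Witt.exists_isRep x
  exact hx.eq Witt.IsRep.zero fun U => hx.eq_zero (hS U)

variable [Finite G] (R M : Type u) [CommRing R] [AddCommGroup M] [Module R M]

/-- Truncation commutes with transfers. For `U ∉ S` no subgroup of `U` is in `S`, so the truncated
Witt vectors at `U` vanish. -/
theorem trunc_tr_eq_zero (S : TruncationSet H) (K U : Subgp H) (i : U.1 ≤ K.1)
    (hU : U.1 ∉ S.carrier)
    (y : ((wittMackeyAll G R M).restrict (le_top : H ≤ ⊤)).obj U) :
    trunc R M ((TruncationSet.all (⊤ : Subgroup G)).restrict K.1 le_top) (S.restrict K.1 K.2)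
      (S.restrict_subset_all K.1 K.2)
      (((wittMackeyAll G R M).restrict (le_top : H ≤ ⊤)).tr i y) = 0 := by
  refine ((isHom_trunc S).tr i y).trans ?_
  refine (congrArg ((wittMackey S R M).tr i)
    (witt_eq_zero_of_isEmpty (S := S.restrict U.1 U.2) (fun V hV => hU ?_) _)).trans (map_zero _)
  exact S.mem_of_le hV.1 hV.2 U.2

/-- The pairing of the Witt vector Mackey functor and the truncated Burnside functor. -/
def wittPairing (S : TruncationSet H) (K : Subgp H) :
    ((wittMackeyAll G R M).restrict (le_top : H ≤ ⊤)).obj K →+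
      (burnside S).obj K →+ (wittMackey S R M).obj K :=
  orbitPairing ((isMackey_wittMackey (TruncationSet.all ⊤)).restrict le_top) S
    (M := (wittMackeyAll G R M).restrict (le_top : H ≤ ⊤)) (P := wittMackey S R M)
    (fun K => trunc R M ((TruncationSet.all (⊤ : Subgroup G)).restrict K.1 le_top)
      (S.restrict K.1 K.2) (S.restrict_subset_all K.1 K.2)) (trunc_tr_eq_zero R M S) K

/-- Truncation is a surjective morphism of Mackey functors, and by `ker_trunc_le` its kernel is
generated by transfers from subgroups outside `S`. -/
theorem isMackeyTruncation_wittPairing (S : TruncationSet H) :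
    IsMackeyTruncation S (wittMackeyAll G R M) (wittMackey S R M) (wittPairing R M S) := by
  refine isBoxProduct_orbitPairing
    ((isMackey_wittMackey (TruncationSet.all ⊤)).restrict le_top) (isMackey_wittMackey S) (isHom_trunc S)
    (fun K => trunc_surjective _) (trunc_tr_eq_zero R M S) fun K => ?_
  refine (ker_trunc_le (Set.toFinite _) _).trans (AddSubgroup.closure_mono ?_)
  rintro _ ⟨U, T, hT, y, hU, hU', rfl⟩
  have hUK := hU.2
  obtain rfl : T = (TruncationSet.all ⊤).restrict U le_top :=
    TruncationSet.eq_of_carrier_eq (Set.ext fun V =>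
      (hT V).trans ⟨fun h => ⟨h.1.1, h.2⟩, fun h => ⟨⟨h.1, h.2.trans hUK⟩, h.2⟩⟩)
  exact ⟨⟨U, hUK.trans K.2⟩, hUK, y, fun h => hU' ⟨h, hUK⟩, rfl⟩

theorem wittPairing_self (S : TruncationSet H) (K : Subgp H)
    (x : Witt ((TruncationSet.all (⊤ : Subgroup G)).restrict K.1 le_top) R M) :
    wittPairing R M S K x (Burn.cls S ⟨K.1, le_rfl⟩) =
      trunc R M ((TruncationSet.all (⊤ : Subgroup G)).restrict K.1 le_top)
        (S.restrict K.1 K.2) (S.restrict_subset_all K.1 K.2) x :=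
  orbitPairing_self (M := (wittMackeyAll G R M).restrict (le_top : H ≤ ⊤))
    (P := wittMackey S R M) K x

/-- On an orbit, both sides are truncations of the same element, and truncations compose. -/
theorem trunc_wittPairing (S S' : TruncationSet H) (hS : S'.carrier ⊆ S.carrier) (K : Subgp H)
    (x : Witt ((TruncationSet.all (⊤ : Subgroup G)).restrict K.1 le_top) R M) (a : Burn S K.1) :
    trunc R M (S.restrict K.1 K.2) (S'.restrict K.1 K.2)
        (TruncationSet.restrict_subset hS K.1 K.2) (wittPairing R M S K x a) =
      wittPairing R M S' K x (Burn.proj S S' hS K.1 a) := by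
  let β : Burn S K.1 →+ Witt (S.restrict K.1 K.2) R M := wittPairing R M S K x
  let β' : Burn S' K.1 →+ Witt (S'.restrict K.1 K.2) R M := wittPairing R M S' K x
  refine Burn.hom_ext_apply (φ := (trunc R M (S.restrict K.1 K.2) (S'.restrict K.1 K.2)
    (TruncationSet.restrict_subset hS K.1 K.2)).comp β)
    (ψ := β'.comp (Burn.proj S S' hS K.1)) (fun U => ?_) a
  rw [AddMonoidHom.comp_apply, AddMonoidHom.comp_apply, Burn.proj, Burn.lift_cls]
  have h1 : β (Burn.cls S U) = _ := orbitPairing_cls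
    (M := (wittMackeyAll G R M).restrict (le_top : H ≤ ⊤)) (P := wittMackey S R M) K x U
  have h2 : β' (Burn.cls S' U) = _ := orbitPairing_cls
    (M := (wittMackeyAll G R M).restrict (le_top : H ≤ ⊤)) (P := wittMackey S' R M) K x U
  rw [h1, h2]
  exact trunc_trunc _ _ _

end WittTruncation

end GWitt

end

theorem mainTheorem7 {G : Type v} [Group G] [TopologicalSpace G] [IsTopologicalGroup G]
    [CompactSpace G] [TotallyDisconnectedSpace G] (R M : Type u) [CommRing R] [AddCommGroup M]
    [Module R M] (H : Subgroup G) (hH : IsOpen (H : Set G)) :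
    -- Verschiebung, Frobenius, truncation and conjugation are induced by the ghost operators.
    (∀ S : TruncationSet H,
      (∀ (K : Subgroup G) (_ : IsOpen (K : Set G)) (hK : K ≤ H),
        IsInduced (ghostVer S (S.restrict K hK) (S.mem_restrict K hK))
          (ver R M S (S.restrict K hK) (S.mem_restrict K hK)) ∧
        IsInduced (ghostFrob S (S.restrict K hK) (S.mem_restrict K hK))
          (frob R M S (S.restrict K hK) (S.mem_restrict K hK))) ∧
      (∀ (S' : TruncationSet H) (hS : S'.carrier ⊆ S.carrier),
        IsInduced (ghostTrunc S S' hS) (trunc R M S S' hS)) ∧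
      (∀ (g : G) (S' : TruncationSet (rconj H g⁻¹))
        (hS : ∀ U, U ∈ S'.carrier ↔ rconj U g ∈ S.carrier),
        IsInduced (ghostConj g S S' hS) (conjOp R M g S S' hS))) ∧
    -- For finite truncation sets the Witt vectors are Hausdorff.
    (∀ S : TruncationSet H, S.carrier.Finite → T2Space (Witt S R M)) ∧
    -- The right exact sequence.
    (∀ (S : TruncationSet H) (K : Subgroup G) (_ : IsOpen (K : Set G)) (hK : K ≤ H),
      ∃ V : WeylOrbits R M S hK →+ Witt S R M,
        (∀ x : Witt (S.restrict K hK) R M,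
          V (QuotientAddGroup.mk x) = ver R M S (S.restrict K hK) (S.mem_restrict K hK) x) ∧
        Continuous V ∧
        V.range = (trunc R M S (S.diff K) (S.diff_subset K)).ker ∧
        Topology.IsQuotientMap (trunc R M S (S.diff K) (S.diff_subset K)) ∧
        ∃ (V' : SeparationQuotient (WeylOrbits R M S hK) →+ SeparationQuotient (Witt S R M))
          (R' : SeparationQuotient (Witt S R M) →+ SeparationQuotient (Witt (S.diff K) R M)),
          (∀ x, V' (SeparationQuotient.mk x) = SeparationQuotient.mk (V x)) ∧
          (∀ x, R' (SeparationQuotient.mk x) =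
            SeparationQuotient.mk (trunc R M S (S.diff K) (S.diff_subset K) x)) ∧
          Continuous V' ∧ Topology.IsQuotientMap R' ∧
          closure (Set.range V') = (R'.ker : Set (SeparationQuotient (Witt S R M))) ∧
          (T2Space (Witt (S.diff K) R M) → V'.range = R'.ker)) ∧
    -- The comparison with truncation of Mackey functors.
    (Finite G →
      (wittMackeyAll G R M).IsMackey ∧
      ∃ β : ∀ (S : TruncationSet H) (K : Subgp H),
          ((wittMackeyAll G R M).restrict (le_top : H ≤ ⊤)).obj K →+
            (burnside S).obj K →+ (wittMackey S R M).obj K,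
        ∀ S : TruncationSet H,
          (wittMackey S R M).IsMackey ∧
          IsMackeyTruncation S (wittMackeyAll G R M) (wittMackey S R M) (β S) ∧
          (∀ (K : Subgp H) (x : Witt ((TruncationSet.all (⊤ : Subgroup G)).restrict K.1 le_top) R M),
            β S K x (Burn.cls S ⟨K.1, le_rfl⟩) =
              trunc R M ((TruncationSet.all (⊤ : Subgroup G)).restrict K.1 le_top)
                (S.restrict K.1 K.2) (S.restrict_subset_all K.1 K.2) x) ∧
          (∀ (S' : TruncationSet H) (hS : S'.carrier ⊆ S.carrier) (K : Subgp H)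
            (x : Witt ((TruncationSet.all (⊤ : Subgroup G)).restrict K.1 le_top) R M)
            (a : Burn S K.1),
            trunc R M (S.restrict K.1 K.2) (S'.restrict K.1 K.2)
                (TruncationSet.restrict_subset hS K.1 K.2) (β S K x a) =
              β S' K x (Burn.proj S S' hS K.1 a))) := by
  refine ⟨fun S => ⟨fun K hKo hK => ?_, fun S' hS => isInduced_trunc hS, fun g S' hS =>
    isInduced_conjOp (rconj_cancel_inv H g) hS⟩, fun S hS => ?_,
    fun S K hKo hK => right_exact R M S hKo hK, fun hG => ?_⟩
  · have := finiteIndex_of_isOpen hKo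
    exact ⟨isInduced_ver hK _, isInduced_frob hK _⟩
  · have := discreteTopology_witt (R := R) (M := M) hS
    infer_instance
  · exact ⟨isMackey_wittMackey _, wittPairing R M, fun S => ⟨isMackey_wittMackey S,
      isMackeyTruncation_wittPairing R M S, wittPairing_self R M S,
      trunc_wittPairing R M S⟩⟩
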